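/- Let $d\ge 1$, $\mathbb{T}^d=\mathbb{R}^d/\mathbb{Z}^d$, $\alpha\ge 0$ with $\alpha<\frac{2}{d-2}$ if $d\ge 3$ (no upper bound on $\alpha$ if $d\le 2$), and let $1<\gamma<2$, $\frac1\gamma+\frac1{\gamma'}=1$. For a terminal time $T>0$ consider the mean-field game with congestion on $\mathbb{T}^d\times[0,T]$ $$\begin{cases} -u_t-\Delta u+m^{\alpha}H_0\left(x,\frac{Du}{m^{\alpha}}\right)+b\cdot Du=V(x,m),\\ m_t-\Delta m-\operatorname{div}\left(D_pH_0\left(x,\frac{Du}{m^{\alpha}}\right)m\right)-\operatorname{div}(bm)=0,\\ u(x,T)=\Psi(x),\quad m(x,0)=m_0(x), \end{cases}$$ where $H_0(x,p)=\sup_{v}\{-v\cdot p-L_0(x,v)\}$, under the following assumptions, with constants $C_1,c,k_0>0$ and $c_1,C_2,c_2,C,C',M_m,M_\Psi,M_b,M_V\in\mathbb{R}$. (1) $\Psi:\mathbb{T}^d\to\mathbb{R}$, $b:\mathbb{T}^d\times[0,T]\to\mathbb{R}^d$ and $V:\mathbb{T}^d\times\mathbb{R}\to\mathbb{R}$ are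 $C^\infty$ and bounded with bounded derivatives of all orders, and $|\Psi|\le M_\Psi$, $|b|\le M_b$, $|V|\le M_V$. (2) $m_0:\mathbb{T}^d\to\mathbb{R}$ is $C^\infty$, $\int_{\mathbb{T}^d}m_0\,dx=1$ and $k_0\le m_0\le M_m$. (3) $L_0:\mathbb{T}^d\times\mathbb{R}^d\to\mathbb{R}$ is $C^\infty$, $L_0\ge 0$, $v\mapsto L_0(x,v)$ is strictly convex for every $x$, and $C_1\frac{|v|^{\gamma'}}{\gamma'}-c_1\le L_0(x,v)\le C_2\frac{|v|^{\gamma'}}{\gamma'}+c_2$ for all $x,v$. (4) $p\cdot D_pH_0(x,p)-H_0(x,p)\ge c|p|^\gamma-C$ and $|D_pH_0(x,p)|\le C'|p|^{\gamma-1}+C'$ for all $x,p$. A $C^\infty$ solution is a pair $(u,m)$ of functions that are $C^\infty$ on $\mathbb{T}^d\times[0,T]$ (up to $t=0$ and $t=T$), with $m>0$, such that $D_pH_0(x,Du/m^\alpha)\,m$ is differentiable in $x$ (which is automatic if $H_0$ is $C^\infty$), the two equations hold pointwise for $0<t<T$, and the terminal and initial conditions hold. Then for every $\overline T>0$ there are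 a time $T_0\in(0,\overline T]$ and a constant $C_0$, depending only on $d,\alpha,\gamma,\overline T$ and the constants listed above, such that for every terminal time $T\in(0,\overline T]$, all data $L_0,b,V,\Psi,m_0$ satisfying (1)–(4) with these constants, and every $C^\infty$ solution $(u,m)$ of the system, $$\left\|\frac1m\right\|_{L^\infty([0,\min\{T_0,T\}]\times\mathbb{T}^d)}\le C_0 .$$ In particular, if $T\ge T_0$ then $\left\|\frac1m\right\|_{L^\infty([0,T_0]\times\mathbb{T}^d)}\le C_0$. -/

import Mathlib

open Set MeasureTheory
open scoped ContDiff Gradient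

noncomputable section

namespace CongestionMFG

/-- The Euclidean space `ℝ^d`. The torus `𝕋^d` is `ℝ^d / ℤ^d`; functions on `𝕋^d` are
`ℤ^d`-periodic functions on `ℝ^d`. -/
abbrev E (d : ℕ) := EuclideanSpace ℝ (Fin d)

/-- `f` is `ℤ^d`-periodic, i.e. it is a function on the torus `𝕋^d`. -/
def Periodic {d : ℕ} {β : Type*} (f : E d → β) : Prop :=
  ∀ (i : Fin d) (x : E d), f (x + EuclideanSpace.single i 1) = f x

/-- The unit cube, a fundamental domain of the torus `𝕋^d`. -/
def cube (d : ℕ) : Set (E d) := {x | ∀ i, x i ∈ Ico (0 : ℝ) 1}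

/-- The divergence `∑ i, ∂_i F_i` of a vector field on `ℝ^d`. -/
def divergence {d : ℕ} (F : E d → E d) (x : E d) : ℝ :=
  ∑ i, fderiv ℝ F x (EuclideanSpace.single i 1) i

/-- The Legendre transform `H₀(x,p) = sup_v (-p·v - L₀(x,v))` of the Lagrangian `L₀`. -/
def hamiltonian {d : ℕ} (L₀ : E d → E d → ℝ) (x p : E d) : ℝ :=
  ⨆ v : E d, (-inner ℝ p v - L₀ x v)

/-- The gradient `D_p H₀(x,p)` in the momentum variable. -/
def DpH {d : ℕ} (L₀ : E d → E d → ℝ) (x p : E d) : E d :=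
  ∇ (fun q => hamiltonian L₀ x q) p

/-- The data of the congestion mean-field game: Lagrangian, reference velocity, potential,
terminal cost and initial density. The conditions on them are in `Assumptions`. -/
structure Data (d : ℕ) where
  L₀ : E d → E d → ℝ
  b : E d → ℝ → E d
  V : E d → ℝ → ℝ
  Ψ : E d → ℝ
  m₀ : E d → ℝ

/-- The numerical constants that occur in `Assumptions`: those of the bounds on `L₀` and `H₀`,
a lower and an upper bound for `m₀`, and bounds for `|Ψ|`, `|b|` and `|V|`. -/
structure Constants where
  C₁ : ℝ
  c₁ : ℝ
  C₂ : ℝ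
  c₂ : ℝ
  cH : ℝ
  CH : ℝ
  CD : ℝ
  k₀ : ℝ
  Mm : ℝ
  MΨ : ℝ
  Mb : ℝ
  MV : ℝ
  C₁_pos : 0 < C₁
  cH_pos : 0 < cH
  k₀_pos : 0 < k₀

/-- The standing assumptions on the data, for the horizon `[0,T]`, the conjugate exponents
`γ, γ'` and the constants `K`. (The derivatives of `Ψ` on `𝕋^d` and of `b` on `𝕋^d × [0,T]` are
bounded by compactness, as `Ψ` and `b` are smooth up to the boundary.) -/
structure Assumptions {d : ℕ} (γ γ' : ℝ) (K : Constants) (T : ℝ) (D : Data d) : Prop where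
  Ψ_periodic : Periodic D.Ψ
  Ψ_smooth : ContDiff ℝ ∞ D.Ψ
  Ψ_bound : ∀ x, |D.Ψ x| ≤ K.MΨ
  b_periodic : ∀ t ∈ Icc 0 T, Periodic (fun x => D.b x t)
  b_smooth : ContDiffOn ℝ ∞ (fun z : E d × ℝ => D.b z.1 z.2) (univ ×ˢ Icc 0 T)
  b_bound : ∀ x, ∀ t ∈ Icc 0 T, ‖D.b x t‖ ≤ K.Mb
  V_periodic : Periodic D.V
  V_smooth : ContDiff ℝ ∞ (fun z : E d × ℝ => D.V z.1 z.2)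
  V_bound : ∀ x r, |D.V x r| ≤ K.MV
  V_deriv_bound : ∀ n : ℕ, ∃ B : ℝ, ∀ z : E d × ℝ,
    ‖iteratedFDeriv ℝ n (fun z : E d × ℝ => D.V z.1 z.2) z‖ ≤ B
  m₀_periodic : Periodic D.m₀
  m₀_smooth : ContDiff ℝ ∞ D.m₀
  m₀_integral : ∫ x in cube d, D.m₀ x = 1
  m₀_lower : ∀ x, K.k₀ ≤ D.m₀ x
  m₀_upper : ∀ x, D.m₀ x ≤ K.Mm
  L₀_periodic : Periodic D.L₀
  L₀_smooth : ContDiff ℝ ∞ (fun z : E d × E d => D.L₀ z.1 z.2)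
  L₀_convex : ∀ x, StrictConvexOn ℝ univ (D.L₀ x)
  L₀_nonneg : ∀ x v, 0 ≤ D.L₀ x v
  L₀_lower : ∀ x v, K.C₁ * (‖v‖ ^ γ' / γ') - K.c₁ ≤ D.L₀ x v
  L₀_upper : ∀ x v, D.L₀ x v ≤ K.C₂ * (‖v‖ ^ γ' / γ') + K.c₂
  H_coercive : ∀ x p, K.cH * ‖p‖ ^ γ - K.CH ≤
    inner ℝ p (DpH D.L₀ x p) - hamiltonian D.L₀ x p
  DpH_bound : ∀ x p, ‖DpH D.L₀ x p‖ ≤ K.CD * ‖p‖ ^ (γ - 1) + K.CD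

/-- The rescaled momentum `Du / m^α` at `(x,t)`. -/
def momentum {d : ℕ} (α : ℝ) (u m : E d → ℝ → ℝ) (x : E d) (t : ℝ) : E d :=
  ((m x t) ^ α)⁻¹ • ∇ (fun y => u y t) x

/-- `(u,m)`, with `m > 0`, is a `C^∞` solution on `𝕋^d × [0,T]` of
`-u_t - Δu + m^α H₀(x, Du/m^α) + b·Du = V(x,m)`,
`m_t - Δm - div(D_pH₀(x, Du/m^α) m) - div(b m) = 0`,
`u(x,T) = Ψ(x)`, `m(x,0) = m₀(x)`.
Smoothness is up to the boundary of `[0,T]`. The field `flux_differentiable`, automatic for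
smooth `H₀`, says that the divergence of the drift term exists classically. -/
structure IsSmoothSolution {d : ℕ} (α T : ℝ) (D : Data d) (u m : E d → ℝ → ℝ) : Prop where
  u_periodic : ∀ t ∈ Icc 0 T, Periodic (fun x => u x t)
  m_periodic : ∀ t ∈ Icc 0 T, Periodic (fun x => m x t)
  u_smooth : ContDiffOn ℝ ∞ (fun z : E d × ℝ => u z.1 z.2) (univ ×ˢ Icc 0 T)
  m_smooth : ContDiffOn ℝ ∞ (fun z : E d × ℝ => m z.1 z.2) (univ ×ˢ Icc 0 T)
  m_pos : ∀ x, ∀ t ∈ Icc 0 T, 0 < m x t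
  flux_differentiable : ∀ t ∈ Ioo 0 T,
    Differentiable ℝ (fun x => m x t • DpH D.L₀ x (momentum α u m x t))
  hamilton_jacobi : ∀ x, ∀ t ∈ Ioo 0 T,
    -deriv (fun s => u x s) t - Laplacian.laplacian (fun y => u y t) x
      + (m x t) ^ α * hamiltonian D.L₀ x (momentum α u m x t)
      + inner ℝ (D.b x t) (∇ (fun y => u y t) x) = D.V x (m x t)
  fokker_planck : ∀ x, ∀ t ∈ Ioo 0 T,
    deriv (fun s => m x s) t - Laplacian.laplacian (fun y => m y t) x
      - divergence (fun y => m y t • DpH D.L₀ y (momentum α u m y t)) x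
      - divergence (fun y => m y t • D.b y t) x = 0
  terminal : ∀ x, u x T = D.Ψ x
  initial : ∀ x, m x 0 = D.m₀ x

end CongestionMFG

end

/-!
The density is bounded from below by an energy method, followed by Moser iterations. Write
`q = Du / m^α` and `F = D_pH₀(x, q)`.

*Functionals.* For every smooth `P` and every exponent `ρ`, the derivative of `∫ P(u) m^ρ` is
computed from the two equations by integrations by parts on the torus
(`IsSmoothSolution.hasDerivAt_integral`); only first derivatives of `u` and `m` are left. All
estimates apply this to a suitable `P(u) m^ρ`, together with the Sobolev inequality
`exists_weighted_sobolev`, in which the weight is only in `L^p`, `α p ≤ 1 + α`. The restriction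
`α < 2 / (d - 2)` is what makes such a weight subcritical.

*Energy* (`exists_energy_bound`). By the coercivity of `p·D_pH₀ - H₀`, `∫ u m` decreases at a rate
controlling `∫ m^{1+α} |q|^γ`; as `2 (γ - 1) ≤ γ`, this absorbs the contribution of the drift `F` to
`∫ m^{1+α}`. What is left is a differential inequality for `λ ∫ u m + ∫ m^{1+α}` with damping
`-Λ ∫ m^{1+α}`, for as large a `Λ` as wanted since `∫ m = 1`. It is forward in time, whereas the
inequality for the moment `Z` of order `1 + 1/(1+α)` of `u` is backward, and both `u(·,0)` and
`m(·,T)` are unknown. Comparing the first functional minus `μ e^{ct} Z` for two values of `μ`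
closes the system (`bounds_of_coupled_inequalities`).

*Value function* (`exists_u_le`). The maximum principle bounds `u` from below. Since `m^α` is now
bounded in `L^p`, a Moser iteration backwards in time bounds `u` from above.

*Density.* In `∫ (a - u) m^{-r}` with `1 ≤ a - u ≤ κ` the factor `a - u` brings in the coercivity
once more, now to control `∫ m^{α-r} |q|^γ`. Because `γ < 2`, Young's inequality absorbs the drift
term `m^{-r} |q|^{2(γ-1)}` at the price of a power `m^{-β}`
(`IsSmoothSolution.rate_neg_rpow_m_le`). For `r = 1 + β p` this gives `y' ≤ C y^N`, hence a bound
on a short time interval whose length depends on the constants only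
(`IsSmoothSolution.integral_rpow_neg_le_of_short_time`). There, `1 + m^α + m^{-β}` is bounded in
`L^p`, and a second Moser iteration (`IsSmoothSolution.rpow_neg_le_of_integral_le`) turns the
integral bound into a pointwise one.
-/

/-! ### Periodic functions and integration over the unit cube -/

namespace CongestionMFG

variable {d : ℕ}

theorem Periodic.comp {β β' : Type*} {f : E d → β} (hf : Periodic f) (g : β → β') :
    Periodic (fun x => g (f x)) := fun i x => congrArg g (hf i x)

theorem Periodic.comp₂ {β β' β'' : Type*} {f : E d → β} {f' : E d → β'} (hf : Periodic f)
    (hf' : Periodic f') (g : β → β' → β'') : Periodic (fun x => g (f x) (f' x)) := fun i x => by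
  simp only [hf i x, hf' i x]

theorem Periodic.fderiv {F : Type*} [NormedAddCommGroup F] [NormedSpace ℝ F] {f : E d → F}
    (hf : Periodic f) : Periodic (fderiv ℝ f) := fun i x => by
  rw [← fderiv_comp_add_right]
  congr 1
  exact funext (hf i)

theorem Periodic.gradient {f : E d → ℝ} (hf : Periodic f) : Periodic (∇ f) := fun i x => by
  simp only [_root_.gradient, hf.fderiv i x]

theorem single_add (i : Fin d) (a b : ℝ) :
    EuclideanSpace.single i (a + b) = EuclideanSpace.single i a + EuclideanSpace.single i b := by
  ext j
  by_cases h : j = i <;> simp [h]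

theorem Periodic.add_natCast {β : Type*} {f : E d → β} (hf : Periodic f) (i : Fin d) (n : ℕ)
    (x : E d) : f (x + EuclideanSpace.single i (n : ℝ)) = f x := by
  induction n with
  | zero =>
    have : (EuclideanSpace.single i ((0 : ℕ) : ℝ) : E d) = 0 := by ext j; simp
    rw [this, add_zero]
  | succ n ih =>
    have : x + EuclideanSpace.single i ((n + 1 : ℕ) : ℝ)
        = (x + EuclideanSpace.single i (n : ℝ)) + EuclideanSpace.single i 1 := by
      rw [add_assoc, ← single_add]; push_cast; rfl
    rw [this, hf, ih]

theorem Periodic.add_intCast {β : Type*} {f : E d → β} (hf : Periodic f) (i : Fin d) (n : ℤ)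
    (x : E d) : f (x + EuclideanSpace.single i (n : ℝ)) = f x := by
  obtain ⟨k, rfl | rfl⟩ := n.eq_nat_or_neg
  · exact_mod_cast hf.add_natCast i k x
  · have := hf.add_natCast i k (x + EuclideanSpace.single i (((-k : ℤ)) : ℝ))
    rw [← this, add_assoc, ← single_add]
    have h0 : (EuclideanSpace.single i (((-k : ℤ) : ℝ) + (k : ℝ)) : E d) = 0 := by ext j; simp
    rw [h0, add_zero]

theorem Periodic.add_lattice {β : Type*} {f : E d → β} (hf : Periodic f) (n : Fin d → ℤ)
    (x : E d) : f (x + ∑ i, EuclideanSpace.single i (n i : ℝ)) = f x := by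
  suffices h : ∀ s : Finset (Fin d),
      f (x + ∑ i ∈ s, EuclideanSpace.single i (n i : ℝ)) = f x from h _
  intro s
  induction s using Finset.induction_on with
  | empty => simp
  | insert i s hi ih =>
    rw [Finset.sum_insert hi, add_comm (EuclideanSpace.single i _), ← add_assoc,
      hf.add_intCast, ih]

/-- The lattice vector of integer parts of the coordinates of `x`. -/
noncomputable def intPart (x : E d) : E d := ∑ i, EuclideanSpace.single i ((⌊x i⌋ : ℤ) : ℝ)

theorem intPart_apply (x : E d) (i : Fin d) : intPart x i = ⌊x i⌋ := by
  simp [intPart]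

theorem sub_intPart_mem_cube (x : E d) : x - intPart x ∈ cube d := fun i => by
  rw [PiLp.sub_apply, intPart_apply]
  exact ⟨Int.fract_nonneg _, Int.fract_lt_one _⟩

theorem Periodic.sub_intPart {β : Type*} {f : E d → β} (hf : Periodic f) (x : E d) :
    f (x - intPart x) = f x := by
  rw [← hf.add_lattice (fun i => -⌊x i⌋) x]
  congr 1
  rw [sub_eq_add_neg, intPart, ← Finset.sum_neg_distrib]
  congr 1
  refine Finset.sum_congr rfl fun i _ => ?_
  ext j
  by_cases h : j = i <;> simp [h]

theorem cube_eq_preimage (d : ℕ) :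
    cube d = WithLp.ofLp ⁻¹' (Set.pi univ fun _ : Fin d => Ico (0 : ℝ) 1) := by
  ext x; simp [cube]

theorem measurableSet_cube (d : ℕ) : MeasurableSet (cube d) := by
  rw [cube_eq_preimage]
  exact (PiLp.volume_preserving_ofLp (Fin d)).measurable
    (MeasurableSet.univ_pi fun _ => measurableSet_Ico)

theorem volume_cube (d : ℕ) : volume (cube d) = 1 := by
  rw [cube_eq_preimage, (PiLp.volume_preserving_ofLp (Fin d)).measure_preimage
    (MeasurableSet.univ_pi fun _ => measurableSet_Ico).nullMeasurableSet, Real.volume_pi_Ico]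
  simp

instance : IsProbabilityMeasure (volume.restrict (cube d)) :=
  ⟨by simp [volume_cube]⟩

/-- The closed unit cube. -/
def closedCube (d : ℕ) : Set (E d) := {x | ∀ i, x i ∈ Icc (0 : ℝ) 1}

theorem cube_subset_closedCube (d : ℕ) : cube d ⊆ closedCube d :=
  fun _ hx i => ⟨(hx i).1, (hx i).2.le⟩

theorem closedCube_eq_preimage (d : ℕ) :
    closedCube d = WithLp.ofLp ⁻¹' (Icc (0 : Fin d → ℝ) 1) := by
  ext x; simp [closedCube, Pi.le_def, forall_and]

theorem isCompact_closedCube (d : ℕ) : IsCompact (closedCube d) := by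
  have h : closedCube d = (EuclideanSpace.equiv (Fin d) ℝ).symm '' (Icc (0 : Fin d → ℝ) 1) := by
    rw [ContinuousLinearEquiv.image_symm_eq_preimage, closedCube_eq_preimage]; rfl
  rw [h]
  exact isCompact_Icc.image (EuclideanSpace.equiv (Fin d) ℝ).symm.continuous

theorem closedCube_ae_eq_cube (d : ℕ) : closedCube d =ᵐ[volume] cube d := by
  rw [cube_eq_preimage, closedCube_eq_preimage]
  exact (PiLp.volume_preserving_ofLp (Fin d)).quasiMeasurePreserving.preimage_ae_eq
    (Measure.univ_pi_Ico_ae_eq_Icc (μ := fun _ : Fin d => (volume : Measure ℝ))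
      (f := 0) (g := 1)).symm

theorem integrableOn_cube {F : Type*} [NormedAddCommGroup F] {f : E d → F} (hf : Continuous f) :
    IntegrableOn f (cube d) :=
  (hf.continuousOn.integrableOn_compact (isCompact_closedCube d)).mono_set
    (cube_subset_closedCube d)

theorem integral_cube_mono {f g : E d → ℝ} (hf : Continuous f) (hg : Continuous g)
    (h : ∀ x, f x ≤ g x) : ∫ x in cube d, f x ≤ ∫ x in cube d, g x :=
  setIntegral_mono (integrableOn_cube hf) (integrableOn_cube hg) h

theorem integral_cube_nonneg {f : E d → ℝ} (h : ∀ x, 0 ≤ f x) : 0 ≤ ∫ x in cube d, f x :=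
  integral_nonneg h

theorem integral_cube_const (c : ℝ) : ∫ _ in cube d, c = c := by simp

/-- A continuous periodic function on the torus attains its values on the compact closed cube,
so a bound there is a bound everywhere. -/
theorem Periodic.forall_of_closedCube {f : E d → ℝ} (hf : Periodic f) {P : ℝ → Prop}
    (h : ∀ x ∈ closedCube d, P (f x)) (x : E d) : P (f x) := by
  rw [← hf.sub_intPart x]
  exact h _ (cube_subset_closedCube d (sub_intPart_mem_cube x))

theorem continuous_gradient {f : E d → ℝ} (hf : ContDiff ℝ 1 f) : Continuous (∇ f) :=
  (InnerProductSpace.toDual ℝ (E d)).symm.continuous.comp (hf.continuous_fderiv one_ne_zero)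

theorem contDiff_gradient {f : E d → ℝ} {n : WithTop ℕ∞} {k : WithTop ℕ∞} (hf : ContDiff ℝ k f)
    (h : n + 1 ≤ k) : ContDiff ℝ n (∇ f) :=
  (InnerProductSpace.toDual ℝ (E d)).symm.contDiff.comp (hf.fderiv_right h)

theorem gradient_apply (f : E d → ℝ) (x : E d) (i : Fin d) :
    (∇ f) x i = fderiv ℝ f x (EuclideanSpace.single i 1) := by
  rw [← inner_gradient_left, EuclideanSpace.inner_single_right]
  simp

theorem norm_gradient (f : E d → ℝ) (x : E d) : ‖(∇ f) x‖ = ‖fderiv ℝ f x‖ :=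
  (InnerProductSpace.toDual ℝ (E d)).symm.norm_map _

/-- The divergence theorem on the torus. Only differentiability of the field and continuity of
its divergence are required. -/
theorem integral_divergence_eq_zero (hd : 1 ≤ d) {F : E d → E d} (hF : Differentiable ℝ F)
    (hper : Periodic F) (hdiv : Continuous (divergence F)) :
    ∫ x in cube d, divergence F x = 0 := by
  obtain ⟨n, rfl⟩ : ∃ n, d = n + 1 := ⟨d - 1, by omega⟩
  let e := EuclideanSpace.equiv (Fin (n + 1)) ℝ
  let f : (Fin (n + 1) → ℝ) → Fin (n + 1) → ℝ := fun y => e (F (e.symm y))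
  let f' : (Fin (n + 1) → ℝ) → (Fin (n + 1) → ℝ) →L[ℝ] (Fin (n + 1) → ℝ) := fun y =>
    (e : E (n + 1) →L[ℝ] (Fin (n + 1) → ℝ)).comp ((fderiv ℝ F (e.symm y)).comp
      (e.symm : (Fin (n + 1) → ℝ) →L[ℝ] E (n + 1)))
  have hf' : ∀ y, HasFDerivAt f (f' y) y := fun y =>
    e.hasFDerivAt.comp y ((hF (e.symm y)).hasFDerivAt.comp y e.symm.hasFDerivAt)
  have hsum : ∀ y, ∑ i, f' y (Pi.single i 1) i = divergence F (e.symm y) := fun y => rfl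
  have key := integral_divergence_of_hasFDerivAt_off_countable (0 : Fin (n + 1) → ℝ) 1
    zero_le_one f f' ∅ countable_empty (fun y _ => (hf' y).continuousAt.continuousWithinAt)
    (fun y _ => hf' y) (by
      simp only [hsum]
      exact (hdiv.comp e.symm.continuous).continuousOn.integrableOn_compact isCompact_Icc)
  simp only [hsum] at key
  have hface : ∀ (i : Fin (n + 1)) (x : Fin n → ℝ),
      f (i.insertNth ((1 : Fin (n + 1) → ℝ) i) x) i
        = f (i.insertNth ((0 : Fin (n + 1) → ℝ) i) x) i := by
    intro i x
    have : e.symm (i.insertNth ((1 : Fin (n + 1) → ℝ) i) x)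
        = e.symm (i.insertNth ((0 : Fin (n + 1) → ℝ) i) x) + EuclideanSpace.single i 1 := by
      ext j
      change i.insertNth (α := fun _ => ℝ) ((1 : Fin (n + 1) → ℝ) i) x j
        = i.insertNth (α := fun _ => ℝ) ((0 : Fin (n + 1) → ℝ) i) x j
          + EuclideanSpace.single i (1 : ℝ) j
      refine Fin.succAboveCases i ?_ (fun k => ?_) j
      · simp
      · simp
    simp only [f, this, hper i]
  simp only [hface, sub_self, Finset.sum_const_zero] at key
  rw [← setIntegral_congr_set (closedCube_ae_eq_cube _), closedCube_eq_preimage, ← key]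
  exact (PiLp.volume_preserving_ofLp (Fin (n + 1))).setIntegral_preimage_emb
    (MeasurableEquiv.toLp 2 (Fin (n + 1) → ℝ)).symm.measurableEmbedding
    (fun y => divergence F (e.symm y)) (Icc 0 1)

theorem divergence_smul {φ : E d → ℝ} {F : E d → E d} {x : E d} (hφ : DifferentiableAt ℝ φ x)
    (hF : DifferentiableAt ℝ F x) : divergence (fun y => φ y • F y) x
      = φ x * divergence F x + inner ℝ ((∇ φ) x) (F x) := by
  simp only [divergence, fderiv_fun_smul hφ hF]
  simp only [add_apply, smul_apply,
    ContinuousLinearMap.smulRight_apply, PiLp.add_apply, PiLp.smul_apply, smul_eq_mul,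
    Finset.sum_add_distrib, Finset.mul_sum]
  congr 1
  rw [PiLp.inner_apply]
  refine Finset.sum_congr rfl fun i _ => ?_
  rw [gradient_apply]
  simp [mul_comm]

/-- Integration by parts on the torus. -/
theorem integral_mul_divergence (hd : 1 ≤ d) {φ : E d → ℝ} {F : E d → E d}
    (hφ : ContDiff ℝ 1 φ) (hφp : Periodic φ) (hF : Differentiable ℝ F) (hFp : Periodic F)
    (hdiv : Continuous (divergence F)) :
    ∫ x in cube d, φ x * divergence F x = -∫ x in cube d, inner ℝ ((∇ φ) x) (F x) := by
  have hd1 := hφ.differentiable one_ne_zero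
  have heq : divergence (fun y => φ y • F y)
      = fun x => φ x * divergence F x + inner ℝ ((∇ φ) x) (F x) :=
    funext fun x => divergence_smul (hd1 x) (hF x)
  have hc1 : Continuous fun x => φ x * divergence F x := hφ.continuous.mul hdiv
  have hc2 : Continuous fun x => (inner ℝ ((∇ φ) x) (F x) : ℝ) :=
    (continuous_gradient hφ).inner hF.continuous
  have := integral_divergence_eq_zero hd (F := fun y => φ y • F y) (hd1.smul hF)
    (hφp.comp₂ hFp (fun a b => a • b)) (by rw [heq]; exact hc1.add hc2)
  rw [heq, integral_add (integrableOn_cube hc1) (integrableOn_cube hc2)] at this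
  linarith

theorem iteratedFDeriv_two_eq_divergence_summand {f : E d → ℝ} (hf : ContDiff ℝ 2 f) (x : E d)
    (i : Fin d) : iteratedFDeriv ℝ 2 f x ![EuclideanSpace.single i 1, EuclideanSpace.single i 1]
      = fderiv ℝ (∇ f) x (EuclideanSpace.single i 1) i := by
  have hdf : DifferentiableAt ℝ (fderiv ℝ f) x :=
    (hf.fderiv_right (m := 1) (by norm_num)).differentiable one_ne_zero x
  have hg : DifferentiableAt ℝ (∇ f) x :=
    (contDiff_gradient (n := 1) hf (by norm_num)).differentiable one_ne_zero x
  have h1 : HasFDerivAt (fun y => (∇ f) y i) _ x :=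
    ((EuclideanSpace.proj (𝕜 := ℝ) i).hasFDerivAt).comp x hg.hasFDerivAt
  simp only [gradient_apply] at h1
  have h2 := hdf.hasFDerivAt.clm_apply
    (hasFDerivAt_const (EuclideanSpace.single i (1 : ℝ) : E d) x)
  have h3 := congrArg (fun ℓ => ℓ (EuclideanSpace.single i 1)) (h1.unique h2)
  rw [iteratedFDeriv_two_apply]
  simpa using h3.symm

theorem laplacian_eq_divergence {f : E d → ℝ} (hf : ContDiff ℝ 2 f) (x : E d) :
    Laplacian.laplacian f x = divergence (∇ f) x := by
  rw [InnerProductSpace.laplacian_eq_iteratedFDeriv_orthonormalBasis f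
    (EuclideanSpace.basisFun (Fin d) ℝ), divergence]
  refine Finset.sum_congr rfl fun i _ => ?_
  simpa using iteratedFDeriv_two_eq_divergence_summand hf x i

theorem continuous_divergence {F : E d → E d} (hF : ContDiff ℝ 1 F) : Continuous (divergence F) :=
  continuous_finsetSum _ fun i _ =>
    (EuclideanSpace.proj (𝕜 := ℝ) i).continuous.comp
      ((hF.continuous_fderiv one_ne_zero).clm_apply continuous_const)

/-- At a minimum the gradient vanishes and the Laplacian is nonnegative. -/
theorem laplacian_nonneg_of_isMinOn {f : E d → ℝ} (hf : ContDiff ℝ 2 f) {x : E d}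
    (hx : ∀ y, f x ≤ f y) : (∇ f) x = 0 ∧ 0 ≤ Laplacian.laplacian f x := by
  have hgrad : fderiv ℝ f x = 0 :=
    IsLocalMin.fderiv_eq_zero (Filter.Eventually.of_forall hx)
  refine ⟨by simp [gradient, hgrad], ?_⟩
  rw [laplacian_eq_divergence hf]
  refine Finset.sum_nonneg fun i _ => ?_
  set e : E d := EuclideanSpace.single i 1
  let g : ℝ → ℝ := fun s => f (x + s • e)
  have hline : ∀ s : ℝ, HasDerivAt (fun s : ℝ => x + s • e) e s := fun s => by
    simpa using ((hasDerivAt_id s).smul_const e).const_add x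
  have hg1 : deriv g = fun s => (∇ f) (x + s • e) i := by
    funext s
    rw [gradient_apply]
    exact (((hf.differentiable two_ne_zero _).hasFDerivAt).comp_hasDerivAt s (hline s)).deriv
  have hgd : Differentiable ℝ (∇ f) := (contDiff_gradient (n := 1) hf (by norm_num)).differentiable
    one_ne_zero
  have hg2 : deriv (deriv g) 0 = fderiv ℝ (∇ f) x e i := by
    rw [hg1]
    have h1 : HasFDerivAt (∇ f) (fderiv ℝ (∇ f) x) (x + (0 : ℝ) • e) := by
      simpa using (hgd x).hasFDerivAt
    have h2 := h1.comp_hasDerivAt (0 : ℝ) (hline 0)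
    exact (((EuclideanSpace.proj (𝕜 := ℝ) i).hasFDerivAt).comp_hasDerivAt (0 : ℝ) h2).deriv
  rw [← hg2]
  by_contra! hneg
  have hg0 : deriv g 0 = 0 := by rw [hg1]; simp [gradient, hgrad]
  have hcont : ContinuousAt g 0 := by
    have : Continuous g := hf.continuous.comp (by fun_prop)
    exact this.continuousAt
  -- a point that is both a local minimum and a local maximum has a constant neighbourhood
  have hmax := isLocalMax_of_deriv_deriv_neg hneg hg0 hcont
  have hconst : g =ᶠ[nhds 0] fun _ => g 0 := by
    filter_upwards [hmax] with s hs
    exact le_antisymm hs (by simpa [g] using hx _)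
  have h3 : deriv g =ᶠ[nhds 0] fun _ => 0 := by
    filter_upwards [hconst.eventuallyEq_nhds] with s hs
    rw [hs.deriv_eq]; simp
  rw [h3.deriv_eq] at hneg
  simp at hneg

end CongestionMFG

/-! ### Sobolev inequalities on the torus -/

namespace CongestionMFG

open scoped ENNReal NNReal

variable {d : ℕ}

theorem lintegral_cube_ofReal {f : E d → ℝ} (hf : Continuous f) (h : ∀ x, 0 ≤ f x) :
    ∫⁻ x in cube d, ENNReal.ofReal (f x) = ENNReal.ofReal (∫ x in cube d, f x) :=
  (ofReal_integral_eq_lintegral_ofReal (integrableOn_cube hf)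
    (Filter.Eventually.of_forall h)).symm

theorem floor_coord_mem_Icc {R : ℝ} {x : E d} (hx : ‖x‖ < R) (i : Fin d) :
    ⌊x i⌋ ∈ Finset.Icc (-⌈R⌉ - 1) (⌈R⌉) := by
  have h1 : |x i| < R := lt_of_le_of_lt (by simpa using PiLp.norm_apply_le x i) hx
  have h2 := abs_lt.1 h1
  have h3 := Int.le_ceil R
  have h4 := Int.floor_le (x i)
  have h5 := Int.lt_floor_add_one (x i)
  rw [Finset.mem_Icc]
  constructor
  · have : ((-⌈R⌉ - 1 : ℤ) : ℝ) < (⌊x i⌋ : ℤ) + 1 := by push_cast; linarith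
    have : (-⌈R⌉ - 1 : ℤ) < ⌊x i⌋ + 1 := by exact_mod_cast this
    omega
  · have : ((⌊x i⌋ : ℤ) : ℝ) < ⌈R⌉ := by linarith
    exact (Int.cast_lt.1 this).le

theorem sq_integral_le_integral_sq {X : Type*} [MeasurableSpace X] {μ : Measure X}
    [IsProbabilityMeasure μ] {f : X → ℝ} (hf : Integrable f μ)
    (hf2 : Integrable (fun x => f x ^ 2) μ) : (∫ x, f x ∂μ) ^ 2 ≤ ∫ x, f x ^ 2 ∂μ := by
  set J := ∫ x, f x ∂μ with hJ
  have h1 : ∫ x, (f x ^ 2 - 2 * J * f x + J ^ 2) ∂μ = (∫ x, f x ^ 2 ∂μ) - 2 * J * J + J ^ 2 := by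
    have h2 : Integrable (fun x => 2 * J * f x) μ := hf.const_mul _
    have h3 : Integrable (fun x => f x ^ 2 - 2 * J * f x) μ := hf2.sub h2
    rw [integral_add h3 (integrable_const _), integral_sub hf2 h2, integral_const_mul]
    simp [← hJ]
  have h4 : 0 ≤ ∫ x, (f x ^ 2 - 2 * J * f x + J ^ 2) ∂μ :=
    integral_nonneg fun x => show 0 ≤ f x ^ 2 - 2 * J * f x + J ^ 2 by
      nlinarith [sq_nonneg (f x - J)]
  rw [h1] at h4
  linarith

/-- A ball is covered by finitely many translates of the unit cube. -/
theorem exists_lintegral_ball_le (d : ℕ) (R : ℝ) : ∃ N : ℕ, ∀ h : E d → ℝ≥0∞, Measurable h →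
    Periodic h → ∫⁻ x in Metric.ball 0 R, h x ≤ N * ∫⁻ x in cube d, h x := by
  classical
  let S : Finset (Fin d → ℤ) := Fintype.piFinset fun _ => Finset.Icc (-⌈R⌉ - 1) ⌈R⌉
  let v : (Fin d → ℤ) → E d := fun n => ∑ i, EuclideanSpace.single i (n i : ℝ)
  refine ⟨S.card, fun h hm hp => ?_⟩
  have hcover : Metric.ball (0 : E d) R ⊆ ⋃ n : S, (fun x => x - v n) ⁻¹' cube d := by
    intro x hx
    have hx' : ‖x‖ < R := by simpa using hx
    simp only [mem_iUnion]
    exact ⟨⟨fun i => ⌊x i⌋, Fintype.mem_piFinset.2 fun i => floor_coord_mem_Icc hx' i⟩,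
      sub_intPart_mem_cube x⟩
  have htrans : ∀ n, ∫⁻ x in (fun x => x - v n) ⁻¹' cube d, h x = ∫⁻ x in cube d, h x := by
    intro n
    rw [← (measurePreserving_sub_right volume (v n)).setLIntegral_comp_preimage
      (measurableSet_cube d) hm]
    refine lintegral_congr fun x => ?_
    have := hp.add_lattice n (x - v n)
    rw [sub_add_cancel] at this
    exact this
  calc ∫⁻ x in Metric.ball 0 R, h x
      ≤ ∫⁻ x in ⋃ n : S, (fun x => x - v n) ⁻¹' cube d, h x := lintegral_mono_set hcover
    _ ≤ ∑' n : S, ∫⁻ x in (fun x => x - v n) ⁻¹' cube d, h x := lintegral_iUnion_le _ _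
    _ = S.card * ∫⁻ x in cube d, h x := by simp [htrans, tsum_fintype]

theorem norm_le_of_mem_closedCube {x : E d} (hx : x ∈ closedCube d) : ‖x‖ ≤ d := by
  have h1 : x = ∑ i, EuclideanSpace.single i (x i) := by
    ext j; simp
  calc ‖x‖ = ‖∑ i, EuclideanSpace.single i (x i)‖ := by rw [← h1]
    _ ≤ ∑ i, ‖(EuclideanSpace.single i (x i) : E d)‖ := norm_sum_le _ _
    _ ≤ ∑ _i : Fin d, (1 : ℝ) := Finset.sum_le_sum fun i _ => by
        simpa [abs_of_nonneg (hx i).1] using (hx i).2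
    _ = d := by simp

/-- A cut-off of a periodic function: it agrees with the function on the unit cube, vanishes
outside a ball, and its derivative is controlled pointwise by the function and its gradient. -/
theorem exists_cutoff (d : ℕ) : ∃ M : ℝ, 0 ≤ M ∧ ∀ f : E d → ℝ, ContDiff ℝ 1 f →
    ∃ g : E d → ℝ, ContDiff ℝ 1 g ∧ (∀ x ∈ cube d, g x = f x) ∧
      (∀ x ∉ Metric.ball (0 : E d) (d + 2), g x = 0 ∧ fderiv ℝ g x = 0) ∧
      ∀ x, ‖fderiv ℝ g x‖ ^ 2 ≤ M * (f x ^ 2 + ‖(∇ f) x‖ ^ 2) := by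
  let χ : ContDiffBump (0 : E d) := ⟨d + 1, d + 2, by positivity, by linarith⟩
  have hχ : ContDiff ℝ 1 χ := χ.contDiff
  obtain ⟨M, hM⟩ : ∃ M : ℝ, ∀ x, ‖fderiv ℝ χ x‖ ≤ M :=
    (hχ.continuous_fderiv one_ne_zero).bounded_above_of_compact_support
      (χ.hasCompactSupport.fderiv ℝ)
  have hM0 : 0 ≤ M := (norm_nonneg _).trans (hM 0)
  refine ⟨2 * (1 + M) ^ 2, by positivity, fun f hf => ⟨fun x => χ x * f x, hχ.mul hf, ?_, ?_, ?_⟩⟩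
  · intro x hx
    have : χ x = 1 := χ.one_of_mem_closedBall (by
      have := norm_le_of_mem_closedCube (cube_subset_closedCube d hx)
      simp only [Metric.mem_closedBall, dist_zero_right]
      change ‖x‖ ≤ (d : ℝ) + 1
      linarith)
    simp [this]
  · intro x hx
    have h1 : ∀ y, χ y = 0 → fderiv ℝ χ y = 0 := fun y hy =>
      IsLocalMin.fderiv_eq_zero (Filter.Eventually.of_forall fun z => by
        simpa [hy] using χ.nonneg)
    have h0 : χ x = 0 := by
      by_contra h
      have h2 : x ∈ Function.support χ := h
      rw [χ.support_eq] at h2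
      exact hx h2
    refine ⟨by simp [h0], ?_⟩
    rw [fderiv_fun_mul (hχ.differentiable one_ne_zero x) (hf.differentiable one_ne_zero x), h0,
      h1 x h0]
    simp
  · intro x
    have h3 : ‖fderiv ℝ (fun x => χ x * f x) x‖ ≤ (1 + M) * (|f x| + ‖(∇ f) x‖) := by
      rw [fderiv_fun_mul (hχ.differentiable one_ne_zero x) (hf.differentiable one_ne_zero x),
        norm_gradient]
      refine (norm_add_le _ _).trans ?_
      rw [norm_smul, norm_smul, Real.norm_eq_abs, Real.norm_eq_abs, abs_of_nonneg χ.nonneg]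
      have := mul_le_mul_of_nonneg_right (χ.le_one (x := x)) (norm_nonneg (fderiv ℝ f x))
      have := mul_le_mul_of_nonneg_left (hM x) (abs_nonneg (f x))
      nlinarith [abs_nonneg (f x), norm_nonneg (fderiv ℝ f x),
        mul_nonneg hM0 (norm_nonneg (fderiv ℝ f x))]
    calc ‖fderiv ℝ (fun x => χ x * f x) x‖ ^ 2 ≤ ((1 + M) * (|f x| + ‖(∇ f) x‖)) ^ 2 :=
          pow_le_pow_left₀ (norm_nonneg _) h3 2
      _ ≤ 2 * (1 + M) ^ 2 * (f x ^ 2 + ‖(∇ f) x‖ ^ 2) := by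
          rw [mul_pow, ← sq_abs (f x)]
          nlinarith [mul_nonneg (sq_nonneg (1 + M)) (sq_nonneg (|f x| - ‖(∇ f) x‖))]

/-- Sobolev's inequality on the torus in dimension at least two, deduced from the
Gagliardo-Nirenberg-Sobolev inequality on the whole space by means of a cut-off function. -/
theorem exists_sobolev_of_two_le {p q : ℝ≥0} (hp : 1 ≤ p) (hp2 : p ≤ 2)
    (hpd : p < (d : ℝ≥0)) (hpq : (p : ℝ)⁻¹ - (d : ℝ)⁻¹ ≤ (q : ℝ)⁻¹) :
    ∃ C : ℝ, 0 ≤ C ∧ ∀ f : E d → ℝ, ContDiff ℝ 1 f → Periodic f →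
      eLpNorm f q (volume.restrict (cube d)) ^ 2
        ≤ ENNReal.ofReal (C * ∫ x in cube d, (f x ^ 2 + ‖(∇ f) x‖ ^ 2)) := by
  obtain ⟨M, hM0, hM⟩ := exists_cutoff d
  obtain ⟨N, hN⟩ := exists_lintegral_ball_le d ((d : ℝ) + 2)
  obtain ⟨C0, hC0⟩ : ∃ C0 : ℝ≥0, ∀ g : E d → ℝ, ContDiff ℝ 1 g →
      Function.support g ⊆ Metric.ball 0 (d + 2) →
      eLpNorm g q volume ≤ C0 * eLpNorm (fderiv ℝ g) p volume := by
    have hfin : Module.finrank ℝ (E d) = d := by simp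
    exact ⟨_, fun g hg hs => eLpNorm_le_eLpNorm_fderiv_of_le volume hg hs hp
      (by rw [hfin]; exact hpd) (by rw [hfin]; exact hpq) Metric.isBounded_ball⟩
  set s : Set (E d) := Metric.ball 0 (d + 2) with hs
  obtain ⟨C1, hC1⟩ : ∃ C1 : ℝ≥0, ∀ G : E d → (E d →L[ℝ] ℝ), Continuous G →
      eLpNorm G p (volume.restrict s) ≤ eLpNorm G 2 (volume.restrict s) * C1 := by
    have hfin : volume s ^ (1 / (p : ℝ≥0∞).toReal - 1 / (2 : ℝ≥0∞).toReal) ≠ ⊤ := by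
      refine ENNReal.rpow_ne_top_of_nonneg ?_ measure_ball_lt_top.ne
      have h1 : (p : ℝ) ≤ 2 := by exact_mod_cast hp2
      have h2 : (1 : ℝ) ≤ p := by exact_mod_cast hp
      simp only [ENNReal.coe_toReal, ENNReal.toReal_ofNat]
      rw [sub_nonneg]
      exact one_div_le_one_div_of_le (by linarith) h1
    refine ⟨(volume s ^ (1 / (p : ℝ≥0∞).toReal - 1 / (2 : ℝ≥0∞).toReal)).toNNReal, fun G hG => ?_⟩
    have := eLpNorm_le_eLpNorm_mul_rpow_measure_univ (μ := volume.restrict s) (p := (p : ℝ≥0∞))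
      (q := 2) (by exact_mod_cast hp2) hG.aestronglyMeasurable
    rw [ENNReal.coe_toNNReal hfin]
    simpa using this
  refine ⟨((C0 : ℝ) * C1) ^ 2 * (N * M), by positivity, fun f hf hper => ?_⟩
  obtain ⟨g, hg, hgf, hg0, hgrad⟩ := hM f hf
  have hcont := hg.continuous_fderiv one_ne_zero
  have hsupp : Function.support (fderiv ℝ g) ⊆ s := fun x hx => by
    by_contra h
    exact hx (hg0 x h).2
  have hres : eLpNorm (fderiv ℝ g) p volume = eLpNorm (fderiv ℝ g) p (volume.restrict s) := by
    rw [eLpNorm_restrict_eq_of_support_subset (ε := E d →L[ℝ] ℝ) hsupp]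
  have hsq : eLpNorm (fderiv ℝ g) 2 (volume.restrict s) ^ 2
      = ∫⁻ x in s, ENNReal.ofReal (‖fderiv ℝ g x‖ ^ 2) := by
    have := eLpNorm_nnreal_pow_eq_lintegral (f := fderiv ℝ g) (μ := volume.restrict s)
      (p := (2 : ℝ≥0)) two_ne_zero
    simp only [NNReal.coe_ofNat, ENNReal.coe_ofNat, ENNReal.rpow_ofNat] at this
    rw [this]
    refine lintegral_congr fun x => ?_
    rw [ENNReal.ofReal_pow (norm_nonneg _), ofReal_norm]
  have hFc : Continuous fun x => M * (f x ^ 2 + ‖(∇ f) x‖ ^ 2) :=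
    continuous_const.mul ((hf.continuous.pow 2).add ((continuous_gradient hf).norm.pow 2))
  have hint : ∫⁻ x in s, ENNReal.ofReal (‖fderiv ℝ g x‖ ^ 2)
      ≤ ENNReal.ofReal (N * M * ∫ x in cube d, (f x ^ 2 + ‖(∇ f) x‖ ^ 2)) := by
    calc ∫⁻ x in s, ENNReal.ofReal (‖fderiv ℝ g x‖ ^ 2)
        ≤ ∫⁻ x in s, ENNReal.ofReal (M * (f x ^ 2 + ‖(∇ f) x‖ ^ 2)) :=
          lintegral_mono fun x => ENNReal.ofReal_le_ofReal (hgrad x)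
      _ ≤ N * ∫⁻ x in cube d, ENNReal.ofReal (M * (f x ^ 2 + ‖(∇ f) x‖ ^ 2)) :=
          hN _ (hFc.measurable.ennreal_ofReal)
            (hper.comp₂ hper.gradient (fun a b => ENNReal.ofReal (M * (a ^ 2 + ‖b‖ ^ 2))))
      _ = _ := by
          rw [lintegral_cube_ofReal hFc (fun x => by positivity), integral_const_mul,
            mul_assoc (N : ℝ), ENNReal.ofReal_mul (p := (N : ℝ)) (by positivity),
            ENNReal.ofReal_natCast]
  have hlow : eLpNorm f q (volume.restrict (cube d)) ≤ eLpNorm g q volume := by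
    have h1 : eLpNorm f q (volume.restrict (cube d)) = eLpNorm g q (volume.restrict (cube d)) := by
      refine eLpNorm_congr_ae ?_
      filter_upwards [ae_restrict_mem (measurableSet_cube d)] with x hx
      exact (hgf x hx).symm
    rw [h1]
    exact eLpNorm_mono_measure _ Measure.restrict_le_self
  have hgns := hC0 g hg (Function.support_subset_iff'.2 fun x hx => (hg0 x hx).1)
  calc eLpNorm f q (volume.restrict (cube d)) ^ 2
      ≤ (C0 * (eLpNorm (fderiv ℝ g) 2 (volume.restrict s) * C1)) ^ 2 := by
        gcongr
        refine hlow.trans (hgns.trans ?_)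
        gcongr
        exact hres.le.trans (hC1 _ hcont)
    _ = (C0 * C1) ^ 2 * ∫⁻ x in s, ENNReal.ofReal (‖fderiv ℝ g x‖ ^ 2) := by
        rw [← hsq]; ring
    _ ≤ (C0 * C1) ^ 2 * ENNReal.ofReal (N * M * ∫ x in cube d, (f x ^ 2 + ‖(∇ f) x‖ ^ 2)) := by
        gcongr
    _ = _ := by
        rw [mul_assoc (((C0 : ℝ) * C1) ^ 2), ENNReal.ofReal_mul (p := ((C0 : ℝ) * C1) ^ 2)
          (by positivity), ENNReal.ofReal_pow (by positivity),
          ENNReal.ofReal_mul (p := (C0 : ℝ)) (by positivity), ENNReal.ofReal_coe_nnreal,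
          ENNReal.ofReal_coe_nnreal]

theorem integral_cube_one (F : E 1 → ℝ) :
    ∫ x in cube 1, F x = ∫ s in Ico (0 : ℝ) 1, F (EuclideanSpace.single 0 s) := by
  have hmp : MeasurePreserving (fun x : E 1 => x 0) volume volume :=
    (volume_preserving_funUnique (Fin 1) ℝ).comp (PiLp.volume_preserving_ofLp (Fin 1))
  have hemb : MeasurableEmbedding (fun x : E 1 => x 0) :=
    (((MeasurableEquiv.toLp 2 (Fin 1 → ℝ)).symm).trans
      (MeasurableEquiv.funUnique (Fin 1) ℝ)).measurableEmbedding
  have hpre : cube 1 = (fun x : E 1 => x 0) ⁻¹' Ico (0 : ℝ) 1 := by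
    ext x; simp [cube]
  rw [hpre, ← hmp.setIntegral_preimage_emb hemb]
  refine integral_congr_ae (Filter.Eventually.of_forall fun x => ?_)
  change F x = F (EuclideanSpace.single 0 (x 0))
  congr 1
  ext j
  fin_cases j
  simp

/-- In dimension one the Sobolev norm controls the supremum. -/
theorem sq_le_sobolev_of_dim_one {f : E 1 → ℝ} (hf : ContDiff ℝ 1 f) (hper : Periodic f)
    (x : E 1) : f x ^ 2 ≤ 2 * ∫ y in cube 1, (f y ^ 2 + ‖(∇ f) y‖ ^ 2) := by
  let g : ℝ → ℝ := fun s => f (EuclideanSpace.single 0 s)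
  have hline : ∀ s : ℝ, HasDerivAt (fun s : ℝ => (EuclideanSpace.single 0 s : E 1))
      (EuclideanSpace.single 0 1) s := fun s => by
    have h : (fun s : ℝ => (EuclideanSpace.single 0 s : E 1))
        = fun s : ℝ => s • (EuclideanSpace.single 0 1 : E 1) := by
      funext s; ext j; fin_cases j; simp
    rw [h]
    simpa using (hasDerivAt_id s).smul_const (EuclideanSpace.single 0 1 : E 1)
  let g' : ℝ → ℝ := fun s => fderiv ℝ f (EuclideanSpace.single 0 s) (EuclideanSpace.single 0 1)
  have hg : ∀ s, HasDerivAt g (g' s) s := fun s =>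
    ((hf.differentiable one_ne_zero _).hasFDerivAt).comp_hasDerivAt s (hline s)
  have hcl : Continuous fun s : ℝ => (EuclideanSpace.single 0 s : E 1) :=
    continuous_iff_continuousAt.2 fun s => (hline s).continuousAt
  have hgc : Continuous g := hf.continuous.comp hcl
  have hg'c : Continuous g' := ((hf.continuous_fderiv one_ne_zero).comp hcl).clm_apply
    continuous_const
  have hg'n : ∀ s, |g' s| ≤ ‖(∇ f) (EuclideanSpace.single 0 s)‖ := fun s => by
    have := (fderiv ℝ f (EuclideanSpace.single 0 s)).le_opNorm (EuclideanSpace.single 0 1)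
    rw [norm_gradient]
    simpa using this
  have hii : ∀ {h : ℝ → ℝ}, Continuous h → IntegrableOn h (Ico (0 : ℝ) 1) := fun hh =>
    (hh.continuousOn.integrableOn_compact isCompact_Icc).mono_set Ico_subset_Icc_self
  have hone : IsProbabilityMeasure (volume.restrict (Ico (0 : ℝ) 1)) := ⟨by simp⟩
  have hsum : ∫ y in cube 1, (f y ^ 2 + ‖(∇ f) y‖ ^ 2)
      = ∫ s in Ico (0 : ℝ) 1, (g s ^ 2 + ‖(∇ f) (EuclideanSpace.single 0 s)‖ ^ 2) :=
    integral_cube_one _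
  have hgg : Continuous fun s : ℝ => ‖(∇ f) (EuclideanSpace.single 0 s)‖ ^ 2 :=
    ((continuous_gradient hf).comp hcl).norm.pow 2
  refine hper.forall_of_closedCube (P := fun r => r ^ 2 ≤ _) (fun x hx => ?_) x
  have hx0 : x = EuclideanSpace.single 0 (x 0) := by ext j; fin_cases j; simp
  set a := x 0 with ha_def
  have ha : a ∈ Icc (0 : ℝ) 1 := hx 0
  have hb : ∀ b ∈ Ico (0 : ℝ) 1, |g a| ≤ |g b| + ∫ s in Ico (0 : ℝ) 1, |g' s| := by
    intro b hb
    have hftc : ∫ s in b..a, g' s = g a - g b :=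
      intervalIntegral.integral_eq_sub_of_hasDerivAt (fun s _ => hg s)
        (hg'c.intervalIntegrable _ _)
    have h1 : |g a - g b| ≤ ∫ s in Ico (0 : ℝ) 1, |g' s| := by
      rw [← hftc, ← Real.norm_eq_abs]
      refine intervalIntegral.norm_integral_le_integral_norm_uIoc.trans ?_
      rw [integral_Ico_eq_integral_Ioc]
      refine setIntegral_mono_set
        ((hg'c.abs.continuousOn.integrableOn_compact isCompact_Icc).mono_set Ioc_subset_Icc_self)
        (Filter.Eventually.of_forall fun s => abs_nonneg _)
        (LE.le.eventuallyLE ?_)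
      exact Ioc_subset_Ioc (le_min hb.1 ha.1) (max_le hb.2.le ha.2)
    have := abs_sub_abs_le_abs_sub (g a) (g b)
    linarith
  have hsq : g a ^ 2 ≤ 2 * ∫ s in Ico (0 : ℝ) 1, (g s ^ 2 + g' s ^ 2) := by
    set J := ∫ s in Ico (0 : ℝ) 1, |g' s|
    have hJ : J ^ 2 ≤ ∫ s in Ico (0 : ℝ) 1, g' s ^ 2 := by
      have := sq_integral_le_integral_sq (hii hg'c.abs)
        (by simpa [IntegrableOn] using hii (h := fun s => g' s ^ 2) (hg'c.pow 2))
      simpa using this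
    have h1 : ∫ b in Ico (0 : ℝ) 1, g a ^ 2 ≤ ∫ b in Ico (0 : ℝ) 1, (2 * g b ^ 2 + 2 * J ^ 2) := by
      refine setIntegral_mono_on (hii continuous_const)
        (hii ((continuous_const.mul (hgc.pow 2)).add continuous_const)) measurableSet_Ico
        fun b hb' => ?_
      have h2 := hb b hb'
      rw [← sq_abs (g a), ← sq_abs (g b)]
      nlinarith [abs_nonneg (g a), sq_nonneg (|g b| - J)]
    have hg2 : IntegrableOn (fun s => g s ^ 2) (Ico 0 1) := hii (hgc.pow 2)
    have hg'2 : IntegrableOn (fun s => g' s ^ 2) (Ico 0 1) := hii (hg'c.pow 2)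
    rw [integral_add (hg2.const_mul 2) (hii continuous_const), integral_const_mul] at h1
    rw [integral_add hg2 hg'2]
    simp only [integral_const, probReal_univ, one_smul] at h1
    linarith
  rw [hsum, hx0]
  refine hsq.trans (mul_le_mul_of_nonneg_left ?_ two_pos.le)
  refine setIntegral_mono (hii ((hgc.pow 2).add (hg'c.pow 2))) (hii ((hgc.pow 2).add hgg))
    fun s => ?_
  have := pow_le_pow_left₀ (abs_nonneg _) (hg'n s) 2
  rw [sq_abs] at this
  simpa using this

end CongestionMFG

/-! ### Interpolation and the weighted Sobolev inequality -/

namespace CongestionMFG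

open scoped ENNReal NNReal

variable {d : ℕ}

theorem integral_cube_add {f g : E d → ℝ} (hf : Continuous f) (hg : Continuous g) :
    ∫ x in cube d, (f x + g x) = (∫ x in cube d, f x) + ∫ x in cube d, g x :=
  integral_add (integrableOn_cube hf) (integrableOn_cube hg)

theorem integral_cube_sub {f g : E d → ℝ} (hf : Continuous f) (hg : Continuous g) :
    ∫ x in cube d, (f x - g x) = (∫ x in cube d, f x) - ∫ x in cube d, g x :=
  integral_sub (integrableOn_cube hf) (integrableOn_cube hg)

/-- Hölder's inequality on the torus. -/
theorem integral_rpow_mul_rpow_le {f g : E d → ℝ} (hf : Continuous f) (hg : Continuous g)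
    (hf0 : ∀ x, 0 ≤ f x) (hg0 : ∀ x, 0 ≤ g x) {a b : ℝ} (ha : 0 ≤ a) (hb : 0 ≤ b)
    (hab : a + b = 1) :
    ∫ x in cube d, f x ^ a * g x ^ b ≤ (∫ x in cube d, f x) ^ a * (∫ x in cube d, g x) ^ b := by
  have hfi := integral_cube_nonneg hf0
  have hgi := integral_cube_nonneg hg0
  have hc : Continuous fun x => f x ^ a * g x ^ b :=
    (hf.rpow_const fun _ => Or.inr ha).mul (hg.rpow_const fun _ => Or.inr hb)
  have h0 : ∀ x, 0 ≤ f x ^ a * g x ^ b := fun x =>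
    mul_nonneg (Real.rpow_nonneg (hf0 x) _) (Real.rpow_nonneg (hg0 x) _)
  have key := ENNReal.lintegral_mul_norm_pow_le (μ := volume.restrict (cube d))
    (f := fun x => ENNReal.ofReal (f x)) (g := fun x => ENNReal.ofReal (g x))
    hf.measurable.ennreal_ofReal.aemeasurable hg.measurable.ennreal_ofReal.aemeasurable ha hb hab
  rw [lintegral_cube_ofReal hf hf0, lintegral_cube_ofReal hg hg0,
    ENNReal.ofReal_rpow_of_nonneg hfi ha, ENNReal.ofReal_rpow_of_nonneg hgi hb,
    ← ENNReal.ofReal_mul (Real.rpow_nonneg hfi _)] at key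
  have hL : ∫⁻ x in cube d, ENNReal.ofReal (f x) ^ a * ENNReal.ofReal (g x) ^ b
      = ENNReal.ofReal (∫ x in cube d, f x ^ a * g x ^ b) := by
    rw [← lintegral_cube_ofReal hc h0]
    refine lintegral_congr fun x => ?_
    rw [ENNReal.ofReal_rpow_of_nonneg (hf0 x) ha, ENNReal.ofReal_rpow_of_nonneg (hg0 x) hb,
      ← ENNReal.ofReal_mul (Real.rpow_nonneg (hf0 x) _)]
  rw [hL] at key
  exact (ENNReal.ofReal_le_ofReal_iff (mul_nonneg (Real.rpow_nonneg hfi _)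
    (Real.rpow_nonneg hgi _))).1 key

theorem sq_integral_cube_le {f : E d → ℝ} (hf : Continuous f) :
    (∫ x in cube d, f x) ^ 2 ≤ ∫ x in cube d, f x ^ 2 :=
  sq_integral_le_integral_sq (integrableOn_cube hf) (integrableOn_cube (hf.pow 2))

/-- Young's inequality with a small factor in front of the first term. -/
theorem young_weighted {θ X δ x y : ℝ} (hθ : 0 ≤ θ) (hθ1 : θ < 1) (hX : 0 ≤ X) (hδ : 0 < δ)
    (hx : 0 ≤ x) (hy : 0 ≤ y) :
    X * (x ^ θ * y ^ (1 - θ)) ≤ δ * x + (X / δ ^ θ) ^ (1 / (1 - θ)) * y := by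
  have h1 : 0 < 1 - θ := by linarith
  set B := (X / δ ^ θ) ^ (1 / (1 - θ)) with hB
  have hδθ : 0 < δ ^ θ := Real.rpow_pos_of_pos hδ _
  have hB0 : 0 ≤ B := Real.rpow_nonneg (div_nonneg hX hδθ.le) _
  have hBp : B ^ (1 - θ) = X / δ ^ θ := by
    rw [hB, ← Real.rpow_mul (div_nonneg hX hδθ.le), one_div, inv_mul_cancel₀ h1.ne', Real.rpow_one]
  have key := Real.geom_mean_le_arith_mean2_weighted hθ h1.le (mul_nonneg hδ.le hx)
    (mul_nonneg hB0 hy) (by ring)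
  rw [Real.mul_rpow hδ.le hx, Real.mul_rpow hB0 hy, hBp] at key
  have h2 : δ ^ θ * x ^ θ * (X / δ ^ θ * y ^ (1 - θ)) = X * (x ^ θ * y ^ (1 - θ)) := by
    field_simp
  rw [h2] at key
  refine key.trans ?_
  have := mul_nonneg hδ.le hx
  have := mul_nonneg hB0 hy
  nlinarith

/-- The form of `young_weighted` used in the absorption arguments, with `X / δ` for
`X / δ ^ θ`. -/
theorem young_weighted' {θ X δ x y : ℝ} (hθ : 0 ≤ θ) (hθ1 : θ < 1) (hX : 0 ≤ X) (hδ : 0 < δ)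
    (hδ1 : δ ≤ 1) (hx : 0 ≤ x) (hy : 0 ≤ y) :
    X * (x ^ θ * y ^ (1 - θ)) ≤ δ * x + (X / δ) ^ (1 / (1 - θ)) * y := by
  refine (young_weighted hθ hθ1 hX hδ hx hy).trans ?_
  have h1 : 0 < 1 - θ := by linarith
  have h2 : δ ≤ δ ^ θ := by
    simpa using Real.rpow_le_rpow_of_exponent_ge hδ hδ1 hθ1.le
  gcongr

/-- The Sobolev inequality on the torus with an exponent `κ` that is critical in dimension at
least three and large in dimensions one and two. The condition on `κ` is where the restriction
`α < 2 / (d - 2)` enters. -/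
theorem exists_sobolev (hd : 1 ≤ d) {α : ℝ} (hα : 0 ≤ α)
    (hα' : 3 ≤ d → α < 2 / ((d : ℝ) - 2)) :
    ∃ κ C : ℝ, 1 < κ ∧ α / (1 + α) < 1 - 1 / κ ∧ 0 ≤ C ∧ ∀ f : E d → ℝ, ContDiff ℝ 1 f →
      Periodic f → (∀ x, 0 < f x) → (∫ x in cube d, f x ^ (2 * κ)) ^ (1 / κ)
        ≤ C * ∫ x in cube d, (f x ^ 2 + ‖(∇ f) x‖ ^ 2) := by
  have hconv : ∀ κ : ℝ, 1 < κ → ∀ f : E d → ℝ, ContDiff ℝ 1 f → (∀ x, 0 < f x) →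
      eLpNorm f ((2 * κ).toNNReal) (volume.restrict (cube d)) ^ 2
        = ENNReal.ofReal ((∫ x in cube d, f x ^ (2 * κ)) ^ (1 / κ)) := by
    intro κ hκ f hf hpos
    have hq : (((2 * κ).toNNReal : ℝ≥0) : ℝ) = 2 * κ := Real.coe_toNNReal _ (by linarith)
    have hq0 : (2 * κ).toNNReal ≠ 0 := by
      intro h; rw [h] at hq; simp at hq; linarith
    have h1 := eLpNorm_nnreal_pow_eq_lintegral (f := f) (μ := volume.restrict (cube d)) hq0
    have hc : Continuous fun x => f x ^ (2 * κ) :=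
      hf.continuous.rpow_const fun x => Or.inl (hpos x).ne'
    have h2 : ∫⁻ x in cube d, ‖f x‖ₑ ^ (2 * κ)
        = ENNReal.ofReal (∫ x in cube d, f x ^ (2 * κ)) := by
      rw [← lintegral_cube_ofReal hc fun x => Real.rpow_nonneg (hpos x).le _]
      refine lintegral_congr fun x => ?_
      rw [Real.enorm_eq_ofReal (hpos x).le, ENNReal.ofReal_rpow_of_pos (hpos x)]
    rw [hq, h2] at h1
    rw [← ENNReal.ofReal_rpow_of_nonneg (integral_cube_nonneg fun x =>
      Real.rpow_nonneg (hpos x).le _) (by positivity), ← h1, ← ENNReal.rpow_mul,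
      ← ENNReal.rpow_natCast]
    congr 1
    field_simp
    norm_num
  have h1α : 0 < 1 + α := by linarith
  -- in dimensions one and two every finite exponent is admissible
  have hlarge : α / (1 + α) < 1 - 1 / (2 * (1 + α)) := by
    have : 1 - 1 / (2 * (1 + α)) - α / (1 + α) = 1 / (2 * (1 + α)) := by field_simp; ring
    have h2 : 0 < 1 / (2 * (1 + α)) := by positivity
    linarith
  have hκ1 : 1 < 2 * (1 + α) := by linarith
  rcases Nat.lt_or_ge d 3 with hd3 | hd3
  · rcases (by omega : d = 1 ∨ d = 2) with rfl | rfl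
    · refine ⟨2 * (1 + α), 2, hκ1, hlarge, by norm_num, fun f hf hper hpos => ?_⟩
      set S := 2 * ∫ x in cube 1, (f x ^ 2 + ‖(∇ f) x‖ ^ 2) with hS
      have hS0 : 0 ≤ S := (sq_nonneg (f 0)).trans (sq_le_sobolev_of_dim_one hf hper 0)
      have hle : ∀ x, f x ^ (2 * (2 * (1 + α))) ≤ S ^ (2 * (1 + α)) := fun x => by
        rw [Real.rpow_mul (hpos x).le, Real.rpow_two]
        exact Real.rpow_le_rpow (sq_nonneg _) (sq_le_sobolev_of_dim_one hf hper x) (by linarith)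
      have h1 : ∫ x in cube 1, f x ^ (2 * (2 * (1 + α))) ≤ S ^ (2 * (1 + α)) := by
        have := integral_cube_mono (hf.continuous.rpow_const fun x => Or.inl (hpos x).ne')
          continuous_const hle
        simpa using this
      calc _ ≤ (S ^ (2 * (1 + α))) ^ (1 / (2 * (1 + α))) :=
            Real.rpow_le_rpow (integral_cube_nonneg fun x => Real.rpow_nonneg (hpos x).le _) h1
              (by positivity)
        _ = S := by
            rw [← Real.rpow_mul hS0, mul_one_div_cancel (by linarith), Real.rpow_one]
    · set κ := 2 * (1 + α) with hκ
      have hκ2 : 2 ≤ κ := by linarith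
      -- the exponent `p < 2` with `1 / p - 1 / 2 = 1 / (2 κ)`
      let p : ℝ≥0 := (2 * κ / (κ + 1)).toNNReal
      have hp : (p : ℝ) = 2 * κ / (κ + 1) := Real.coe_toNNReal _ (by positivity)
      have hp1 : (1 : ℝ) ≤ p := by rw [hp, le_div_iff₀ (by linarith)]; linarith
      have hp2 : (p : ℝ) < 2 := by rw [hp, div_lt_iff₀ (by linarith)]; linarith
      obtain ⟨C, hC, h⟩ := exists_sobolev_of_two_le (d := 2) (p := p) (q := (2 * κ).toNNReal)
        (by exact_mod_cast hp1) (by exact_mod_cast hp2.le) (by exact_mod_cast hp2) (by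
          rw [hp, Real.coe_toNNReal _ (by linarith)]
          apply le_of_eq
          push_cast
          field_simp
          ring)
      refine ⟨κ, C, hκ1, hlarge, hC, fun f hf hper hpos => ?_⟩
      have h2 := h f hf hper
      rw [hconv κ hκ1 f hf hpos] at h2
      exact (ENNReal.ofReal_le_ofReal_iff (mul_nonneg hC (integral_cube_nonneg fun x => by
        positivity))).1 h2
  · have hd3' : (3 : ℝ) ≤ d := by exact_mod_cast hd3
    have hd2 : 0 < (d : ℝ) - 2 := by linarith
    set κ : ℝ := d / (d - 2) with hκ
    have hκ1 : 1 < κ := by rw [hκ, lt_div_iff₀ hd2]; linarith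
    obtain ⟨C, hC, h⟩ := exists_sobolev_of_two_le (d := d) (p := 2) (q := (2 * κ).toNNReal)
      (by norm_num) le_rfl (by exact_mod_cast (by omega : 2 < d)) (by
        rw [Real.coe_toNNReal _ (by linarith), hκ]
        apply le_of_eq
        push_cast
        field_simp)
    refine ⟨κ, C, hκ1, ?_, hC, fun f hf hper hpos => ?_⟩
    · have h3 := hα' hd3
      rw [lt_div_iff₀ hd2] at h3
      have h4 : 1 - 1 / κ = 2 / d := by rw [hκ]; field_simp; ring
      rw [h4, div_lt_div_iff₀ h1α (by linarith)]
      nlinarith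
    · have h2 := h f hf hper
      rw [hconv κ hκ1 f hf hpos] at h2
      exact (ENNReal.ofReal_le_ofReal_iff (mul_nonneg hC (integral_cube_nonneg fun x => by
        positivity))).1 h2

set_option maxHeartbeats 400000 in
/-- A weight in `L^p` with `p` above the scaling threshold is form-bounded with respect to the
Dirichlet form, with arbitrarily small relative bound; the remainder involves only the `L¹` norm
of the function. The loss in the constant is polynomial in `A / ε`. -/
theorem exists_weighted_sobolev (hd : 1 ≤ d) {α : ℝ} (hα : 0 ≤ α)
    (hα' : 3 ≤ d → α < 2 / ((d : ℝ) - 2)) :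
    ∃ p k C : ℝ, 1 ≤ p ∧ α * p ≤ 1 + α ∧ 1 ≤ k ∧ 1 ≤ C ∧ ∀ f a : E d → ℝ, ContDiff ℝ 1 f →
      Periodic f → (∀ x, 0 < f x) → Continuous a → (∀ x, 0 ≤ a x) → ∀ A : ℝ, 1 ≤ A →
      ∫ x in cube d, a x ^ p ≤ A ^ p → ∀ ε : ℝ, 0 < ε → ε ≤ 1 →
      ∫ x in cube d, a x * f x ^ 2 ≤ ε * (∫ x in cube d, ‖(∇ f) x‖ ^ 2)
        + C * (A / ε) ^ k * (∫ x in cube d, f x) ^ 2 := by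
  obtain ⟨κ, CS, hκ, hακ, hCS, hsob⟩ := exists_sobolev hd hα hα'
  have h1α : 0 < 1 + α := by linarith
  have hα1 : 0 ≤ α / (1 + α) := by positivity
  set s := (α / (1 + α) + (1 - 1 / κ)) / 2 with hs
  have hκ0 : 0 < 1 - 1 / κ := by linarith
  have hκ' : 1 / κ > 0 := by positivity
  have hs0 : 0 < s := by rw [hs]; linarith
  have hsα : α / (1 + α) ≤ s := by rw [hs]; linarith
  have hsκ : s < 1 - 1 / κ := by rw [hs]; linarith
  have hs1 : s < 1 := by linarith
  have h2κ : 0 < 2 * κ - 1 := by linarith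
  -- the exponents of Hölder's inequality
  set X := (1 + s) / (2 * κ - 1) with hX
  set Y := 1 - s - X with hY
  have hX0 : 0 < X := by positivity
  have hXeq : X * (2 * κ - 1) = 1 + s := div_mul_cancel₀ _ h2κ.ne'
  have hκs : 1 < κ * (1 - s) := by
    have : κ * (1 / κ) = 1 := by field_simp
    nlinarith
  have hY0 : 0 < Y := by
    have : Y * (2 * κ - 1) = 2 * (κ * (1 - s) - 1) := by rw [hY, sub_mul, hXeq]; ring
    have h3 : 0 < Y * (2 * κ - 1) := by rw [this]; linarith
    exact pos_of_mul_pos_left h3 h2κ.le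
  -- the exponents in Young's inequality; `1 - τ = Y / 2` turns `J ^ Y` into a power of `J ^ 2`
  set τ := κ * X with hτ
  have hτY : 1 - τ = Y / 2 := by rw [hτ, hY]; linarith
  have hτ0 : 0 ≤ τ := by positivity
  have hτ1 : τ < 1 := by linarith
  set k := 1 / (1 - τ) with hk
  have hk1 : 1 ≤ k := by rw [hk, le_div_iff₀ (by linarith)]; linarith
  have hk0 : 0 ≤ k := by linarith
  have hp1 : 1 ≤ 1 / s := by rw [le_div_iff₀ hs0]; linarith
  -- interpolation between `L¹` and the Sobolev space
  have hint : ∀ f a : E d → ℝ, ContDiff ℝ 1 f → (∀ x, 0 < f x) → Continuous a →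
      (∀ x, 0 ≤ a x) → ∀ A : ℝ, 1 ≤ A → ∫ x in cube d, a x ^ (1 / s) ≤ A ^ (1 / s) →
      ∀ ε : ℝ, 0 < ε → ε ≤ 1 → ∫ x in cube d, a x * f x ^ 2
        ≤ ε * (∫ x in cube d, f x ^ (2 * κ)) ^ (1 / κ)
          + (A / ε) ^ k * (∫ x in cube d, f x) ^ 2 := by
    intro f a hf hpos ha ha0 A hA haA ε hε hε1
    have hfc := hf.continuous
    have hapc : Continuous fun x => a x ^ (1 / s) := ha.rpow_const fun _ => Or.inr (by linarith)
    have hfκ : Continuous fun x => f x ^ (2 * κ) :=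
      hfc.rpow_const fun x => Or.inl (hpos x).ne'
    have hs1' : 0 < 1 - s := by linarith
    set W : E d → ℝ := fun x => (f x ^ (2 * κ)) ^ (X / (1 - s)) * f x ^ (Y / (1 - s)) with hW
    have hWc : Continuous W :=
      (hfκ.rpow_const fun x => Or.inr (by positivity)).mul
        (hfc.rpow_const fun x => Or.inr (by positivity))
    have hW0 : ∀ x, 0 ≤ W x := fun x => mul_nonneg
      (Real.rpow_nonneg (Real.rpow_nonneg (hpos x).le _) _) (Real.rpow_nonneg (hpos x).le _)
    set I := ∫ x in cube d, f x ^ (2 * κ) with hI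
    set J := ∫ x in cube d, f x with hJ
    have hI0 : 0 ≤ I := integral_cube_nonneg fun x => Real.rpow_nonneg (hpos x).le _
    have hJ0 : 0 ≤ J := integral_cube_nonneg fun x => (hpos x).le
    have e1 : ∀ x, a x * f x ^ 2 = (a x ^ (1 / s)) ^ s * W x ^ (1 - s) := by
      intro x
      have := hpos x
      rw [← Real.rpow_mul (ha0 x), one_div, inv_mul_cancel₀ hs0.ne', Real.rpow_one, hW]
      simp only
      have h2 : 0 ≤ f x ^ (2 * κ) := Real.rpow_nonneg this.le _
      rw [Real.mul_rpow (Real.rpow_nonneg h2 _) (Real.rpow_nonneg this.le _),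
        ← Real.rpow_mul h2, ← Real.rpow_mul this.le, ← Real.rpow_mul this.le,
        div_mul_cancel₀ _ hs1'.ne', div_mul_cancel₀ _ hs1'.ne', ← Real.rpow_add this]
      have : 2 * κ * X + Y = 2 := by rw [hY]; linarith
      rw [this, Real.rpow_two]
    have e2 : ∫ x in cube d, W x ≤ I ^ (X / (1 - s)) * J ^ (Y / (1 - s)) :=
      integral_rpow_mul_rpow_le hfκ hfc (fun x => Real.rpow_nonneg (hpos x).le _)
        (fun x => (hpos x).le) (by positivity) (by positivity) (by
          rw [← add_div, hY]; field_simp; ring)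
    have e3 : ∫ x in cube d, a x * f x ^ 2 ≤ A * (I ^ X * J ^ Y) := by
      simp only [e1]
      refine (integral_rpow_mul_rpow_le hapc hWc (fun x => Real.rpow_nonneg (ha0 x) _) hW0
        hs0.le hs1'.le (by ring)).trans ?_
      have e4 : (∫ x in cube d, a x ^ (1 / s)) ^ s ≤ A := by
        have := Real.rpow_le_rpow (integral_cube_nonneg fun x => Real.rpow_nonneg (ha0 x) _)
          haA hs0.le
        rwa [← Real.rpow_mul (by linarith), one_div_mul_cancel hs0.ne', Real.rpow_one] at this
      have e5 : (∫ x in cube d, W x) ^ (1 - s) ≤ I ^ X * J ^ Y := by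
        have := Real.rpow_le_rpow (integral_cube_nonneg hW0) e2 hs1'.le
        rwa [Real.mul_rpow (Real.rpow_nonneg hI0 _) (Real.rpow_nonneg hJ0 _),
          ← Real.rpow_mul hI0, ← Real.rpow_mul hJ0, div_mul_cancel₀ _ hs1'.ne',
          div_mul_cancel₀ _ hs1'.ne'] at this
      exact mul_le_mul e4 e5 (Real.rpow_nonneg (integral_cube_nonneg hW0) _) (by linarith)
    refine e3.trans ?_
    have e6 : I ^ X * J ^ Y = (I ^ (1 / κ)) ^ τ * (J ^ 2) ^ (1 - τ) := by
      rw [← Real.rpow_mul hI0, ← Real.rpow_two, ← Real.rpow_mul hJ0, hτY, hτ]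
      congr 2
      · field_simp
      · ring
    rw [e6]
    exact young_weighted' hτ0 hτ1 (by linarith) hε hε1 (Real.rpow_nonneg hI0 _) (sq_nonneg _)
  set S := 2 * (CS + 1) with hS
  have hS1 : 1 ≤ S := by linarith
  have hS0 : 0 < S := by linarith
  have hSk : 1 ≤ S ^ k := Real.one_le_rpow hS1 hk0
  refine ⟨1 / s, k, 2 * S ^ k, hp1, ?_, hk1, by linarith,
    fun f a hf hper hpos ha ha0 A hA haA ε hε hε1 => ?_⟩
  · rw [mul_one_div, div_le_iff₀ hs0]
    rw [div_le_iff₀ h1α] at hsα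
    linarith
  set N := (∫ x in cube d, f x ^ (2 * κ)) ^ (1 / κ) with hN
  set Z := (∫ x in cube d, f x) ^ 2 with hZ
  set D := ∫ x in cube d, ‖(∇ f) x‖ ^ 2 with hD
  have hD0 : 0 ≤ D := integral_cube_nonneg fun x => by positivity
  have hZ0 : 0 ≤ Z := sq_nonneg _
  have hN0 : 0 ≤ N := Real.rpow_nonneg
    (integral_cube_nonneg fun x => Real.rpow_nonneg (hpos x).le _) _
  -- the `L²` part of the Sobolev norm is absorbed by interpolation
  have h1 := hsob f hf hper hpos
  rw [integral_cube_add (f := fun x => f x ^ 2) (g := fun x => ‖(∇ f) x‖ ^ 2)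
    (hf.continuous.pow 2) ((continuous_gradient hf).norm.pow 2)] at h1
  have h2 := hint f (fun _ => 1) hf hpos continuous_const (fun _ => zero_le_one) 1 le_rfl
    (by simp) (1 / S) (by positivity) (by rw [div_le_one hS0]; exact hS1)
  simp only [one_mul, one_div_one_div] at h2
  have h3 : N ≤ S * D + S * S ^ k * Z := by
    have e1 : CS * (1 / S * N) ≤ N / 2 := by
      have : CS * (1 / S) ≤ 1 / 2 := by
        rw [mul_one_div, div_le_iff₀ hS0, hS]; linarith
      nlinarith
    have e2 := mul_le_mul_of_nonneg_left h2 hCS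
    rw [mul_add] at e2 h1
    have e3 : CS * D ≤ S / 2 * D := mul_le_mul_of_nonneg_right (by rw [hS]; linarith) hD0
    have e4 : CS * (S ^ k * Z) ≤ S / 2 * (S ^ k * Z) :=
      mul_le_mul_of_nonneg_right (by rw [hS]; linarith) (by positivity)
    linarith
  have h4 := hint f a hf hpos ha ha0 A hA haA (ε / S) (by positivity)
    (by rw [div_le_one hS0]; linarith)
  have hAε : 1 ≤ (A / ε) ^ k :=
    Real.one_le_rpow (by rw [le_div_iff₀ hε]; linarith) hk0
  have h5 : (A / (ε / S)) ^ k = S ^ k * (A / ε) ^ k := by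
    rw [← Real.mul_rpow hS0.le (by positivity)]
    congr 1
    field_simp
  have h6 : ε / S * N ≤ ε * D + ε * S ^ k * Z := by
    calc ε / S * N ≤ ε / S * (S * D + S * S ^ k * Z) :=
          mul_le_mul_of_nonneg_left h3 (by positivity)
      _ = ε * D + ε * S ^ k * Z := by field_simp
  have h7 : ε * S ^ k * Z ≤ S ^ k * (A / ε) ^ k * Z := by
    refine mul_le_mul_of_nonneg_right ?_ hZ0
    nlinarith
  rw [h5] at h4
  linarith

end CongestionMFG

/-! ### Differential inequalities, and suprema from high moments -/

namespace CongestionMFG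

open scoped ENNReal NNReal

variable {d : ℕ}

theorem le_of_hasDerivAt_nonpos {a b : ℝ} {f f' : ℝ → ℝ} (hf : ContinuousOn f (Icc a b))
    (hf' : ∀ t ∈ Ioo a b, HasDerivAt f (f' t) t) (h : ∀ t ∈ Ioo a b, f' t ≤ 0) {s t : ℝ}
    (hs : s ∈ Icc a b) (ht : t ∈ Icc a b) (hst : s ≤ t) : f t ≤ f s := by
  refine antitoneOn_of_deriv_nonpos (convex_Icc a b) hf ?_ ?_ hs ht hst
  · rw [interior_Icc]
    exact fun t ht => (hf' t ht).differentiableAt.differentiableWithinAt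
  · rw [interior_Icc]
    intro t ht
    rw [(hf' t ht).deriv]
    exact h t ht

/-- A decaying quantity with a constant source stays below its initial value or the source. -/
theorem le_max_of_hasDerivAt_le {b c : ℝ} {f f' : ℝ → ℝ} (hf : ContinuousOn f (Icc 0 b))
    (hf' : ∀ t ∈ Ioo 0 b, HasDerivAt f (f' t) t) (h : ∀ t ∈ Ioo 0 b, f' t ≤ -f t + c) {t : ℝ}
    (ht : t ∈ Icc 0 b) : f t ≤ max (f 0) c := by
  have h0 : (0 : ℝ) ∈ Icc 0 b := ⟨le_rfl, ht.1.trans ht.2⟩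
  have key := le_of_hasDerivAt_nonpos (f := fun t => Real.exp t * (f t - c))
    (f' := fun t => Real.exp t * (f t - c) + Real.exp t * f' t)
    (Real.continuous_exp.continuousOn.mul (hf.sub continuousOn_const))
    (fun t ht => (Real.hasDerivAt_exp t).mul ((hf' t ht).sub_const c))
    (fun t ht => by
      have := h t ht
      rw [← mul_add]
      exact mul_nonpos_of_nonneg_of_nonpos (Real.exp_pos t).le (by linarith)) h0 ht ht.1
  simp only [Real.exp_zero, one_mul] at key
  by_contra! hcon
  have h1 : f 0 < f t := (le_max_left _ _).trans_lt hcon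
  have h2 : c < f t := (le_max_right _ _).trans_lt hcon
  have h3 : 1 ≤ Real.exp t := Real.one_le_exp ht.1
  nlinarith

/-- The time-reversed form of `le_max_of_hasDerivAt_le`. -/
theorem le_max_of_le_hasDerivAt {b c : ℝ} {f f' : ℝ → ℝ} (hf : ContinuousOn f (Icc 0 b))
    (hf' : ∀ t ∈ Ioo 0 b, HasDerivAt f (f' t) t) (h : ∀ t ∈ Ioo 0 b, f t - c ≤ f' t) {t : ℝ}
    (ht : t ∈ Icc 0 b) : f t ≤ max (f b) c := by
  have hmaps : ∀ t ∈ Icc 0 b, b - t ∈ Icc 0 b := fun t ht => ⟨by linarith [ht.2], by linarith [ht.1]⟩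
  have hmaps' : ∀ t ∈ Ioo 0 b, b - t ∈ Ioo 0 b := fun t ht => ⟨by linarith [ht.2], by linarith [ht.1]⟩
  have key := le_max_of_hasDerivAt_le (b := b) (c := c) (f := fun t => f (b - t))
    (f' := fun t => -f' (b - t))
    (hf.comp (continuous_const.sub continuous_id).continuousOn hmaps)
    (fun t ht => by
      simpa using (hf' _ (hmaps' t ht)).comp_const_sub b t)
    (fun t ht => by linarith [h _ (hmaps' t ht)]) (hmaps t ht)
  simpa using key

/-- A superlinear differential inequality has solutions bounded on a time interval whose length
depends only on the initial bound. -/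
theorem le_two_mul_of_hasDerivAt_le_rpow {b C N y₀ : ℝ} {f f' : ℝ → ℝ} (hN : 2 ≤ N) (hC : 0 < C)
    (hf : ContinuousOn f (Icc 0 b)) (hf' : ∀ t ∈ Ioo 0 b, HasDerivAt f (f' t) t)
    (hpos : ∀ t ∈ Icc 0 b, 0 < f t) (h : ∀ t ∈ Ioo 0 b, f' t ≤ C * f t ^ N) (h0 : f 0 ≤ y₀)
    (hb : (N - 1) * C * b ≤ y₀ ^ (-(N - 1)) / 2) {t : ℝ} (ht : t ∈ Icc 0 b) : f t ≤ 2 * y₀ := by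
  have h0b : (0 : ℝ) ∈ Icc 0 b := ⟨le_rfl, ht.1.trans ht.2⟩
  have hN1 : 0 < N - 1 := by linarith
  have hy0 : 0 < y₀ := (hpos 0 h0b).trans_le h0
  have key := le_of_hasDerivAt_nonpos (f := fun t => -(f t ^ (-(N - 1))) - (N - 1) * C * t)
    (f' := fun t => -(f' t * (-(N - 1)) * f t ^ (-(N - 1) - 1)) - (N - 1) * C)
    (((hf.rpow_const fun t ht => Or.inl (hpos t ht).ne').neg).sub
      (continuous_const.mul continuous_id).continuousOn)
    (fun t ht => by
      have h1 := (hf' t ht).rpow_const (p := -(N - 1))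
        (Or.inl (hpos t (Ioo_subset_Icc_self ht)).ne')
      have h2 := (hasDerivAt_id t).const_mul ((N - 1) * C)
      rw [mul_one] at h2
      exact h1.neg.sub h2)
    (fun t ht => by
      have hp := hpos t (Ioo_subset_Icc_self ht)
      have e1 : -(N - 1) - 1 = -N := by ring
      have e2 : f' t * f t ^ (-N) ≤ C := by
        calc f' t * f t ^ (-N) ≤ C * f t ^ N * f t ^ (-N) :=
              mul_le_mul_of_nonneg_right (h t ht) (Real.rpow_nonneg hp.le _)
          _ = C := by rw [mul_assoc, ← Real.rpow_add hp]; simp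
      rw [e1]
      nlinarith) h0b ht ht.1
  simp only [mul_zero, sub_zero] at key
  have h1 : y₀ ^ (-(N - 1)) ≤ f 0 ^ (-(N - 1)) :=
    Real.rpow_le_rpow_of_nonpos (hpos 0 h0b) h0 (by linarith)
  have h2 : (N - 1) * C * t ≤ (N - 1) * C * b := by
    have := ht.2
    gcongr
  have h3 : y₀ ^ (-(N - 1)) / 2 ≤ f t ^ (-(N - 1)) := by linarith
  by_contra! hcon
  have h4 : f t ^ (-(N - 1)) < (2 * y₀) ^ (-(N - 1)) :=
    Real.rpow_lt_rpow_of_neg (by linarith) hcon (by linarith)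
  rw [Real.mul_rpow two_pos.le hy0.le] at h4
  have h5 : (2 : ℝ) ^ (-(N - 1)) ≤ 1 / 2 := by
    calc (2 : ℝ) ^ (-(N - 1)) ≤ 2 ^ (-1 : ℝ) :=
          Real.rpow_le_rpow_of_exponent_le one_le_two (by linarith)
      _ = 1 / 2 := by rw [Real.rpow_neg_one]; norm_num
  have h6 : 0 < y₀ ^ (-(N - 1)) := Real.rpow_pos_of_pos hy0 _
  nlinarith

/-- The recursion of Alikakos and Moser: if each moment is controlled by the square of the
previous one with a geometrically growing constant, all moments grow at most like powers of one
constant. -/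
theorem moment_recursion {ι : Type*} {S : Set ι} {I : ℕ → ι → ℝ} {D M : ℝ} (hD : 1 ≤ D)
    (hM : 1 ≤ M) (h0 : ∀ t ∈ S, I 0 t ≤ M)
    (hstep : ∀ n c, 0 ≤ c → (∀ t ∈ S, I n t ≤ c) →
      ∀ t ∈ S, I (n + 1) t ≤ max (M ^ 2 ^ (n + 1)) (D ^ (n + 1) * c ^ 2)) (n : ℕ) :
    ∀ t ∈ S, I n t ≤ (D ^ 2 * M) ^ 2 ^ n := by
  have hD0 : 0 < D := by linarith
  -- the factor `D ^ (n + 2)` compensates the growth of the constant in the induction step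
  suffices h : ∀ n, ∀ t ∈ S, I n t ≤ (D ^ 2 * M) ^ 2 ^ n / D ^ (n + 2) from fun t ht =>
    (h n t ht).trans (div_le_self (by positivity) (one_le_pow₀ hD))
  intro n
  induction n with
  | zero =>
    intro t ht
    refine (h0 t ht).trans (le_of_eq ?_)
    field_simp
    ring
  | succ n ih =>
    intro t ht
    refine (hstep n _ (by positivity) ih t ht).trans (max_le ?_ ?_)
    · rw [le_div_iff₀ (by positivity), mul_pow, ← pow_mul, mul_comm]
      refine mul_le_mul_of_nonneg_right (pow_le_pow_right₀ hD ?_) (by positivity)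
      have : n + 1 < 2 ^ (n + 1) := Nat.lt_two_pow_self
      omega
    · apply le_of_eq
      rw [div_pow, ← pow_mul, ← pow_succ, ← pow_mul]
      field_simp
      rw [← pow_add]
      congr 1
      ring

/-- A continuous periodic function is bounded by `Λ` if its `2 ^ n`-th moments are bounded by
`Λ ^ 2 ^ n`. -/
theorem le_of_moments_le {W : E d → ℝ} (hW : Continuous W) (hper : Periodic W)
    (hW0 : ∀ x, 0 ≤ W x) {Λ : ℝ} (hΛ : 0 < Λ)
    (h : ∀ n : ℕ, ∫ x in cube d, W x ^ 2 ^ n ≤ Λ ^ 2 ^ n) (x : E d) : W x ≤ Λ := by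
  by_contra! hx
  obtain ⟨Λ', h1, h2⟩ := exists_between hx
  have hΛ' : 0 < Λ' := hΛ.trans h1
  set U : Set (E d) := {y | Λ' < W y} with hU
  have hUo : IsOpen U := isOpen_lt continuous_const hW
  have hUm : MeasurableSet U := hUo.measurableSet
  obtain ⟨N, hN⟩ := exists_lintegral_ball_le d (‖x‖ + 1)
  -- the superlevel set has positive measure in the unit cube, by periodicity
  have hpos : 0 < (volume.restrict (cube d)).real U := by
    rw [measureReal_def, ENNReal.toReal_pos_iff]
    refine ⟨?_, measure_lt_top _ _⟩
    rw [pos_iff_ne_zero]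
    intro hzero
    have h3 := hN (U.indicator 1) (measurable_one.indicator hUm) (fun i y => by
      have : y + EuclideanSpace.single i 1 ∈ U ↔ y ∈ U := by
        simp only [hU, mem_ofPred_eq, hper i y]
      by_cases hy : y ∈ U
      · rw [indicator_of_mem (this.2 hy), indicator_of_mem hy]; rfl
      · rw [indicator_of_notMem (fun h => hy (this.1 h)), indicator_of_notMem hy])
    rw [lintegral_indicator_one hUm, lintegral_indicator_one hUm, hzero, mul_zero,
      Measure.restrict_apply hUm] at h3
    have h4 : 0 < volume (U ∩ Metric.ball (0 : E d) (‖x‖ + 1)) :=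
      (hUo.inter Metric.isOpen_ball).measure_pos volume ⟨x, h2, by simp⟩
    exact absurd h3 (not_le.2 h4)
  set v := (volume.restrict (cube d)).real U with hv
  have h5 : ∀ n : ℕ, v ≤ (Λ / Λ') ^ 2 ^ n := by
    intro n
    have h6 : Λ' ^ 2 ^ n * v ≤ ∫ y in cube d, W y ^ 2 ^ n := by
      have hind : ∫ y in cube d, U.indicator (fun _ => Λ' ^ 2 ^ n) y = Λ' ^ 2 ^ n * v := by
        rw [integral_indicator_const _ hUm, smul_eq_mul, mul_comm]
      rw [← hind]
      refine integral_mono ((integrable_const _).indicator hUm)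
        (integrableOn_cube (hW.pow _)) fun y => ?_
      by_cases hy : y ∈ U
      · rw [indicator_of_mem hy]
        exact pow_le_pow_left₀ hΛ'.le (le_of_lt hy) _
      · rw [indicator_of_notMem hy]
        exact pow_nonneg (hW0 y) _
    rw [div_pow, le_div_iff₀ (by positivity), mul_comm]
    exact h6.trans (h n)
  have hq : Λ / Λ' < 1 := (div_lt_one hΛ').2 h1
  obtain ⟨n, hn⟩ := exists_pow_lt_of_lt_one hpos hq
  have h7 : (Λ / Λ') ^ 2 ^ n ≤ (Λ / Λ') ^ n :=
    pow_le_pow_of_le_one (by positivity) hq.le Nat.lt_two_pow_self.le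
  exact absurd (h5 n) (not_le.2 (h7.trans_lt hn))

/-! ### Integrals depending on time -/

theorem continuousOn_integral_cube {f : E d → ℝ → ℝ} {a b : ℝ}
    (hf : ContinuousOn (fun z : E d × ℝ => f z.1 z.2) (univ ×ˢ Icc a b)) :
    ContinuousOn (fun t => ∫ x in cube d, f x t) (Icc a b) := by
  obtain ⟨C, hC⟩ := ((isCompact_closedCube d).prod (isCompact_Icc (a := a) (b := b))
    ).exists_bound_of_continuousOn (hf.mono (prod_mono_left (subset_univ _)))
  intro t ht
  refine continuousWithinAt_of_dominated (bound := fun _ => C) ?_ ?_ (integrable_const C) ?_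
  · filter_upwards [self_mem_nhdsWithin] with s hs
    have : Continuous fun x => f x s :=
      hf.comp_continuous (by fun_prop : Continuous fun x : E d => (x, s)) fun x => ⟨mem_univ _, hs⟩
    exact this.aestronglyMeasurable
  · filter_upwards [self_mem_nhdsWithin] with s hs
    filter_upwards [ae_restrict_mem (measurableSet_cube d)] with x hx
    exact hC (x, s) ⟨cube_subset_closedCube d hx, hs⟩
  · refine Filter.Eventually.of_forall fun x => ?_
    exact (hf.comp (by fun_prop : ContinuousOn (fun s : ℝ => (x, s)) (Icc a b))
      fun s hs => ⟨mem_univ _, hs⟩) t ht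

theorem hasDerivAt_of_contDiffOn {f : E d → ℝ → ℝ} {a b : ℝ}
    (hf : ContDiffOn ℝ 1 (fun z : E d × ℝ => f z.1 z.2) (univ ×ˢ Ioo a b)) (x : E d) {t : ℝ}
    (ht : t ∈ Ioo a b) : HasDerivAt (fun s => f x s)
      (fderiv ℝ (fun z : E d × ℝ => f z.1 z.2) (x, t) (0, 1)) t := by
  have hopen : IsOpen ((univ : Set (E d)) ×ˢ Ioo a b) := isOpen_univ.prod isOpen_Ioo
  have h1 : DifferentiableAt ℝ (fun z : E d × ℝ => f z.1 z.2) (x, t) :=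
    (hf.differentiableOn one_ne_zero).differentiableAt (hopen.mem_nhds ⟨mem_univ _, ht⟩)
  have h2 : HasDerivAt (fun s : ℝ => (x, s)) ((0 : E d), (1 : ℝ)) t :=
    (hasDerivAt_const t x).prodMk (hasDerivAt_id t)
  exact h1.hasFDerivAt.comp_hasDerivAt t h2

theorem continuousOn_deriv_time {f : E d → ℝ → ℝ} {a b : ℝ}
    (hf : ContDiffOn ℝ 1 (fun z : E d × ℝ => f z.1 z.2) (univ ×ˢ Ioo a b)) :
    ContinuousOn (fun z : E d × ℝ => deriv (fun s => f z.1 s) z.2) (univ ×ˢ Ioo a b) := by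
  have hopen : IsOpen ((univ : Set (E d)) ×ˢ Ioo a b) := isOpen_univ.prod isOpen_Ioo
  refine ((hf.continuousOn_fderiv_of_isOpen hopen le_rfl).clm_apply
    (continuousOn_const (c := ((0 : E d), (1 : ℝ))))).congr fun z hz => ?_
  exact (hasDerivAt_of_contDiffOn hf z.1 hz.2).deriv

theorem hasDerivAt_integral_cube {f : E d → ℝ → ℝ} {a b : ℝ}
    (hf : ContDiffOn ℝ 1 (fun z : E d × ℝ => f z.1 z.2) (univ ×ˢ Ioo a b)) {t : ℝ}
    (ht : t ∈ Ioo a b) : HasDerivAt (fun s => ∫ x in cube d, f x s)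
      (∫ x in cube d, deriv (fun s => f x s) t) t := by
  obtain ⟨a', ha', hat⟩ := exists_between ht.1
  obtain ⟨b', hbt, hb'⟩ := exists_between ht.2
  have hsub : Icc a' b' ⊆ Ioo a b := fun s hs => ⟨ha'.trans_le hs.1, hs.2.trans_lt hb'⟩
  have hcont := continuousOn_deriv_time hf
  obtain ⟨C, hC⟩ := ((isCompact_closedCube d).prod (isCompact_Icc (a := a') (b := b'))
    ).exists_bound_of_continuousOn (hcont.mono (prod_mono (subset_univ _) hsub))
  have hslice : ∀ {g : E d → ℝ → ℝ}, ContinuousOn (fun z : E d × ℝ => g z.1 z.2)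
      (univ ×ˢ Ioo a b) → ∀ s ∈ Ioo a b, Continuous fun x => g x s := fun hg s hs =>
    hg.comp_continuous (by fun_prop : Continuous fun x : E d => (x, s)) fun x => ⟨mem_univ _, hs⟩
  have hnhds : Icc a' b' ∈ nhds t := Icc_mem_nhds hat hbt
  refine (hasDerivAt_integral_of_dominated_loc_of_deriv_le (bound := fun _ => C)
    (F := fun s x => f x s) (F' := fun s x => deriv (fun s => f x s) s) hnhds ?_ ?_ ?_ ?_
    (integrable_const C) ?_).2
  · filter_upwards [hnhds] with s hs
    exact (hslice hf.continuousOn s (hsub hs)).aestronglyMeasurable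
  · exact integrableOn_cube (hslice hf.continuousOn t ht)
  · exact (hslice (g := fun x s => deriv (fun s => f x s) s) hcont t ht).aestronglyMeasurable
  · filter_upwards [ae_restrict_mem (measurableSet_cube d)] with x hx s hs
    exact hC (x, s) ⟨cube_subset_closedCube d hx, hs⟩
  · refine Filter.Eventually.of_forall fun x s hs => ?_
    have := hasDerivAt_of_contDiffOn hf x (hsub hs)
    rwa [this.deriv]

end CongestionMFG

/-! ### Weak form of the system -/

namespace CongestionMFG

variable {d : ℕ}

theorem contDiff_slice {F : Type*} [NormedAddCommGroup F] [NormedSpace ℝ F] {f : E d → ℝ → F}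
    {n : WithTop ℕ∞} {S : Set ℝ}
    (hf : ContDiffOn ℝ n (fun z : E d × ℝ => f z.1 z.2) (univ ×ˢ S)) {t : ℝ} (ht : t ∈ S) :
    ContDiff ℝ n (fun x => f x t) :=
  contDiffOn_univ.1 (hf.comp (contDiff_id.prodMk contDiff_const).contDiffOn
    fun _ _ => ⟨mem_univ _, ht⟩)

theorem two_le_smooth : (2 : WithTop ℕ∞) ≤ ∞ := by
  exact WithTop.coe_le_coe.2 (le_top : (2 : ℕ∞) ≤ ⊤)

theorem one_add_one_le_smooth : (1 + 1 : WithTop ℕ∞) ≤ ∞ := by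
  rw [one_add_one_eq_two]; exact two_le_smooth

theorem divergence_add {F G : E d → E d} {x : E d} (hF : DifferentiableAt ℝ F x)
    (hG : DifferentiableAt ℝ G x) :
    divergence (fun y => F y + G y) x = divergence F x + divergence G x := by
  simp only [divergence, fderiv_fun_add hF hG]
  simp [Finset.sum_add_distrib]

theorem gradient_comp {φ : ℝ → ℝ} {φ' : ℝ} {f : E d → ℝ} {x : E d} (hφ : HasDerivAt φ φ' (f x))
    (hf : DifferentiableAt ℝ f x) : ∇ (fun y => φ (f y)) x = φ' • (∇ f) x := by
  have h : HasFDerivAt (fun y => φ (f y)) (φ' • fderiv ℝ f x) x := hφ.comp_hasFDerivAt x hf.hasFDerivAt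
  simp only [gradient]
  rw [h.fderiv, map_smulₛₗ]
  simp

theorem gradient_mul {f g : E d → ℝ} {x : E d} (hf : DifferentiableAt ℝ f x)
    (hg : DifferentiableAt ℝ g x) : ∇ (fun y => f y * g y) x = f x • (∇ g) x + g x • (∇ f) x := by
  simp only [gradient]
  rw [fderiv_fun_mul hf hg, map_add, map_smulₛₗ, map_smulₛₗ]
  simp

theorem gradient_rpow {f : E d → ℝ} {x : E d} (ρ : ℝ) (hf : DifferentiableAt ℝ f x)
    (hpos : 0 < f x) : ∇ (fun y => f y ^ ρ) x = (ρ * f x ^ (ρ - 1)) • (∇ f) x :=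
  gradient_comp (φ := fun s => s ^ ρ) (Real.hasDerivAt_rpow_const (Or.inl hpos.ne')) hf

theorem sq_norm_gradient_rpow {f : E d → ℝ} {x : E d} (ρ : ℝ) (hf : DifferentiableAt ℝ f x)
    (hpos : 0 < f x) : ‖∇ (fun y => f y ^ (ρ / 2)) x‖ ^ 2
      = ρ ^ 2 / 4 * (f x ^ (ρ - 2) * ‖(∇ f) x‖ ^ 2) := by
  rw [gradient_rpow _ hf hpos, norm_smul, mul_pow, Real.norm_eq_abs, sq_abs, mul_pow,
    ← Real.rpow_natCast (f x ^ (ρ / 2 - 1)) 2, ← Real.rpow_mul hpos.le]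
  have : (ρ / 2 - 1) * ((2 : ℕ) : ℝ) = ρ - 2 := by push_cast; ring
  rw [this]
  ring

/-- The total drift `D_pH₀(x, Du/m^α) + b`, with which the density is transported. -/
noncomputable def drift (α : ℝ) (D : Data d) (u m : E d → ℝ → ℝ) (x : E d) (t : ℝ) : E d :=
  DpH D.L₀ x (momentum α u m x t) + D.b x t

/-- The first-order part `m^α H₀(x, Du/m^α) + b·Du - V(x,m)` of the Hamilton-Jacobi equation. -/
noncomputable def source (α : ℝ) (D : Data d) (u m : E d → ℝ → ℝ) (x : E d) (t : ℝ) : ℝ :=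
  m x t ^ α * hamiltonian D.L₀ x (momentum α u m x t)
    + inner ℝ (D.b x t) (∇ (fun y => u y t) x) - D.V x (m x t)

variable {α γ γ' T : ℝ} {K : Constants} {D : Data d} {u m : E d → ℝ → ℝ}

namespace IsSmoothSolution

theorem contDiff_u (S : IsSmoothSolution α T D u m) {t : ℝ} (ht : t ∈ Icc 0 T) :
    ContDiff ℝ ∞ (fun x => u x t) := contDiff_slice S.u_smooth ht

theorem contDiff_m (S : IsSmoothSolution α T D u m) {t : ℝ} (ht : t ∈ Icc 0 T) :
    ContDiff ℝ ∞ (fun x => m x t) := contDiff_slice S.m_smooth ht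

theorem continuous_rpow_m (S : IsSmoothSolution α T D u m) {t : ℝ} (ht : t ∈ Icc 0 T) (ρ : ℝ) :
    Continuous (fun x => m x t ^ ρ) :=
  (S.contDiff_m ht).continuous.rpow_const fun x => Or.inl (S.m_pos x t ht).ne'

theorem contDiff_rpow_m (S : IsSmoothSolution α T D u m) {t : ℝ} (ht : t ∈ Icc 0 T) (ρ : ℝ) :
    ContDiff ℝ ∞ (fun x => m x t ^ ρ) :=
  (S.contDiff_m ht).rpow_const_of_ne fun x => (S.m_pos x t ht).ne'

theorem continuous_gradient_u (S : IsSmoothSolution α T D u m) {t : ℝ} (ht : t ∈ Icc 0 T) :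
    Continuous (∇ (fun x => u x t)) := continuous_gradient ((S.contDiff_u ht).of_le (by simp))

theorem continuous_gradient_m (S : IsSmoothSolution α T D u m) {t : ℝ} (ht : t ∈ Icc 0 T) :
    Continuous (∇ (fun x => m x t)) := continuous_gradient ((S.contDiff_m ht).of_le (by simp))

theorem continuous_momentum (S : IsSmoothSolution α T D u m) {t : ℝ} (ht : t ∈ Icc 0 T) :
    Continuous (fun x => momentum α u m x t) :=
  ((S.continuous_rpow_m ht α).inv₀ fun x => (Real.rpow_pos_of_pos (S.m_pos x t ht) _).ne').smul
    (S.continuous_gradient_u ht)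

theorem smul_momentum (S : IsSmoothSolution α T D u m) {t : ℝ} (ht : t ∈ Icc 0 T) (x : E d) :
    m x t ^ α • momentum α u m x t = ∇ (fun y => u y t) x := by
  rw [momentum, smul_inv_smul₀ (Real.rpow_pos_of_pos (S.m_pos x t ht) _).ne']

theorem continuous_deriv_u (S : IsSmoothSolution α T D u m) {t : ℝ} (ht : t ∈ Ioo 0 T) :
    Continuous (fun x => deriv (fun s => u x s) t) :=
  (continuousOn_deriv_time ((S.u_smooth.of_le (by simp)).mono
    (prod_mono_right Ioo_subset_Icc_self))).comp_continuous
    (by fun_prop : Continuous fun x : E d => (x, t)) fun x => ⟨mem_univ _, ht⟩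

theorem continuous_deriv_m (S : IsSmoothSolution α T D u m) {t : ℝ} (ht : t ∈ Ioo 0 T) :
    Continuous (fun x => deriv (fun s => m x s) t) :=
  (continuousOn_deriv_time ((S.m_smooth.of_le (by simp)).mono
    (prod_mono_right Ioo_subset_Icc_self))).comp_continuous
    (by fun_prop : Continuous fun x : E d => (x, t)) fun x => ⟨mem_univ _, ht⟩

theorem hasDerivAt_u (S : IsSmoothSolution α T D u m) {t : ℝ} (ht : t ∈ Ioo 0 T) (x : E d) :
    HasDerivAt (fun s => u x s) (deriv (fun s => u x s) t) t :=
  (hasDerivAt_of_contDiffOn ((S.u_smooth.of_le (by simp)).mono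
    (prod_mono_right Ioo_subset_Icc_self)) x ht).differentiableAt.hasDerivAt

theorem hasDerivAt_m (S : IsSmoothSolution α T D u m) {t : ℝ} (ht : t ∈ Ioo 0 T) (x : E d) :
    HasDerivAt (fun s => m x s) (deriv (fun s => m x s) t) t :=
  (hasDerivAt_of_contDiffOn ((S.m_smooth.of_le (by simp)).mono
    (prod_mono_right Ioo_subset_Icc_self)) x ht).differentiableAt.hasDerivAt

theorem deriv_u_eq (S : IsSmoothSolution α T D u m) {t : ℝ} (ht : t ∈ Ioo 0 T) (x : E d) :
    deriv (fun s => u x s) t = -divergence (∇ (fun y => u y t)) x + source α D u m x t := by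
  have h := S.hamilton_jacobi x t ht
  rw [laplacian_eq_divergence ((S.contDiff_u (Ioo_subset_Icc_self ht)).of_le two_le_smooth)] at h
  rw [source]
  linarith

theorem continuous_divergence_u (S : IsSmoothSolution α T D u m) {t : ℝ} (ht : t ∈ Icc 0 T) :
    Continuous (divergence (∇ (fun y => u y t))) :=
  continuous_divergence (contDiff_gradient (S.contDiff_u ht) one_add_one_le_smooth)

theorem continuous_divergence_m (S : IsSmoothSolution α T D u m) {t : ℝ} (ht : t ∈ Icc 0 T) :
    Continuous (divergence (∇ (fun y => m y t))) :=
  continuous_divergence (contDiff_gradient (S.contDiff_m ht) one_add_one_le_smooth)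

/-- The Hamiltonian is not assumed to be continuous; along a solution, the Hamilton-Jacobi
equation expresses the first-order terms by continuous functions. -/
theorem continuous_source (S : IsSmoothSolution α T D u m) {t : ℝ} (ht : t ∈ Ioo 0 T) :
    Continuous (fun x => source α D u m x t) := by
  have h : (fun x => source α D u m x t)
      = fun x => deriv (fun s => u x s) t + divergence (∇ (fun y => u y t)) x := by
    funext x; rw [S.deriv_u_eq ht]; ring
  rw [h]
  exact (S.continuous_deriv_u ht).add (S.continuous_divergence_u (Ioo_subset_Icc_self ht))

/-- The Hamilton-Jacobi equation tested with a periodic function. -/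
theorem integral_mul_deriv_u (hd : 1 ≤ d) (S : IsSmoothSolution α T D u m) {t : ℝ}
    (ht : t ∈ Ioo 0 T) {ζ : E d → ℝ} (hζ : ContDiff ℝ 1 ζ) (hζp : Periodic ζ) :
    ∫ x in cube d, ζ x * deriv (fun s => u x s) t
      = ∫ x in cube d, (inner ℝ ((∇ ζ) x) (∇ (fun y => u y t) x) + ζ x * source α D u m x t) := by
  have ht' := Ioo_subset_Icc_self ht
  have hc1 := S.continuous_divergence_u ht'
  have hibp := integral_mul_divergence hd hζ hζp
    ((contDiff_gradient (n := 1) (S.contDiff_u ht') one_add_one_le_smooth).differentiable one_ne_zero)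
    (S.u_periodic t ht').gradient hc1
  rw [integral_cube_add (f := fun x => inner ℝ ((∇ ζ) x) (∇ (fun y => u y t) x))
    (g := fun x => ζ x * source α D u m x t)
    ((continuous_gradient hζ).inner (S.continuous_gradient_u ht'))
    (hζ.continuous.mul (S.continuous_source ht))]
  have h : ∀ x, ζ x * deriv (fun s => u x s) t
      = -(ζ x * divergence (∇ (fun y => u y t)) x) + ζ x * source α D u m x t := fun x => by
    rw [S.deriv_u_eq ht]; ring
  simp only [h]
  rw [integral_cube_add (f := fun x => -(ζ x * divergence (∇ (fun y => u y t)) x))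
    (g := fun x => ζ x * source α D u m x t) (hζ.continuous.mul hc1).neg
    (hζ.continuous.mul (S.continuous_source ht)), integral_neg, hibp, neg_neg]

section

variable (A : Assumptions γ γ' K T D) (S : IsSmoothSolution α T D u m)
include A S

theorem differentiable_flux {t : ℝ} (ht : t ∈ Ioo 0 T) :
    Differentiable ℝ (fun x => m x t • drift α D u m x t) := by
  have ht' := Ioo_subset_Icc_self ht
  have hb : ContDiff ℝ ∞ (fun x => D.b x t) := contDiff_slice A.b_smooth ht'
  have := (S.flux_differentiable t ht).add
    (((S.contDiff_m ht').smul hb).differentiable (by simp))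
  simpa [drift, smul_add, Pi.add_def] using this

theorem periodic_flux {t : ℝ} (ht : t ∈ Icc 0 T) :
    Periodic (fun x => m x t • drift α D u m x t) := by
  intro i x
  have h1 := S.m_periodic t ht i x
  have h2 := (S.u_periodic t ht).gradient i x
  have h3 := A.b_periodic t ht i x
  have h4 : DpH D.L₀ (x + EuclideanSpace.single i 1) = DpH D.L₀ x := by
    funext p
    simp only [DpH, hamiltonian, A.L₀_periodic i x]
  simp only at h1 h3
  simp only [drift, momentum, h1, h2, h3, h4]

/-- As for `continuous_source`, continuity of `D_pH₀` along the solution is a consequence of the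
differentiability of the flux, and of `m > 0`. -/
theorem continuous_drift {t : ℝ} (ht : t ∈ Ioo 0 T) :
    Continuous (fun x => drift α D u m x t) := by
  have ht' := Ioo_subset_Icc_self ht
  have h := ((S.contDiff_m ht').continuous.inv₀ fun x => (S.m_pos x t ht').ne').smul
    (S.differentiable_flux A ht).continuous
  refine h.congr fun x => ?_
  simp only [Pi.smul_apply', Pi.inv_apply]
  exact inv_smul_smul₀ (S.m_pos x t ht').ne' _

theorem deriv_m_eq {t : ℝ} (ht : t ∈ Ioo 0 T) (x : E d) :
    deriv (fun s => m x s) t = divergence (∇ (fun y => m y t)) x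
      + divergence (fun y => m y t • drift α D u m y t) x := by
  have ht' := Ioo_subset_Icc_self ht
  have h := S.fokker_planck x t ht
  have hb : ContDiff ℝ ∞ (fun x => D.b x t) := contDiff_slice A.b_smooth ht'
  rw [laplacian_eq_divergence ((S.contDiff_m ht').of_le two_le_smooth)] at h
  simp only [drift, smul_add]
  rw [divergence_add (G := fun y => m y t • D.b y t) (S.flux_differentiable t ht x)
    (((S.contDiff_m ht').smul hb).differentiable (by simp) x)]
  linarith

/-- The Fokker-Planck equation tested with a periodic function. -/
theorem integral_mul_deriv_m (hd : 1 ≤ d) {t : ℝ}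
    (ht : t ∈ Ioo 0 T) {ζ : E d → ℝ} (hζ : ContDiff ℝ 1 ζ) (hζp : Periodic ζ) :
    ∫ x in cube d, ζ x * deriv (fun s => m x s) t
      = -∫ x in cube d, (inner ℝ ((∇ ζ) x) (∇ (fun y => m y t) x)
          + m x t * inner ℝ ((∇ ζ) x) (drift α D u m x t)) := by
  have ht' := Ioo_subset_Icc_self ht
  have hc1 := S.continuous_divergence_m ht'
  -- the flux need not be `C¹`, but the equation makes its divergence continuous
  have hc2 : Continuous (divergence fun y => m y t • drift α D u m y t) := by
    have h : (divergence fun y => m y t • drift α D u m y t)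
        = fun x => deriv (fun s => m x s) t - divergence (∇ (fun y => m y t)) x := by
      funext x; rw [S.deriv_m_eq A ht]; ring
    rw [h]
    exact (S.continuous_deriv_m ht).sub hc1
  have hibp := integral_mul_divergence hd hζ hζp
    ((contDiff_gradient (n := 1) (S.contDiff_m ht') one_add_one_le_smooth).differentiable one_ne_zero)
    (S.m_periodic t ht').gradient hc1
  have hibp2 := integral_mul_divergence hd hζ hζp (S.differentiable_flux A ht)
    (S.periodic_flux A ht') hc2
  simp only [inner_smul_right] at hibp2
  have hg := continuous_gradient hζ
  rw [integral_cube_add (f := fun x => inner ℝ ((∇ ζ) x) (∇ (fun y => m y t) x))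
    (g := fun x => m x t * inner ℝ ((∇ ζ) x) (drift α D u m x t))
    (hg.inner (S.continuous_gradient_m ht'))
    ((S.contDiff_m ht').continuous.mul (hg.inner (S.continuous_drift A ht)))]
  simp only [S.deriv_m_eq A ht, mul_add]
  rw [integral_cube_add (f := fun x => ζ x * divergence (∇ (fun y => m y t)) x)
    (g := fun x => ζ x * divergence (fun y => m y t • drift α D u m y t) x)
    (hζ.continuous.mul hc1) (hζ.continuous.mul hc2), hibp, hibp2]
  ring

end

end IsSmoothSolution

end CongestionMFG

/-! ### Evolution of the functionals `∫ P(u) m^ρ` -/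

namespace CongestionMFG

variable {d : ℕ} {α γ γ' T : ℝ} {K : Constants} {D : Data d} {u m : E d → ℝ → ℝ}

/-- The density of the time derivative of `∫ P(u) m^ρ` along a solution, after the second-order
terms have been integrated by parts. -/
noncomputable def rate (α : ℝ) (D : Data d) (u m : E d → ℝ → ℝ) (P : ℝ → ℝ) (ρ : ℝ) (x : E d)
    (t : ℝ) : ℝ :=
  deriv (deriv P) (u x t) * m x t ^ ρ * ‖∇ (fun y => u y t) x‖ ^ 2
    + deriv P (u x t) * m x t ^ ρ * source α D u m x t
    - ρ * (ρ - 1) * P (u x t) * m x t ^ (ρ - 2) * ‖∇ (fun y => m y t) x‖ ^ 2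
    - ρ * deriv P (u x t) * m x t ^ ρ * inner ℝ (∇ (fun y => u y t) x) (drift α D u m x t)
    - ρ * (ρ - 1) * P (u x t) * m x t ^ (ρ - 1)
      * inner ℝ (∇ (fun y => m y t) x) (drift α D u m x t)

namespace IsSmoothSolution

variable (A : Assumptions γ γ' K T D) (S : IsSmoothSolution α T D u m)
include S

theorem contDiff_comp_u {P : ℝ → ℝ} {O : Set ℝ} (hP : ContDiffOn ℝ ∞ P O)
    (hu : ∀ x, ∀ t ∈ Icc 0 T, u x t ∈ O) {t : ℝ} (ht : t ∈ Icc 0 T) :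
    ContDiff ℝ ∞ (fun x => P (u x t)) :=
  contDiffOn_univ.1 (hP.comp (S.contDiff_u ht).contDiffOn fun x _ => hu x t ht)

theorem contDiffOn_integrand {P : ℝ → ℝ} {O : Set ℝ} (hP : ContDiffOn ℝ ∞ P O)
    (hu : ∀ x, ∀ t ∈ Icc 0 T, u x t ∈ O) (ρ : ℝ) :
    ContDiffOn ℝ ∞ (fun z : E d × ℝ => P (u z.1 z.2) * m z.1 z.2 ^ ρ) (univ ×ˢ Icc 0 T) :=
  (hP.comp S.u_smooth fun z hz => hu z.1 z.2 hz.2).mul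
    (S.m_smooth.rpow_const_of_ne fun z hz => (S.m_pos z.1 z.2 hz.2).ne')

theorem continuousOn_integral {P : ℝ → ℝ} {O : Set ℝ} (hP : ContDiffOn ℝ ∞ P O)
    (hu : ∀ x, ∀ t ∈ Icc 0 T, u x t ∈ O) (ρ : ℝ) :
    ContinuousOn (fun t => ∫ x in cube d, P (u x t) * m x t ^ ρ) (Icc 0 T) :=
  continuousOn_integral_cube (S.contDiffOn_integrand hP hu ρ).continuousOn

include A

theorem continuous_rate {P : ℝ → ℝ} {O : Set ℝ} (hO : IsOpen O) (hP : ContDiffOn ℝ ∞ P O)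
    (hu : ∀ x, ∀ t ∈ Icc 0 T, u x t ∈ O) (ρ : ℝ) {t : ℝ} (ht : t ∈ Ioo 0 T) :
    Continuous (fun x => rate α D u m P ρ x t) := by
  have ht' := Ioo_subset_Icc_self ht
  have hP1 : ContDiffOn ℝ ∞ (deriv P) O := hP.deriv_of_isOpen hO le_rfl
  have hP2 : ContDiffOn ℝ ∞ (deriv (deriv P)) O := hP1.deriv_of_isOpen hO le_rfl
  have c0 := (S.contDiff_comp_u hP hu ht').continuous
  have c1 := (S.contDiff_comp_u hP1 hu ht').continuous
  have c2 := (S.contDiff_comp_u hP2 hu ht').continuous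
  have gu := S.continuous_gradient_u ht'
  have gm := S.continuous_gradient_m ht'
  have dr := S.continuous_drift A ht
  exact (((((c2.mul (S.continuous_rpow_m ht' ρ)).mul (gu.norm.pow 2)).add
    ((c1.mul (S.continuous_rpow_m ht' ρ)).mul (S.continuous_source ht))).sub
    (((continuous_const.mul c0).mul (S.continuous_rpow_m ht' (ρ - 2))).mul (gm.norm.pow 2))).sub
    (((continuous_const.mul c1).mul (S.continuous_rpow_m ht' ρ)).mul (gu.inner dr))).sub
    (((continuous_const.mul c0).mul (S.continuous_rpow_m ht' (ρ - 1))).mul (gm.inner dr))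

/-- The evolution of `∫ P(u) m^ρ`. The two second-order cross terms cancel, because the
Laplacians in the two equations have opposite signs. -/
theorem hasDerivAt_integral (hd : 1 ≤ d) {P : ℝ → ℝ} {O : Set ℝ} (hO : IsOpen O)
    (hP : ContDiffOn ℝ ∞ P O) (hu : ∀ x, ∀ t ∈ Icc 0 T, u x t ∈ O) (ρ : ℝ) {t : ℝ}
    (ht : t ∈ Ioo 0 T) : HasDerivAt (fun s => ∫ x in cube d, P (u x s) * m x s ^ ρ)
      (∫ x in cube d, rate α D u m P ρ x t) t := by
  have ht' := Ioo_subset_Icc_self ht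
  have hP1 : ContDiffOn ℝ ∞ (deriv P) O := hP.deriv_of_isOpen hO le_rfl
  have dP : ∀ x, HasDerivAt P (deriv P (u x t)) (u x t) := fun x =>
    ((hP.differentiableOn (by simp)).differentiableAt (hO.mem_nhds (hu x t ht'))).hasDerivAt
  have dP1 : ∀ x, HasDerivAt (deriv P) (deriv (deriv P) (u x t)) (u x t) := fun x =>
    ((hP1.differentiableOn (by simp)).differentiableAt (hO.mem_nhds (hu x t ht'))).hasDerivAt
  have hder := hasDerivAt_integral_cube (f := fun x s => P (u x s) * m x s ^ ρ)
    (((S.contDiffOn_integrand hP hu ρ).of_le (by simp)).mono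
      (prod_mono_right Ioo_subset_Icc_self)) ht
  convert hder using 1
  -- the two test functions
  set ζ : E d → ℝ := fun x => deriv P (u x t) * m x t ^ ρ with hζ
  set η : E d → ℝ := fun x => ρ * (P (u x t) * m x t ^ (ρ - 1)) with hη
  have hζs : ContDiff ℝ 1 ζ :=
    ((S.contDiff_comp_u hP1 hu ht').mul (S.contDiff_rpow_m ht' ρ)).of_le (by simp)
  have hηs : ContDiff ℝ 1 η := (contDiff_const.mul
    ((S.contDiff_comp_u hP hu ht').mul (S.contDiff_rpow_m ht' (ρ - 1)))).of_le (by simp)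
  have hζp : Periodic ζ := (S.u_periodic t ht').comp₂ (S.m_periodic t ht')
    (fun a b => deriv P a * b ^ ρ)
  have hηp : Periodic η := (S.u_periodic t ht').comp₂ (S.m_periodic t ht')
    (fun a b => ρ * (P a * b ^ (ρ - 1)))
  have hpt : ∀ x, deriv (fun s => P (u x s) * m x s ^ ρ) t
      = ζ x * deriv (fun s => u x s) t + η x * deriv (fun s => m x s) t := fun x => by
    have h1 := ((dP x).comp t (S.hasDerivAt_u ht x)).mul
      ((S.hasDerivAt_m ht x).rpow_const (p := ρ) (Or.inl (S.m_pos x t ht').ne'))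
    have h2 : deriv (fun s => P (u x s) * m x s ^ ρ) t = _ := h1.deriv
    rw [h2]
    simp only [hζ, hη, Function.comp]
    ring
  simp only [hpt]
  have cζ := (hζs.continuous.mul (S.continuous_deriv_u ht))
  have cη := (hηs.continuous.mul (S.continuous_deriv_m ht))
  rw [integral_cube_add (f := fun x => ζ x * deriv (fun s => u x s) t)
    (g := fun x => η x * deriv (fun s => m x s) t) cζ cη,
    S.integral_mul_deriv_u hd ht hζs hζp, S.integral_mul_deriv_m A hd ht hηs hηp,
    ← sub_eq_add_neg]
  have gu := S.continuous_gradient_u ht'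
  have gm := S.continuous_gradient_m ht'
  rw [← integral_cube_sub
    (f := fun x => inner ℝ ((∇ ζ) x) (∇ (fun y => u y t) x) + ζ x * source α D u m x t)
    (g := fun x => inner ℝ ((∇ η) x) (∇ (fun y => m y t) x)
      + m x t * inner ℝ ((∇ η) x) (drift α D u m x t))
    (((continuous_gradient hζs).inner gu).add (hζs.continuous.mul (S.continuous_source ht)))
    (((continuous_gradient hηs).inner gm).add ((S.contDiff_m ht').continuous.mul
      ((continuous_gradient hηs).inner (S.continuous_drift A ht))))]
  refine integral_congr_ae (Filter.Eventually.of_forall fun x => ?_)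
  have hm := S.m_pos x t ht'
  have du : DifferentiableAt ℝ (fun y => u y t) x := (S.contDiff_u ht').differentiable (by simp) x
  have dm : DifferentiableAt ℝ (fun y => m y t) x := (S.contDiff_m ht').differentiable (by simp) x
  have dmr : ∀ r : ℝ, DifferentiableAt ℝ (fun y => m y t ^ r) x := fun r =>
    (S.contDiff_rpow_m ht' r).differentiable (by simp) x
  have e1 : (∇ ζ) x = (deriv P (u x t) * (ρ * m x t ^ (ρ - 1))) • ∇ (fun y => m y t) x
      + (m x t ^ ρ * deriv (deriv P) (u x t)) • ∇ (fun y => u y t) x := by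
    rw [hζ, gradient_mul ((S.contDiff_comp_u hP1 hu ht').differentiable (by simp) x) (dmr ρ),
      gradient_rpow ρ dm hm, gradient_comp (f := fun y => u y t) (dP1 x) du, smul_smul, smul_smul]
  have e2 : (∇ η) x = (ρ * (ρ - 1) * P (u x t) * m x t ^ (ρ - 2)) • ∇ (fun y => m y t) x
      + (ρ * deriv P (u x t) * m x t ^ (ρ - 1)) • ∇ (fun y => u y t) x := by
    have dq : DifferentiableAt ℝ (fun y => P (u y t) * m y t ^ (ρ - 1)) x :=
      (((S.contDiff_comp_u hP hu ht').mul (S.contDiff_rpow_m ht' (ρ - 1)))).differentiable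
        (by simp) x
    have e3 : (∇ η) x = ρ • ∇ (fun y => P (u y t) * m y t ^ (ρ - 1)) x :=
      gradient_comp (φ := fun s => ρ * s) (φ' := ρ)
        (f := fun y => P (u y t) * m y t ^ (ρ - 1)) (by
          simpa using (hasDerivAt_id (P (u x t) * m x t ^ (ρ - 1))).const_mul ρ) dq
    rw [e3, gradient_mul ((S.contDiff_comp_u hP hu ht').differentiable (by simp) x) (dmr (ρ - 1)),
      gradient_rpow (ρ - 1) dm hm, gradient_comp (f := fun y => u y t) (dP x) du, smul_add,
      smul_smul, smul_smul, smul_smul, smul_smul]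
    have : ρ - 1 - 1 = ρ - 2 := by ring
    rw [this]
    congr 2 <;> ring
  have r1 : m x t * m x t ^ (ρ - 1) = m x t ^ ρ := by
    rw [Real.rpow_sub_one hm.ne']; field_simp
  have r2 : m x t * m x t ^ (ρ - 2) = m x t ^ (ρ - 1) := by
    rw [show ρ - 2 = (ρ - 1) - 1 by ring, Real.rpow_sub_one hm.ne' (ρ - 1)]; field_simp
  simp only [rate, e1, e2, inner_add_left, inner_smul_left, real_inner_self_eq_norm_sq,
    conj_trivial]
  rw [real_inner_comm (∇ (fun y => m y t) x) (∇ (fun y => u y t) x), hζ]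
  simp only
  linear_combination (ρ * deriv P (u x t)
      * inner ℝ (∇ (fun y => u y t) x) (drift α D u m x t)) * r1
    + (ρ * (ρ - 1) * P (u x t) * inner ℝ (∇ (fun y => m y t) x) (drift α D u m x t)) * r2

end IsSmoothSolution

end CongestionMFG

/-! ### Pointwise bounds, the maximum principle and conservation of mass -/

namespace CongestionMFG

variable {d : ℕ} {α γ γ' T : ℝ} {K : Constants} {D : Data d} {u m : E d → ℝ → ℝ}

/-- A single constant dominating all the constants of the problem. -/
noncomputable def Constants.bound (K : Constants) : ℝ :=
  1 + |K.c₂| + |K.CH| + |K.CD| + |K.Mm| + |K.MΨ| + |K.Mb| + |K.MV| + K.cH⁻¹ + K.k₀⁻¹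

theorem Constants.le_bound (K : Constants) : 1 ≤ K.bound ∧ K.c₂ ≤ K.bound ∧ K.CH ≤ K.bound ∧
    K.CD ≤ K.bound ∧ K.Mm ≤ K.bound ∧ K.MΨ ≤ K.bound ∧ K.Mb ≤ K.bound ∧ K.MV ≤ K.bound ∧
    K.cH⁻¹ ≤ K.bound ∧ K.k₀⁻¹ ≤ K.bound := by
  have h1 := inv_pos.2 K.cH_pos
  have h2 := inv_pos.2 K.k₀_pos
  have a1 := abs_nonneg K.c₂
  have a2 := abs_nonneg K.CH
  have a3 := abs_nonneg K.CD
  have a4 := abs_nonneg K.Mm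
  have a5 := abs_nonneg K.MΨ
  have a6 := abs_nonneg K.Mb
  have a7 := abs_nonneg K.MV
  have b1 := le_abs_self K.c₂
  have b2 := le_abs_self K.CH
  have b3 := le_abs_self K.CD
  have b4 := le_abs_self K.Mm
  have b5 := le_abs_self K.MΨ
  have b6 := le_abs_self K.Mb
  have b7 := le_abs_self K.MV
  unfold Constants.bound
  refine ⟨?_, ?_, ?_, ?_, ?_, ?_, ?_, ?_, ?_, ?_⟩ <;> linarith

theorem Constants.one_le_bound (K : Constants) : 1 ≤ K.bound := K.le_bound.1

theorem Constants.inv_bound_le_cH (K : Constants) : K.bound⁻¹ ≤ K.cH :=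
  inv_le_of_inv_le₀ K.cH_pos K.le_bound.2.2.2.2.2.2.2.2.1

theorem Constants.inv_bound_le_k₀ (K : Constants) : K.bound⁻¹ ≤ K.k₀ :=
  inv_le_of_inv_le₀ K.k₀_pos K.le_bound.2.2.2.2.2.2.2.2.2

namespace Assumptions

variable (A : Assumptions γ γ' K T D)
include A

/-- By the superlinear growth of `L₀` the supremum in the Legendre transform is finite. -/
theorem bddAbove_legendre (hγ' : 1 < γ') (x p : E d) :
    BddAbove (range fun v : E d => -inner ℝ p v - D.L₀ x v) := by
  have hC := K.C₁_pos
  set ρ := (‖p‖ * γ' / K.C₁) ^ (1 / (γ' - 1)) with hρ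
  have h0 : 0 ≤ ‖p‖ * γ' / K.C₁ := by positivity
  have hρ0 : 0 ≤ ρ := Real.rpow_nonneg h0 _
  refine ⟨‖p‖ * ρ + K.c₁, ?_⟩
  rintro _ ⟨v, rfl⟩
  have h1 : -inner ℝ p v ≤ ‖p‖ * ‖v‖ := (neg_le_abs _).trans (abs_real_inner_le_norm p v)
  have h2 := A.L₀_lower x v
  -- for `ρ ≤ |v|` the Lagrangian dominates the linear term
  have h3 : ‖p‖ * ‖v‖ ≤ ‖p‖ * ρ + K.C₁ * (‖v‖ ^ γ' / γ') := by
    rcases le_total ‖v‖ ρ with hv | hv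
    · have := mul_le_mul_of_nonneg_left hv (norm_nonneg p)
      have : 0 ≤ K.C₁ * (‖v‖ ^ γ' / γ') := by positivity
      linarith
    · have h4 : ‖p‖ * γ' / K.C₁ ≤ ‖v‖ ^ (γ' - 1) := by
        have := Real.rpow_le_rpow hρ0 hv (by linarith : 0 ≤ γ' - 1)
        rwa [hρ, ← Real.rpow_mul h0, one_div_mul_cancel (by linarith), Real.rpow_one] at this
      have h5 : ‖v‖ ^ γ' = ‖v‖ ^ (γ' - 1) * ‖v‖ := by
        rw [← Real.rpow_add_one' (norm_nonneg v) (by linarith), sub_add_cancel]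
      rw [div_le_iff₀ hC] at h4
      have h6 : ‖p‖ ≤ K.C₁ * (‖v‖ ^ (γ' - 1) / γ') := by
        rw [← mul_div_assoc, le_div_iff₀ (by linarith)]
        linarith
      have h7 := mul_le_mul_of_nonneg_right h6 (norm_nonneg v)
      have h8 := mul_nonneg (norm_nonneg p) hρ0
      rw [h5]
      calc ‖p‖ * ‖v‖ ≤ K.C₁ * (‖v‖ ^ (γ' - 1) / γ') * ‖v‖ := h7
        _ = K.C₁ * (‖v‖ ^ (γ' - 1) * ‖v‖ / γ') := by ring
        _ ≤ _ := by linarith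
  show -inner ℝ p v - D.L₀ x v ≤ _
  linarith

theorem neg_bound_le_hamiltonian (hγ' : 1 < γ') (x p : E d) :
    -K.bound ≤ hamiltonian D.L₀ x p := by
  have h0 : D.L₀ x 0 ≤ K.c₂ := by
    have := A.L₀_upper x 0
    simpa [Real.zero_rpow (by linarith : γ' ≠ 0)] using this
  have hc : K.c₂ ≤ K.bound := K.le_bound.2.1
  have h1 : -inner ℝ p (0 : E d) - D.L₀ x 0 ≤ hamiltonian D.L₀ x p :=
    le_ciSup (A.bddAbove_legendre hγ' x p) 0
  rw [inner_zero_right] at h1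
  linarith

theorem hamiltonian_zero_nonpos (x : E d) : hamiltonian D.L₀ x 0 ≤ 0 :=
  Real.iSup_nonpos fun v => by
    have := A.L₀_nonneg x v
    simp only [inner_zero_left]
    linarith

theorem coercive (x p : E d) : K.bound⁻¹ * ‖p‖ ^ γ - K.bound
    ≤ inner ℝ p (DpH D.L₀ x p) - hamiltonian D.L₀ x p := by
  have h1 := A.H_coercive x p
  have h2 : K.CH ≤ K.bound := K.le_bound.2.2.1
  have h3 := mul_le_mul_of_nonneg_right K.inv_bound_le_cH (Real.rpow_nonneg (norm_nonneg p) γ)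
  linarith

/-- The total drift grows at most like `|p|^{γ-1}` in the rescaled momentum; stated for squares. -/
theorem sq_norm_drift_le {t : ℝ} (ht : t ∈ Icc 0 T) (x : E d) :
    ‖drift α D u m x t‖ ^ 2
      ≤ 8 * K.bound ^ 2 * (1 + ‖momentum α u m x t‖ ^ (2 * (γ - 1))) := by
  set p := momentum α u m x t
  have hB := K.one_le_bound
  have h1 := A.DpH_bound x p
  have h2 := A.b_bound x t ht
  have h3 : K.CD ≤ K.bound := K.le_bound.2.2.2.1
  have h4 : K.Mb ≤ K.bound := K.le_bound.2.2.2.2.2.2.1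
  have hq : 0 ≤ ‖p‖ ^ (γ - 1) := Real.rpow_nonneg (norm_nonneg p) _
  have h5 := mul_le_mul_of_nonneg_right h3 hq
  have h6 : ‖drift α D u m x t‖ ≤ 2 * K.bound * (1 + ‖p‖ ^ (γ - 1)) := by
    have := norm_add_le (DpH D.L₀ x p) (D.b x t)
    have h7 := mul_nonneg (by linarith : 0 ≤ K.bound) hq
    rw [drift]
    linarith
  have h8 : ‖p‖ ^ (2 * (γ - 1)) = (‖p‖ ^ (γ - 1)) ^ 2 := by
    rw [mul_comm, Real.rpow_mul (norm_nonneg p)]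
    norm_cast
  rw [h8]
  calc ‖drift α D u m x t‖ ^ 2 ≤ (2 * K.bound * (1 + ‖p‖ ^ (γ - 1))) ^ 2 :=
        pow_le_pow_left₀ (norm_nonneg _) h6 2
    _ ≤ _ := by
        have := mul_nonneg (sq_nonneg K.bound) (sq_nonneg (1 - ‖p‖ ^ (γ - 1)))
        nlinarith

end Assumptions

theorem nonneg_of_hasDerivAt_of_le_right {g : ℝ → ℝ} {g' a b : ℝ} (hab : a < b)
    (hg : HasDerivAt g g' a) (h : ∀ s ∈ Icc a b, g a ≤ g s) : 0 ≤ g' := by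
  have h1 : HasDerivWithinAt g g' (Ioi a) a := hg.hasDerivWithinAt
  rw [hasDerivWithinAt_iff_tendsto_slope' (by simp)] at h1
  refine ge_of_tendsto h1 ?_
  filter_upwards [Ioc_mem_nhdsGT hab] with s hs
  rw [slope_def_field]
  exact div_nonneg (sub_nonneg.2 (h s ⟨hs.1.le, hs.2⟩)) (sub_nonneg.2 hs.1.le)

namespace IsSmoothSolution

variable (A : Assumptions γ γ' K T D) (S : IsSmoothSolution α T D u m)
include A S

/-- The minimum principle for the value function. At a spatial minimum the Hamiltonian is
evaluated at zero momentum, where it is nonpositive since `L₀ ≥ 0`. -/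
theorem neg_le_u_of_pos {t : ℝ} (ht : t ∈ Ioc 0 T) (x : E d) :
    -(K.bound + (K.bound + 1) * T) ≤ u x t := by
  have hB := K.one_le_bound
  have hT : 0 < T := ht.1.trans_le ht.2
  set φ : E d × ℝ → ℝ := fun z => u z.1 z.2 + (K.bound + 1) * (T - z.2) with hφ
  have hsub : Icc t T ⊆ Icc 0 T := Icc_subset_Icc_left ht.1.le
  have hcont : ContinuousOn φ (closedCube d ×ˢ Icc t T) :=
    (S.u_smooth.continuousOn.mono (prod_mono (subset_univ _) hsub)).add (by fun_prop)
  have hne : (closedCube d ×ˢ Icc t T).Nonempty :=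
    ⟨(0, t), fun i => by simp, ⟨le_rfl, ht.2⟩⟩
  obtain ⟨⟨y, s⟩, ⟨hy, hs⟩, hmin⟩ :=
    ((isCompact_closedCube d).prod isCompact_Icc).exists_isMinOn hne hcont
  have hmin' : ∀ z, ∀ r ∈ Icc t T, φ (y, s) ≤ φ (z, r) := fun z r hr =>
    (S.u_periodic r (hsub hr)).forall_of_closedCube
      (P := fun w => φ (y, s) ≤ w + (K.bound + 1) * (T - r))
      (fun z hz => hmin (show (z, r) ∈ closedCube d ×ˢ Icc t T from ⟨hz, hr⟩)) z
  suffices h : -K.bound ≤ φ (y, s) by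
    have h1 := hmin' x t ⟨le_rfl, ht.2⟩
    simp only [hφ] at h1 h
    nlinarith [ht.1]
  rcases hs.2.eq_or_lt with hsT | hsT
  · have h1 := A.Ψ_bound y
    have h2 : K.MΨ ≤ K.bound := K.le_bound.2.2.2.2.2.1
    have hsT' : s = T := hsT
    simp only [hφ]
    rw [hsT', S.terminal]
    have := abs_le.1 h1
    linarith
  · exfalso
    have hs0 : s ∈ Ioo 0 T := ⟨ht.1.trans_le hs.1, hsT⟩
    have hs0' := Ioo_subset_Icc_self hs0
    have hder : HasDerivAt (fun r => φ (y, r)) (deriv (fun r => u y r) s + (K.bound + 1) * -1) s :=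
      (S.hasDerivAt_u hs0 y).add (((hasDerivAt_id s).const_sub T).const_mul _)
    have h1 := nonneg_of_hasDerivAt_of_le_right hsT hder
      fun r hr => hmin' y r ⟨hs.1.trans hr.1, hr.2⟩
    obtain ⟨h2, h3⟩ := laplacian_nonneg_of_isMinOn
      ((S.contDiff_u hs0').of_le two_le_smooth) (x := y) fun z => by
        have := hmin' z s hs
        simp only [hφ] at this
        linarith
    have h4 := S.hamilton_jacobi y s hs0
    have h5 : momentum α u m y s = 0 := by rw [momentum, h2, smul_zero]
    rw [h5, h2, inner_zero_right] at h4
    have h6 := mul_nonneg (Real.rpow_nonneg (S.m_pos y s hs0').le α)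
      (neg_nonneg.2 (A.hamiltonian_zero_nonpos y))
    have h7 := (abs_le.1 (A.V_bound y (m y s))).1
    have h8 : K.MV ≤ K.bound := K.le_bound.2.2.2.2.2.2.2.1
    linarith

theorem neg_le_u {t : ℝ} (hT : 0 < T) (ht : t ∈ Icc 0 T) (x : E d) :
    -(K.bound + (K.bound + 1) * T) ≤ u x t := by
  have hcl : closure (Ioc 0 T) = Icc 0 T := closure_Ioc hT.ne
  have hc : ContinuousOn (fun s => u x s) (Icc 0 T) :=
    S.u_smooth.continuousOn.comp (by fun_prop : ContinuousOn (fun s : ℝ => (x, s)) (Icc 0 T))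
      fun s hs => ⟨mem_univ _, hs⟩
  exact le_on_closure (f := fun _ => -(K.bound + (K.bound + 1) * T)) (g := fun s => u x s)
    (s := Ioc 0 T) (fun s hs => S.neg_le_u_of_pos A hs x) continuousOn_const (by rwa [hcl])
    (by rwa [hcl])

/-- The mass is conserved, and equal to one. -/
theorem integral_m (hd : 1 ≤ d) {t : ℝ} (ht : t ∈ Icc 0 T) : ∫ x in cube d, m x t = 1 := by
  have h0 : (0 : ℝ) ∈ Icc 0 T := ⟨le_rfl, ht.1.trans ht.2⟩
  have hP : ContDiffOn ℝ ∞ (fun _ : ℝ => (1 : ℝ)) univ := contDiffOn_const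
  have hu : ∀ x, ∀ t ∈ Icc 0 T, u x t ∈ (univ : Set ℝ) := fun _ _ _ => mem_univ _
  have hrate : ∀ x s, rate α D u m (fun _ => 1) 1 x s = 0 := fun x s => by simp [rate]
  have hc := S.continuousOn_integral hP hu 1
  have hder : ∀ s ∈ Ioo 0 T, HasDerivAt
      (fun s => ∫ x in cube d, (fun _ => (1 : ℝ)) (u x s) * m x s ^ (1 : ℝ)) 0 s := fun s hs => by
    have := S.hasDerivAt_integral A hd isOpen_univ hP hu 1 hs
    simpa only [hrate, integral_zero] using this
  have h1 := le_of_hasDerivAt_nonpos hc hder (fun _ _ => le_rfl) h0 ht ht.1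
  have h2 := le_of_hasDerivAt_nonpos hc.neg (fun s hs => (hder s hs).neg) (fun _ _ => by simp)
    h0 ht ht.1
  simp only [Real.rpow_one, one_mul, S.initial, A.m₀_integral] at h1 h2
  simp only [Pi.neg_apply, S.initial, A.m₀_integral] at h2
  linarith

end IsSmoothSolution

end CongestionMFG

/-! ### Pointwise estimates for the evolution of the functionals -/

namespace CongestionMFG

variable {d : ℕ} {α γ γ' T : ℝ} {K : Constants} {D : Data d} {u m : E d → ℝ → ℝ}

/-- The cross term `s^{ρ-1} a·b` is split by Young's inequality with the powers of `s` that match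
the dissipation `s^{ρ-2} |a|²`. -/
theorem neg_rpow_mul_inner_le {s : ℝ} (hs : 0 < s) (ρ : ℝ) (a b : E d) :
    -(s ^ (ρ - 1) * inner ℝ a b) ≤ (s ^ (ρ - 2) * ‖a‖ ^ 2 + s ^ ρ * ‖b‖ ^ 2) / 2 := by
  have h1 : s ^ (ρ - 1) = s * s ^ (ρ - 2) := by
    rw [show ρ - 1 = 1 + (ρ - 2) by ring, Real.rpow_add hs, Real.rpow_one]
  have h2 : s ^ ρ = s * s * s ^ (ρ - 2) := by
    rw [show s ^ ρ = s ^ (1 + (1 + (ρ - 2))) by ring_nf, Real.rpow_add hs, Real.rpow_add hs,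
      Real.rpow_one]
    ring
  have h3 := norm_add_sq_real a (s • b)
  rw [inner_smul_right, norm_smul, Real.norm_eq_abs, abs_of_pos hs] at h3
  have h4 := mul_nonneg (Real.rpow_pos_of_pos hs (ρ - 2)).le (sq_nonneg ‖a + s • b‖)
  rw [h3] at h4
  rw [h1, h2]
  linarith

theorem rpow_two_mul_sub_one_le (hγ : 1 < γ) (hγ2 : γ < 2) {q : ℝ} (hq : 0 ≤ q) :
    q ^ (2 * (γ - 1)) ≤ 1 + q ^ γ := by
  rcases le_total q 1 with h | h
  · have h1 := Real.rpow_le_one hq h (by linarith : 0 ≤ 2 * (γ - 1))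
    have h2 := Real.rpow_nonneg hq γ
    linarith
  · have h1 := Real.rpow_le_rpow_of_exponent_le h (by linarith : 2 * (γ - 1) ≤ γ)
    linarith

namespace Assumptions

variable (A : Assumptions γ γ' K T D)
include A

theorem abs_inner_b_le {t : ℝ} (ht : t ∈ Icc 0 T) (x : E d) :
    |inner ℝ (D.b x t) (∇ (fun y => u y t) x)| ≤ K.bound * ‖∇ (fun y => u y t) x‖ := by
  refine (abs_real_inner_le_norm _ _).trans (mul_le_mul_of_nonneg_right ?_ (norm_nonneg _))
  exact (A.b_bound x t ht).trans K.le_bound.2.2.2.2.2.2.1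

theorem abs_V_le {t : ℝ} (x : E d) : |D.V x (m x t)| ≤ K.bound :=
  (A.V_bound x (m x t)).trans K.le_bound.2.2.2.2.2.2.2.1

end Assumptions

namespace IsSmoothSolution

variable (A : Assumptions γ γ' K T D) (S : IsSmoothSolution α T D u m)
include S

theorem inner_gradient_drift {t : ℝ} (ht : t ∈ Icc 0 T) (x : E d) :
    inner ℝ (∇ (fun y => u y t) x) (drift α D u m x t)
      = m x t ^ α * inner ℝ (momentum α u m x t) (DpH D.L₀ x (momentum α u m x t))
        + inner ℝ (D.b x t) (∇ (fun y => u y t) x) := by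
  rw [drift, inner_add_right, real_inner_comm (D.b x t)]
  conv_lhs => rw [← S.smul_momentum ht x, inner_smul_left]
  rw [S.smul_momentum ht x, conj_trivial]

theorem norm_gradient_u {t : ℝ} (ht : t ∈ Icc 0 T) (x : E d) :
    ‖∇ (fun y => u y t) x‖ = m x t ^ α * ‖momentum α u m x t‖ := by
  rw [← S.smul_momentum ht x, norm_smul, Real.norm_eq_abs,
    abs_of_pos (Real.rpow_pos_of_pos (S.m_pos x t ht) _)]

include A

/-- The evolution of `∫ u m`, the energy identity of the mean-field game. -/
theorem rate_u_mul_m_le {t : ℝ} (ht : t ∈ Icc 0 T) (x : E d) :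
    rate α D u m (fun y => y) 1 x t
      ≤ -(K.bound⁻¹ * (m x t ^ (1 + α) * ‖momentum α u m x t‖ ^ γ))
        + K.bound * m x t ^ (1 + α) + K.bound * m x t := by
  have hm := S.m_pos x t ht
  have h1 := A.coercive x (momentum α u m x t)
  have h2 := (abs_le.1 (A.abs_V_le (m := m) (t := t) x)).1
  have h3 : deriv (fun y : ℝ => y) = fun _ => 1 := by funext y; simp
  have h4 : m x t ^ (1 + α) = m x t * m x t ^ α := by rw [Real.rpow_add hm, Real.rpow_one]
  have h5 : 0 < m x t * m x t ^ α := mul_pos hm (Real.rpow_pos_of_pos hm _)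
  simp only [rate, h3, deriv_const, S.inner_gradient_drift ht, source, Real.rpow_one, h4]
  have h6 := mul_le_mul_of_nonneg_left h1 h5.le
  have h7 := mul_le_mul_of_nonneg_left h2 hm.le
  linarith

/-- The evolution of `∫ m^{1+α}`. The drift contributes `m^{1+α} |q|^{2(γ-1)}`, which is at most
`m^{1+α} (1 + |q|^γ)` because `γ < 2`. -/
theorem rate_rpow_m_le (hγ : 1 < γ) (hγ2 : γ < 2) (hα : 0 ≤ α) {t : ℝ} (ht : t ∈ Icc 0 T)
    (x : E d) : rate α D u m (fun _ => 1) (1 + α) x t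
      ≤ -(α * (1 + α) / 2 * (m x t ^ (α - 1) * ‖∇ (fun y => m y t) x‖ ^ 2))
        + 4 * α * (1 + α) * K.bound ^ 2 * (m x t ^ (1 + α) * ‖momentum α u m x t‖ ^ γ)
        + 8 * α * (1 + α) * K.bound ^ 2 * m x t ^ (1 + α) := by
  have hm := S.m_pos x t ht
  have h1 := neg_rpow_mul_inner_le hm (1 + α) (∇ (fun y => m y t) x) (drift α D u m x t)
  have h2 := A.sq_norm_drift_le (u := u) (m := m) (α := α) ht x
  have h3 := rpow_two_mul_sub_one_le hγ hγ2 (norm_nonneg (momentum α u m x t))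
  have h4 : ‖drift α D u m x t‖ ^ 2
      ≤ 8 * K.bound ^ 2 * (2 + ‖momentum α u m x t‖ ^ γ) :=
    h2.trans (mul_le_mul_of_nonneg_left (by linarith) (by positivity))
  have h5 := mul_le_mul_of_nonneg_left h4 (Real.rpow_pos_of_pos hm (1 + α)).le
  have e1 : 1 + α - 1 = α := by ring
  have e2 : 1 + α - 2 = α - 1 := by ring
  rw [e1, e2] at h1
  have hα2 : 0 ≤ α * (1 + α) := by positivity
  have h6 := mul_le_mul_of_nonneg_left h1 hα2
  have h7 := mul_le_mul_of_nonneg_left h5 (by linarith : 0 ≤ α * (1 + α) / 2)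
  simp only [rate, deriv_const', e1, e2]
  linarith

/-- The evolution of the moments of `v = u + a ≥ 1`; a lower bound, as the value function
solves a backward equation. -/
theorem le_rate_rpow_u (hγ' : 1 < γ') (hα : 0 ≤ α) {a r : ℝ} (hr : 1 + 1 / (1 + α) ≤ r)
    {t : ℝ} (ht : t ∈ Icc 0 T) (x : E d) (hv : 1 ≤ u x t + a) :
    r * (r - 1) / 2 * ((u x t + a) ^ (r - 2) * ‖∇ (fun y => u y t) x‖ ^ 2)
      - 2 * (1 + α) * K.bound ^ 2 * r
        * ((u x t + a) ^ r + m x t ^ α * (u x t + a) ^ (r - 1))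
      ≤ rate α D u m (fun y => (y + a) ^ r) 0 x t := by
  have hm := S.m_pos x t ht
  have hB := K.one_le_bound
  have h1α : 0 < 1 + α := by linarith
  have hr1 : 0 < r - 1 := by
    have : 0 < 1 / (1 + α) := by positivity
    linarith
  set v := u x t + a with hv_def
  have hv0 : 0 < v := by linarith
  have hd1 : ∀ y, 0 < y + a → HasDerivAt (fun y => (y + a) ^ r) (r * (y + a) ^ (r - 1)) y :=
    fun y hy => by
      simpa using ((hasDerivAt_id y).add_const a).rpow_const (p := r) (Or.inl hy.ne')
  have hev : deriv (fun y => (y + a) ^ r) =ᶠ[nhds (u x t)] fun y => r * (y + a) ^ (r - 1) := by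
    have : ∀ᶠ y in nhds (u x t), 0 < y + a :=
      (isOpen_lt continuous_const (continuous_id.add continuous_const)).mem_nhds hv0
    filter_upwards [this] with y hy using (hd1 y hy).deriv
  have hd2 : deriv (deriv fun y => (y + a) ^ r) (u x t) = r * ((r - 1) * v ^ (r - 2)) := by
    rw [hev.deriv_eq]
    have := (((hasDerivAt_id (u x t)).add_const a).rpow_const (p := r - 1)
      (Or.inl hv0.ne')).const_mul r
    have h2 := this.deriv
    simp only [id] at h2
    rw [h2, show r - 1 - 1 = r - 2 by ring, one_mul]
  have hs : -(K.bound * m x t ^ α) - K.bound * ‖∇ (fun y => u y t) x‖ - K.bound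
      ≤ source α D u m x t := by
    have h1 := mul_le_mul_of_nonneg_left
      (A.neg_bound_le_hamiltonian hγ' x (momentum α u m x t)) (Real.rpow_pos_of_pos hm α).le
    have h2 := (abs_le.1 (A.abs_inner_b_le (u := u) ht x)).1
    have h3 := (abs_le.1 (A.abs_V_le (m := m) (t := t) x)).2
    rw [source]
    linarith
  have w1 : v ^ (r - 1) = v * v ^ (r - 2) := by
    rw [show r - 1 = 1 + (r - 2) by ring, Real.rpow_add hv0, Real.rpow_one]
  have w2 : v ^ r = v * v * v ^ (r - 2) := by
    rw [show v ^ r = v ^ (1 + (1 + (r - 2))) by ring_nf, Real.rpow_add hv0, Real.rpow_add hv0,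
      Real.rpow_one]
    ring
  set G := ‖∇ (fun y => u y t) x‖ with hG
  set w := v ^ (r - 2) with hw
  have hw0 : 0 < w := Real.rpow_pos_of_pos hv0 _
  have hma : 0 < m x t ^ α := Real.rpow_pos_of_pos hm α
  -- the transport term is absorbed into the dissipation
  have hinv : 1 ≤ (1 + α) * (r - 1) := by
    have : 1 / (1 + α) ≤ r - 1 := by linarith
    rwa [div_le_iff₀ h1α, mul_comm] at this
  have k1 : v * K.bound * G ≤ (r - 1) / 2 * G ^ 2 + (1 + α) * K.bound ^ 2 / 2 * (v * v) := by
    have h1 : 2 * (v * K.bound) * G ≤ (r - 1) * G ^ 2 + (v * K.bound) ^ 2 / (r - 1) := by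
      have : 0 ≤ ((r - 1) * G - v * K.bound) ^ 2 / (r - 1) := by positivity
      have e : ((r - 1) * G - v * K.bound) ^ 2 / (r - 1)
          = (r - 1) * G ^ 2 - 2 * (v * K.bound) * G + (v * K.bound) ^ 2 / (r - 1) := by
        field_simp; ring
      linarith
    have h2 : (v * K.bound) ^ 2 / (r - 1) ≤ (1 + α) * (v * K.bound) ^ 2 := by
      rw [div_le_iff₀ hr1]
      nlinarith [sq_nonneg (v * K.bound)]
    nlinarith
  have k2 := mul_le_mul_of_nonneg_left k1 hw0.le
  have k3 := mul_le_mul_of_nonneg_left hs (mul_pos hv0 hw0).le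
  have k4 : v * w ≤ v * v * w := by nlinarith [mul_pos hv0 hw0]
  have k5 : K.bound ≤ K.bound ^ 2 := by nlinarith
  have hBα : K.bound ^ 2 ≤ (1 + α) * K.bound ^ 2 := by nlinarith [sq_nonneg K.bound]
  have hP := mul_pos (mul_pos hv0 hv0) hw0
  have hQ := mul_pos hma (mul_pos hv0 hw0)
  have k6 : K.bound * (v * w) ≤ (1 + α) * K.bound ^ 2 * (v * v * w) := by
    calc K.bound * (v * w) ≤ K.bound * (v * v * w) :=
          mul_le_mul_of_nonneg_left k4 (by linarith)
      _ ≤ _ := mul_le_mul_of_nonneg_right (by linarith) hP.le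
  have k7 : K.bound * (m x t ^ α * (v * w))
      ≤ 2 * (1 + α) * K.bound ^ 2 * (m x t ^ α * (v * w)) :=
    mul_le_mul_of_nonneg_right (by linarith) hQ.le
  have hBP : 0 ≤ (1 + α) * K.bound ^ 2 * (v * v * w) := by positivity
  have k8 : (r - 1) / 2 * (w * G ^ 2)
      - 2 * (1 + α) * K.bound ^ 2 * (v * v * w + m x t ^ α * (v * w))
      ≤ (r - 1) * (w * G ^ 2) + v * w * source α D u m x t := by
    linarith
  have k9 := mul_le_mul_of_nonneg_left k8 (by linarith : 0 ≤ r)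
  simp only [rate, hd2, (hd1 (u x t) hv0).deriv, Real.rpow_zero, ← hv_def]
  rw [w1, w2]
  linarith

set_option maxHeartbeats 400000 in
/-- The evolution of `∫ (a - u) m^{-r}`. The decreasing factor `a - u` brings in the coercivity
of `p·D_pH₀ - H₀`, which controls `m^{α-r} |p|^γ`; since `γ < 2` this dominates the drift term
`m^{-r} |p|^{2(γ-1)}` at the price of the negative power `m^{-β}` with
`β = α θ / (1 - θ)`, `θ = 2 (γ - 1) / γ`. -/
theorem rate_neg_rpow_m_le (hγ : 1 < γ) (hγ2 : γ < 2) (hγ' : 1 < γ') {a k r : ℝ} (hr : 1 ≤ r)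
    (hk1 : k = 1 / (1 - 2 * (γ - 1) / γ)) {κ : ℝ}
    {t : ℝ} (ht : t ∈ Icc 0 T) (x : E d) (hu1 : 1 ≤ a - u x t) (hu2 : a - u x t ≤ κ) :
    rate α D u m (fun y => a - y) (-r) x t
      ≤ -(r ^ 2 / 2 * (m x t ^ (-r - 2) * ‖∇ (fun y => m y t) x‖ ^ 2))
        + (4 * K.bound + (8 * K.bound ^ 2) ^ (1 / (1 - 1 / γ)) + 8 * κ * K.bound ^ 2
            + (32 * κ * K.bound ^ 3) ^ k) * r ^ (2 * k)
          * ((1 + m x t ^ α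
            + m x t ^ (-(α * (2 * (γ - 1) / γ) / (1 - 2 * (γ - 1) / γ)))) * m x t ^ (-r)) := by
  have hm := S.m_pos x t ht
  have hB := K.one_le_bound
  have hB0 : 0 < K.bound := by linarith
  have hγ0 : 0 < γ := by linarith
  have hr0 : 0 ≤ r := by linarith
  have hrr : r ≤ r ^ 2 := le_self_pow₀ hr two_ne_zero
  set θ := 2 * (γ - 1) / γ with hθ
  have hθ0 : 0 ≤ θ := div_nonneg (by linarith) hγ0.le
  have hθ1 : θ < 1 := by rw [hθ, div_lt_one hγ0]; linarith
  have h1θ : 0 < 1 - θ := by linarith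
  set β := α * θ / (1 - θ) with hβ
  have hκ : 1 ≤ κ := hu1.trans hu2
  have hk : 1 ≤ k := by rw [hk1, le_div_iff₀ h1θ]; linarith
  set p := momentum α u m x t with hp
  set F := DpH D.L₀ x p with hF
  set H := hamiltonian D.L₀ x p with hH
  set Q := ‖p‖ with hQ
  have hQ0 : 0 ≤ Q := norm_nonneg _
  set Du := ∇ (fun y => u y t) x with hDu
  set Dm := ∇ (fun y => m y t) x with hDm
  set G := drift α D u m x t with hG
  set s := m x t with hs
  set B := K.bound with hBdef
  have hd1 : deriv (fun y : ℝ => a - y) = fun _ => -1 := by funext y; simp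
  have hsr : 0 < s ^ (-r) := Real.rpow_pos_of_pos hm _
  have hsα : 0 < s ^ α := Real.rpow_pos_of_pos hm _
  have hsβ : 0 < s ^ (-β) := Real.rpow_pos_of_pos hm _
  have hQγ : 0 ≤ Q ^ γ := Real.rpow_nonneg hQ0 _
  set y := s ^ α * Q ^ γ with hy
  have hy0 : 0 ≤ y := mul_nonneg hsα.le hQγ
  -- the term with the Hamiltonian
  have c1 : B⁻¹ * Q ^ γ - B ≤ inner ℝ p F - H := A.coercive x p
  have c2 : -B ≤ H := A.neg_bound_le_hamiltonian hγ' x p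
  have c3 : r * (B⁻¹ * Q ^ γ) - 3 * r * B ≤ H + r * inner ℝ p F := by
    have h1 := mul_le_mul_of_nonneg_left (by linarith : B⁻¹ * Q ^ γ - 2 * B ≤ inner ℝ p F) hr0
    have h2 : B ≤ r * B := le_mul_of_one_le_left hB0.le hr
    linarith
  have c4 := mul_le_mul_of_nonneg_left c3 hsα.le
  -- the transport term
  set C1 := (8 * B ^ 2) ^ (1 / (1 - 1 / γ)) with hC1
  have hγi : 1 / γ < 1 := by rw [div_lt_one hγ0]; exact hγ
  have c5 : 2 * B * Q ≤ 1 / (4 * B) * Q ^ γ + C1 := by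
    have := young_weighted' (θ := 1 / γ) (X := 2 * B) (δ := 1 / (4 * B)) (x := Q ^ γ) (y := 1)
      (by positivity) hγi (by positivity) (by positivity)
      (by rw [div_le_one (by positivity)]; linarith) hQγ zero_le_one
    rw [← Real.rpow_mul hQ0, mul_one_div_cancel hγ0.ne', Real.rpow_one, Real.one_rpow, mul_one,
      mul_one] at this
    refine this.trans (le_of_eq ?_)
    rw [hC1]
    congr 2
    field_simp
    ring
  have c6 : |inner ℝ (D.b x t) Du| ≤ B * (s ^ α * Q) := by
    have h1 := A.abs_inner_b_le (u := u) ht x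
    rwa [S.norm_gradient_u ht x] at h1
  have c7 : -((1 + r) * inner ℝ (D.b x t) Du) ≤ r * (1 / (4 * B) * y + C1 * s ^ α) := by
    have h1 := (abs_le.1 c6).1
    have h2 : 0 ≤ B * (s ^ α * Q) := by positivity
    have h3 := mul_le_mul_of_nonneg_left c5 hsα.le
    calc -((1 + r) * inner ℝ (D.b x t) Du) = (1 + r) * (-inner ℝ (D.b x t) Du) := by ring
      _ ≤ (1 + r) * (B * (s ^ α * Q)) := mul_le_mul_of_nonneg_left (by linarith) (by linarith)
      _ ≤ 2 * r * (B * (s ^ α * Q)) := mul_le_mul_of_nonneg_right (by linarith) h2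
      _ = r * (s ^ α * (2 * B * Q)) := by ring
      _ ≤ r * (s ^ α * (1 / (4 * B) * Q ^ γ + C1)) :=
          mul_le_mul_of_nonneg_left h3 (by linarith)
      _ = _ := by rw [hy]; ring
  have c8 := (abs_le.1 (A.abs_V_le (m := m) (t := t) x)).2
  -- the drift term
  have c9 : ‖G‖ ^ 2 ≤ 8 * B ^ 2 * (1 + Q ^ (2 * (γ - 1))) := A.sq_norm_drift_le ht x
  set X := 8 * κ * B ^ 2 * r ^ 2 with hX
  have c10 : X * Q ^ (2 * (γ - 1)) ≤ 1 / (4 * B) * y + (32 * κ * B ^ 3) ^ k * r ^ (2 * k) * s ^ (-β) := by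
    have := young_weighted' (θ := θ) (X := X) (δ := 1 / (4 * B)) (x := y) (y := s ^ (-β))
      hθ0 hθ1 (by positivity) (by positivity)
      (by rw [div_le_one (by positivity)]; linarith) hy0 hsβ.le
    have e1 : y ^ θ * (s ^ (-β)) ^ (1 - θ) = Q ^ (2 * (γ - 1)) := by
      rw [hy, Real.mul_rpow hsα.le hQγ, ← Real.rpow_mul hm.le, ← Real.rpow_mul hQ0,
        ← Real.rpow_mul hm.le, mul_right_comm, ← Real.rpow_add hm]
      have e2 : α * θ + -β * (1 - θ) = 0 := by rw [hβ]; field_simp; ring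
      have e3 : γ * θ = 2 * (γ - 1) := by rw [hθ]; field_simp
      rw [e2, e3, Real.rpow_zero, one_mul]
    have e4 : (X / (1 / (4 * B))) ^ (1 / (1 - θ)) = (32 * κ * B ^ 3) ^ k * r ^ (2 * k) := by
      rw [← hk1, Real.rpow_mul (by linarith : 0 ≤ r), ← Real.mul_rpow (by positivity)
        (by positivity), Real.rpow_two, hX]
      congr 1
      field_simp
      ring
    rwa [e1, e4] at this
  have c11 : r * (r + 1) * (a - u x t) / 2 * ‖G‖ ^ 2
      ≤ X + (1 / (4 * B) * y + (32 * κ * B ^ 3) ^ k * r ^ (2 * k) * s ^ (-β)) := by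
    have h1 : r * (r + 1) * (a - u x t) / 2 ≤ r ^ 2 * κ := by
      have : r * (r + 1) ≤ 2 * r ^ 2 := by rw [mul_add, ← sq]; linarith
      calc r * (r + 1) * (a - u x t) / 2 ≤ (2 * r ^ 2) * κ / 2 := by
            have := mul_le_mul this hu2 (by linarith) (by positivity)
            linarith
        _ = r ^ 2 * κ := by ring
    calc r * (r + 1) * (a - u x t) / 2 * ‖G‖ ^ 2
        ≤ r ^ 2 * κ * (8 * B ^ 2 * (1 + Q ^ (2 * (γ - 1)))) :=
          mul_le_mul h1 c9 (sq_nonneg _) (by positivity)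
      _ = X + X * Q ^ (2 * (γ - 1)) := by rw [hX]; ring
      _ ≤ _ := by linarith
  have c12 := neg_rpow_mul_inner_le hm (-r) Dm G
  have hcoef : 0 ≤ r * (r + 1) * (a - u x t) :=
    mul_nonneg (mul_nonneg (by linarith) (by linarith)) (by linarith)
  have c13 := mul_le_mul_of_nonneg_left c12 hcoef
  have c14 := mul_le_mul_of_nonneg_left c11 hsr.le
  have hD0 : 0 ≤ s ^ (-r - 2) * ‖Dm‖ ^ 2 :=
    mul_nonneg (Real.rpow_pos_of_pos hm _).le (sq_nonneg _)
  have c15 : r ^ 2 / 2 * (s ^ (-r - 2) * ‖Dm‖ ^ 2)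
      ≤ r * (r + 1) * (a - u x t) / 2 * (s ^ (-r - 2) * ‖Dm‖ ^ 2) := by
    refine mul_le_mul_of_nonneg_right ?_ hD0
    have : r ^ 2 * 1 ≤ r * (r + 1) * (a - u x t) :=
      mul_le_mul (by rw [mul_add, ← sq]; linarith) hu1 zero_le_one (by positivity)
    linarith
  -- collecting the terms of order zero
  have hinv : B⁻¹ = 4 * (1 / (4 * B)) := by field_simp
  have hrB : 0 ≤ 1 / (4 * B) * y := by positivity
  have c16 : -(s ^ α * (H + r * inner ℝ p F)) - (1 + r) * inner ℝ (D.b x t) Du + D.V x s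
      + (r * (r + 1) * (a - u x t) / 2 * ‖G‖ ^ 2)
      ≤ (3 * r * B + r * C1) * s ^ α + B + X
        + (32 * κ * B ^ 3) ^ k * r ^ (2 * k) * s ^ (-β) := by
    have h1 : r * (1 / (4 * B) * y) ≥ 1 / (4 * B) * y := le_mul_of_one_le_left hrB hr
    have h2 : s ^ α * (r * (B⁻¹ * Q ^ γ) - 3 * r * B)
        = 4 * (r * (1 / (4 * B) * y)) - 3 * r * B * s ^ α := by rw [hinv, hy]; ring
    rw [h2] at c4
    linarith
  set R := r ^ (2 * k) with hR
  have hR2 : r ^ 2 ≤ R := by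
    rw [hR, ← Real.rpow_two]
    exact Real.rpow_le_rpow_of_exponent_le hr (by linarith)
  have hR1 : r ≤ R := hrr.trans hR2
  have hR0 : 1 ≤ R := hr.trans hR1
  have hC10 : 0 ≤ C1 := Real.rpow_nonneg (by positivity) _
  have hCk0 : 0 ≤ (32 * κ * B ^ 3) ^ k := Real.rpow_nonneg (by positivity) _
  set Ck := (32 * κ * B ^ 3) ^ k with hCk
  have c17 : (3 * r * B + r * C1) * s ^ α + B + X + Ck * R * s ^ (-β)
      ≤ (4 * B + C1 + 8 * κ * B ^ 2 + Ck) * R * (1 + s ^ α + s ^ (-β)) := by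
    have hκB : 0 ≤ 8 * κ * B ^ 2 := by positivity
    have t1 : (3 * r * B + r * C1) * s ^ α ≤ (3 * B + C1) * R * s ^ α := by
      refine mul_le_mul_of_nonneg_right ?_ hsα.le
      have := mul_le_mul_of_nonneg_left hR1 (by linarith : 0 ≤ 3 * B + C1)
      linarith
    have t2 : B ≤ B * R := le_mul_of_one_le_right hB0.le hR0
    have t3 : X ≤ 8 * κ * B ^ 2 * R := mul_le_mul_of_nonneg_left hR2 hκB
    have t4 : 0 ≤ (3 * B + C1 + Ck) * R := by positivity
    have t5 : 0 ≤ (B + 8 * κ * B ^ 2 + Ck) * R * s ^ α := by positivity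
    have t6 : 0 ≤ (4 * B + C1 + 8 * κ * B ^ 2) * R * s ^ (-β) := by positivity
    linarith
  have c18 := mul_le_mul_of_nonneg_left (c16.trans c17) hsr.le
  have hin : inner ℝ Du G = s ^ α * inner ℝ p F + inner ℝ (D.b x t) Du :=
    S.inner_gradient_drift ht x
  simp only [rate, hd1, deriv_const, source, ← hs, ← hp, ← hH, ← hDu, ← hDm, ← hG, hin]
  linarith

end IsSmoothSolution

end CongestionMFG

/-! ### First-order energy estimates -/

namespace CongestionMFG

variable {d : ℕ} {α γ γ' T : ℝ} {K : Constants} {D : Data d} {u m : E d → ℝ → ℝ}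

/-- For a probability density, the square of the moment of order `(1 + α) / 2` is sublinear in
the moment of order `1 + α`. -/
theorem exists_sq_integral_half_le (hα : 0 < α) : ∃ τ : ℝ, 0 ≤ τ ∧ τ < 1 ∧ ∀ f : E d → ℝ,
    Continuous f → (∀ x, 0 < f x) → ∫ x in cube d, f x = 1 →
    (∫ x in cube d, f x ^ ((1 + α) / 2)) ^ 2 ≤ 1 + (∫ x in cube d, f x ^ (1 + α)) ^ τ := by
  rcases le_total α 1 with h1 | h1
  · refine ⟨0, le_rfl, one_pos, fun f hf hpos hint => ?_⟩
    have h2 := integral_rpow_mul_rpow_le hf (continuous_const (y := (1 : ℝ)))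
      (fun x => (hpos x).le) (fun _ => zero_le_one) (a := (1 + α) / 2) (b := 1 - (1 + α) / 2)
      (by linarith) (by linarith) (by ring)
    simp only [Real.one_rpow, mul_one, hint, integral_cube_const] at h2
    have h3 : 0 ≤ ∫ x in cube d, f x ^ ((1 + α) / 2) :=
      integral_cube_nonneg fun x => Real.rpow_nonneg (hpos x).le _
    rw [Real.rpow_zero]
    nlinarith
  · -- interpolation between the mass and the moment of order `1 + α`
    set τ := (α - 1) / α with hτ
    have hτ0 : 0 ≤ τ := div_nonneg (by linarith) hα.le
    have hτ1 : τ < 1 := by rw [hτ, div_lt_one hα]; linarith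
    refine ⟨τ, hτ0, hτ1, fun f hf hpos hint => ?_⟩
    have hf1 : Continuous fun x => f x ^ (1 + α) := hf.rpow_const fun x => Or.inl (hpos x).ne'
    have h2 := integral_rpow_mul_rpow_le hf hf1
      (fun x => (hpos x).le) (fun x => Real.rpow_nonneg (hpos x).le _)
      (a := 1 - τ / 2) (b := τ / 2) (by linarith) (by linarith) (by ring)
    have h3 : ∀ x, f x ^ (1 - τ / 2) * (f x ^ (1 + α)) ^ (τ / 2) = f x ^ ((1 + α) / 2) := by
      intro x
      rw [← Real.rpow_mul (hpos x).le, ← Real.rpow_add (hpos x)]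
      congr 1
      rw [hτ]
      field_simp
      ring
    simp only [h3, hint, Real.one_rpow, one_mul] at h2
    set I := ∫ x in cube d, f x ^ (1 + α) with hI
    have hI0 : 0 ≤ I := integral_cube_nonneg fun x => Real.rpow_nonneg (hpos x).le _
    have h4 : 0 ≤ ∫ x in cube d, f x ^ ((1 + α) / 2) :=
      integral_cube_nonneg fun x => Real.rpow_nonneg (hpos x).le _
    have h5 := pow_le_pow_left₀ h4 h2 2
    rw [← Real.rpow_natCast (I ^ (τ / 2)) 2, ← Real.rpow_mul hI0] at h5
    have h6 : τ / 2 * ((2 : ℕ) : ℝ) = τ := by push_cast; ring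
    rw [h6] at h5
    linarith

/-- For a probability density, the moment of order `1 + α` is controlled, with an arbitrarily
small constant, by the dissipation that the Fokker-Planck equation provides. -/
theorem exists_integral_rpow_le (hd : 1 ≤ d) (hα : 0 ≤ α)
    (hα' : 3 ≤ d → α < 2 / ((d : ℝ) - 2)) {ε : ℝ} (hε : 0 < ε) :
    ∃ C : ℝ, 0 ≤ C ∧ ∀ f : E d → ℝ, ContDiff ℝ ∞ f → Periodic f → (∀ x, 0 < f x) →
      ∫ x in cube d, f x = 1 → ∫ x in cube d, f x ^ (1 + α)
        ≤ ε * (α * ∫ x in cube d, f x ^ (α - 1) * ‖(∇ f) x‖ ^ 2) + C := by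
  rcases hα.eq_or_lt with rfl | hα0
  · refine ⟨1, zero_le_one, fun f hf hper hpos hint => ?_⟩
    simp [hint]
  obtain ⟨p, k, C0, hp, -, hk, hC0, hsob⟩ := exists_weighted_sobolev hd hα hα'
  obtain ⟨τ, hτ0, hτ1, hτ⟩ := exists_sq_integral_half_le (d := d) hα0
  set ε' := min 1 (2 * ε * α / (1 + α) ^ 2) with hε'
  have hε0 : 0 < ε' := lt_min one_pos (by positivity)
  set C1 := C0 * (1 / ε') ^ k with hC1
  have hC10 : 0 ≤ C1 := by positivity
  refine ⟨2 * C1 + 2 * (C1 / (1 / 2)) ^ (1 / (1 - τ)), by positivity,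
    fun f hf hper hpos hint => ?_⟩
  have hφ : ContDiff ℝ 1 fun x => f x ^ ((1 + α) / 2) :=
    (hf.rpow_const_of_ne fun x => (hpos x).ne').of_le (by simp)
  have h1 := hsob (fun x => f x ^ ((1 + α) / 2)) (fun _ => 1) hφ
    (hper.comp fun s => s ^ ((1 + α) / 2))
    (fun x => Real.rpow_pos_of_pos (hpos x) _) continuous_const (fun _ => zero_le_one) 1 le_rfl
    (by simp) ε' hε0 (min_le_left _ _)
  have e1 : ∀ x, 1 * (f x ^ ((1 + α) / 2)) ^ 2 = f x ^ (1 + α) := fun x => by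
    rw [one_mul, ← Real.rpow_natCast, ← Real.rpow_mul (hpos x).le]
    congr 1
    push_cast
    ring
  have e2 : ∀ x, ‖∇ (fun x => f x ^ ((1 + α) / 2)) x‖ ^ 2
      = (1 + α) ^ 2 / 4 * (f x ^ (α - 1) * ‖(∇ f) x‖ ^ 2) := fun x => by
    rw [sq_norm_gradient_rpow (1 + α) (hf.differentiable (by simp) x) (hpos x),
      show 1 + α - 2 = α - 1 by ring]
  simp only [e1, e2, integral_const_mul] at h1
  have h2 := hτ f hf.continuous hpos hint
  set I := ∫ x in cube d, f x ^ (1 + α) with hI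
  set G := ∫ x in cube d, f x ^ (α - 1) * ‖(∇ f) x‖ ^ 2 with hG
  have hI0 : 0 ≤ I := integral_cube_nonneg fun x => Real.rpow_nonneg (hpos x).le _
  have hG0 : 0 ≤ G := integral_cube_nonneg fun x =>
    mul_nonneg (Real.rpow_nonneg (hpos x).le _) (sq_nonneg _)
  have h3 := young_weighted' (θ := τ) (X := C1) (δ := 1 / 2) (x := I) (y := 1) hτ0 hτ1 hC10
    (by norm_num) (by norm_num) hI0 zero_le_one
  rw [Real.one_rpow, mul_one, mul_one] at h3
  have h4 := mul_le_mul_of_nonneg_left h2 hC10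
  have h5 : ε' * ((1 + α) ^ 2 / 4 * G) ≤ ε * α / 2 * G := by
    have : ε' * (1 + α) ^ 2 ≤ 2 * ε * α := by
      rw [← le_div_iff₀ (by positivity)]
      exact min_le_right _ _
    nlinarith
  nlinarith

/-- The shift that makes the value function at least one. -/
noncomputable def shift (K : Constants) (Tmax : ℝ) : ℝ :=
  K.bound + (K.bound + 1) * Tmax + 1

theorem contDiffOn_add_rpow (a r : ℝ) :
    ContDiffOn ℝ ∞ (fun y : ℝ => (y + a) ^ r) (Ioi (-a)) :=
  (contDiff_id.add contDiff_const).contDiffOn.rpow_const_of_ne fun y hy => by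
    have : -a < y := hy
    simp only [id]
    linarith

namespace IsSmoothSolution

variable (A : Assumptions γ γ' K T D) (S : IsSmoothSolution α T D u m)
include A S

theorem one_le_u_add_shift {Tmax : ℝ} (hT : 0 < T) (hTm : T ≤ Tmax) {t : ℝ} (ht : t ∈ Icc 0 T)
    (x : E d) : 1 ≤ u x t + shift K Tmax := by
  have h1 := S.neg_le_u A hT ht x
  have h2 := mul_le_mul_of_nonneg_left hTm (by linarith [K.one_le_bound] : 0 ≤ K.bound + 1)
  rw [shift]
  linarith

theorem integral_rate_u_mul_m_le (hd : 1 ≤ d) (hγ : 1 < γ) {t : ℝ} (ht : t ∈ Ioo 0 T) :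
    ∫ x in cube d, rate α D u m (fun y => y) 1 x t
      ≤ -(K.bound⁻¹ * ∫ x in cube d, m x t ^ (1 + α) * ‖momentum α u m x t‖ ^ γ)
        + K.bound * (∫ x in cube d, m x t ^ (1 + α)) + K.bound := by
  have ht' := Ioo_subset_Icc_self ht
  have cX : Continuous fun x => m x t ^ (1 + α) * ‖momentum α u m x t‖ ^ γ :=
    (S.continuous_rpow_m ht' _).mul
      ((S.continuous_momentum ht').norm.rpow_const fun _ => Or.inr (by linarith))
  have cM := S.continuous_rpow_m ht' (1 + α)
  have cm := (S.contDiff_m ht').continuous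
  have h : ∫ x in cube d, rate α D u m (fun y => y) 1 x t
      ≤ ∫ x in cube d, (-(K.bound⁻¹ * (m x t ^ (1 + α) * ‖momentum α u m x t‖ ^ γ))
        + K.bound * m x t ^ (1 + α) + K.bound * m x t) := integral_cube_mono
    (S.continuous_rate A isOpen_univ (P := fun y => y) contDiffOn_id (fun _ _ _ => mem_univ _) 1 ht)
    (((continuous_const.mul cX).neg.add (continuous_const.mul cM)).add (continuous_const.mul cm))
    (S.rate_u_mul_m_le A ht')
  rw [integral_cube_add (f := fun x => -(K.bound⁻¹ * (m x t ^ (1 + α)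
      * ‖momentum α u m x t‖ ^ γ)) + K.bound * m x t ^ (1 + α)) (g := fun x => K.bound * m x t)
      ((continuous_const.mul cX).neg.add (continuous_const.mul cM)) (continuous_const.mul cm),
    integral_cube_add (f := fun x => -(K.bound⁻¹ * (m x t ^ (1 + α)
      * ‖momentum α u m x t‖ ^ γ))) (g := fun x => K.bound * m x t ^ (1 + α))
      (continuous_const.mul cX).neg (continuous_const.mul cM), integral_neg, integral_const_mul,
    integral_const_mul, integral_const_mul, S.integral_m A hd ht', mul_one] at h
  exact h

theorem integral_rate_rpow_m_le (hγ : 1 < γ) (hγ2 : γ < 2) (hα : 0 ≤ α) {t : ℝ}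
    (ht : t ∈ Ioo 0 T) :
    ∫ x in cube d, rate α D u m (fun _ => 1) (1 + α) x t
      ≤ -(α * (1 + α) / 2 * ∫ x in cube d, m x t ^ (α - 1) * ‖∇ (fun y => m y t) x‖ ^ 2)
        + 4 * α * (1 + α) * K.bound ^ 2
          * (∫ x in cube d, m x t ^ (1 + α) * ‖momentum α u m x t‖ ^ γ)
        + 8 * α * (1 + α) * K.bound ^ 2 * ∫ x in cube d, m x t ^ (1 + α) := by
  have ht' := Ioo_subset_Icc_self ht
  have cX : Continuous fun x => m x t ^ (1 + α) * ‖momentum α u m x t‖ ^ γ :=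
    (S.continuous_rpow_m ht' _).mul
      ((S.continuous_momentum ht').norm.rpow_const fun _ => Or.inr (by linarith))
  have cM := S.continuous_rpow_m ht' (1 + α)
  have cG : Continuous fun x => m x t ^ (α - 1) * ‖∇ (fun y => m y t) x‖ ^ 2 :=
    (S.continuous_rpow_m ht' _).mul ((S.continuous_gradient_m ht').norm.pow 2)
  have h : ∫ x in cube d, rate α D u m (fun _ => 1) (1 + α) x t
      ≤ ∫ x in cube d, (-(α * (1 + α) / 2 * (m x t ^ (α - 1) * ‖∇ (fun y => m y t) x‖ ^ 2))
        + 4 * α * (1 + α) * K.bound ^ 2 * (m x t ^ (1 + α) * ‖momentum α u m x t‖ ^ γ)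
        + 8 * α * (1 + α) * K.bound ^ 2 * m x t ^ (1 + α)) := integral_cube_mono
    (S.continuous_rate A isOpen_univ (P := fun _ => 1) contDiffOn_const
      (fun _ _ _ => mem_univ _) (1 + α) ht)
    (((continuous_const.mul cG).neg.add (continuous_const.mul cX)).add (continuous_const.mul cM))
    (S.rate_rpow_m_le A hγ hγ2 hα ht')
  rw [integral_cube_add (f := fun x => -(α * (1 + α) / 2 * (m x t ^ (α - 1)
      * ‖∇ (fun y => m y t) x‖ ^ 2)) + 4 * α * (1 + α) * K.bound ^ 2
      * (m x t ^ (1 + α) * ‖momentum α u m x t‖ ^ γ))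
      (g := fun x => 8 * α * (1 + α) * K.bound ^ 2 * m x t ^ (1 + α))
      ((continuous_const.mul cG).neg.add (continuous_const.mul cX)) (continuous_const.mul cM),
    integral_cube_add (f := fun x => -(α * (1 + α) / 2 * (m x t ^ (α - 1)
      * ‖∇ (fun y => m y t) x‖ ^ 2))) (g := fun x => 4 * α * (1 + α) * K.bound ^ 2
      * (m x t ^ (1 + α) * ‖momentum α u m x t‖ ^ γ))
      (continuous_const.mul cG).neg (continuous_const.mul cX), integral_neg, integral_const_mul,
    integral_const_mul, integral_const_mul] at h
  exact h

end IsSmoothSolution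

end CongestionMFG

/-! ### The bound for the energy -/

namespace CongestionMFG

variable {d : ℕ} {α γ γ' T : ℝ} {K : Constants} {D : Data d} {u m : E d → ℝ → ℝ}

/-- Two coupled differential inequalities, a forward one for `F` and a backward one for `Z`,
closed by comparing `F - μ e^{ct} Z` for two values of `μ`. -/
theorem bounds_of_coupled_inequalities {b b' c μ w₀ w₁ C : ℝ} {F F' Z Z' M : ℝ → ℝ}
    (hb : b ≤ b') (hc : 0 ≤ c) (hμ : 0 ≤ μ) (hC : 0 ≤ C) (hF : ContinuousOn F (Icc 0 b))
    (hZ : ContinuousOn Z (Icc 0 b)) (hF' : ∀ t ∈ Ioo 0 b, HasDerivAt F (F' t) t)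
    (hZ' : ∀ t ∈ Ioo 0 b, HasDerivAt Z (Z' t) t) (hM0 : ∀ t ∈ Ioo 0 b, 0 ≤ M t)
    (hZ0 : ∀ t ∈ Icc 0 b, 0 ≤ Z t)
    (h1 : ∀ t ∈ Ioo 0 b, F' t ≤ -((μ + 1) * (Real.exp (c * b') * c) * M t) + C)
    (h2 : ∀ t ∈ Ioo 0 b, -(c * Z t) - c * M t ≤ Z' t)
    (hw₀ : F 0 - μ * Z 0 ≤ w₀) (hw₁ : -w₁ ≤ F b - (μ + 1) * Real.exp (c * b') * Z b) {t : ℝ}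
    (ht : t ∈ Icc 0 b) :
    Z t ≤ w₀ + w₁ + 2 * (C * b') ∧ F t ≤ w₀ + C * b' + μ * (w₀ + w₁ + 2 * (C * b')) := by
  have h0b : (0 : ℝ) ∈ Icc 0 b := ⟨le_rfl, ht.1.trans ht.2⟩
  have hbb : b ∈ Icc 0 b := ⟨ht.1.trans ht.2, le_rfl⟩
  have key : ∀ ν, 0 ≤ ν → ν ≤ μ + 1 → ∀ s ∈ Icc 0 b, ∀ t ∈ Icc 0 b, s ≤ t →
      F t - ν * (Real.exp (c * t) * Z t) - C * t
        ≤ F s - ν * (Real.exp (c * s) * Z s) - C * s := by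
    intro ν hν hν1 s hs t ht hst
    have hcexp : Continuous fun t : ℝ => Real.exp (c * t) := by fun_prop
    refine le_of_hasDerivAt_nonpos
      (f := fun t => F t - ν * (Real.exp (c * t) * Z t) - C * t)
      (f' := fun t => F' t - ν * (Real.exp (c * t) * c * Z t + Real.exp (c * t) * Z' t) - C)
      ((hF.sub (continuousOn_const.mul (hcexp.continuousOn.mul hZ))).sub
        (continuousOn_const.mul continuousOn_id)) (fun t ht => ?_) (fun t ht => ?_) hs ht hst
    · have e : HasDerivAt (fun t => Real.exp (c * t)) (Real.exp (c * t) * c) t := by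
        simpa using ((hasDerivAt_id t).const_mul c).exp
      have := ((hF' t ht).sub ((e.mul (hZ' t ht)).const_mul ν)).sub
        ((hasDerivAt_id t).const_mul C)
      rw [mul_one] at this
      exact this
    · have e1 : Real.exp (c * t) ≤ Real.exp (c * b') :=
        Real.exp_le_exp.2 (mul_le_mul_of_nonneg_left (ht.2.le.trans hb) hc)
      have e2 := mul_le_mul_of_nonneg_left (h2 t ht)
        (mul_nonneg hν (Real.exp_pos (c * t)).le)
      have e3 : ν * Real.exp (c * t) ≤ (μ + 1) * Real.exp (c * b') :=
        mul_le_mul hν1 e1 (Real.exp_pos _).le (by linarith)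
      have e4 := mul_le_mul_of_nonneg_right e3 (mul_nonneg hc (hM0 t ht))
      have e5 := h1 t ht
      show F' t - ν * (Real.exp (c * t) * c * Z t + Real.exp (c * t) * Z' t) - C ≤ 0
      linarith
  have k1 := key μ hμ (by linarith) 0 h0b t ht ht.1
  have k2 := key (μ + 1) (by linarith) le_rfl t ht b hbb ht.2
  have hZt := hZ0 t ht
  have e1 : 1 ≤ Real.exp (c * t) := Real.one_le_exp (mul_nonneg hc ht.1)
  have e2 : Z t ≤ Real.exp (c * t) * Z t := le_mul_of_one_le_left hZt e1
  have e3 : (μ + 1) * (Real.exp (c * b) * Z b) ≤ (μ + 1) * Real.exp (c * b') * Z b := by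
    rw [mul_assoc]
    refine mul_le_mul_of_nonneg_left (mul_le_mul_of_nonneg_right ?_ (hZ0 b hbb)) (by linarith)
    exact Real.exp_le_exp.2 (mul_le_mul_of_nonneg_left hb hc)
  simp only [mul_zero, Real.exp_zero, one_mul, sub_zero] at k1
  have e4 : C * t ≤ C * b' := mul_le_mul_of_nonneg_left (ht.2.trans hb) hC
  have e5 : C * b ≤ C * b' := mul_le_mul_of_nonneg_left hb hC
  have e6 : 0 ≤ C * t := mul_nonneg hC ht.1
  have k3 : Real.exp (c * t) * Z t ≤ w₀ + w₁ + 2 * (C * b') := by linarith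
  refine ⟨e2.trans k3, ?_⟩
  have := mul_le_mul_of_nonneg_left k3 hμ
  linarith

namespace IsSmoothSolution

variable (A : Assumptions γ γ' K T D) (S : IsSmoothSolution α T D u m)
include A S

omit A in
theorem continuous_rpow_u_add {a : ℝ} {t : ℝ} (ht : t ∈ Icc 0 T)
    (hv : ∀ x, 1 ≤ u x t + a) (r : ℝ) : Continuous fun x => (u x t + a) ^ r :=
  ((S.contDiff_u ht).continuous.add continuous_const).rpow_const fun x =>
    Or.inl (by linarith [hv x] : 0 < u x t + a).ne'

/-- The backward inequality for the moment of order `1 + 1/(1+α)`, the one for which the coupling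
term `m^α v^{r-1}` is dominated by `m^{1+α} + v^r`. -/
theorem le_integral_rate_rpow_u (hγ' : 1 < γ') (hα : 0 ≤ α) {a : ℝ}
    (hv : ∀ x, ∀ t ∈ Icc 0 T, 1 ≤ u x t + a) {t : ℝ} (ht : t ∈ Ioo 0 T) :
    -(4 * (1 + α) * K.bound ^ 2 * (1 + 1 / (1 + α))
        * ∫ x in cube d, (u x t + a) ^ (1 + 1 / (1 + α)))
      - 4 * (1 + α) * K.bound ^ 2 * (1 + 1 / (1 + α)) * (∫ x in cube d, m x t ^ (1 + α))
      ≤ ∫ x in cube d, rate α D u m (fun y => (y + a) ^ (1 + 1 / (1 + α))) 0 x t := by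
  have ht' := Ioo_subset_Icc_self ht
  have h1α : 0 < 1 + α := by linarith
  set r := 1 + 1 / (1 + α) with hr
  set c := 4 * (1 + α) * K.bound ^ 2 * r with hc
  have hr0 : 0 ≤ r := by positivity
  have hr1 : 0 < r - 1 := by rw [hr]; have : 0 < 1 / (1 + α) := by positivity
                             linarith
  have cv := S.continuous_rpow_u_add ht' (fun x => hv x t ht') r
  have cm := S.continuous_rpow_m ht' (1 + α)
  rw [← integral_const_mul, ← integral_const_mul, ← integral_neg,
    ← integral_cube_sub (f := fun x => -(c * (u x t + a) ^ r)) (g := fun x => c * m x t ^ (1 + α))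
      (continuous_const.mul cv).neg (continuous_const.mul cm)]
  refine integral_cube_mono ((continuous_const.mul cv).neg.sub (continuous_const.mul cm))
    (S.continuous_rate A isOpen_Ioi (contDiffOn_add_rpow a r)
      (fun x t ht => by have := hv x t ht; simp only [mem_Ioi]; linarith) 0 ht) fun x => ?_
  have h1 := S.le_rate_rpow_u A hγ' hα le_rfl ht' x (hv x t ht')
  rw [← hr] at h1
  have hv0 : 1 ≤ u x t + a := hv x t ht'
  have hm := S.m_pos x t ht'
  have h2 : 0 ≤ r * (r - 1) / 2 * ((u x t + a) ^ (r - 2) * ‖∇ (fun y => u y t) x‖ ^ 2) := by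
    have : 0 ≤ (u x t + a) ^ (r - 2) := Real.rpow_nonneg (by linarith) _
    positivity
  -- Young's inequality with exponents `(1 + α) / α` and `1 + α`
  have h3 : m x t ^ α * (u x t + a) ^ (r - 1) ≤ m x t ^ (1 + α) + (u x t + a) ^ r := by
    have h4 := Real.geom_mean_le_arith_mean2_weighted (w₁ := α / (1 + α)) (w₂ := 1 / (1 + α))
      (p₁ := m x t ^ (1 + α)) (p₂ := u x t + a) (by positivity) (by positivity)
      (Real.rpow_pos_of_pos hm _).le (by linarith) (by field_simp; ring)
    rw [← Real.rpow_mul hm.le, mul_div_cancel₀ _ h1α.ne'] at h4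
    have e : r - 1 = 1 / (1 + α) := by rw [hr]; ring
    rw [e]
    have h5 : u x t + a ≤ (u x t + a) ^ r := by
      simpa using Real.rpow_le_rpow_of_exponent_le hv0 (by linarith : 1 ≤ r)
    have h6 : α / (1 + α) * m x t ^ (1 + α) ≤ m x t ^ (1 + α) :=
      mul_le_of_le_one_left (Real.rpow_pos_of_pos hm _).le (by rw [div_le_one h1α]; linarith)
    have h7 : 1 / (1 + α) * (u x t + a) ≤ u x t + a :=
      mul_le_of_le_one_left (by linarith) (by rw [div_le_one h1α]; linarith)
    linarith
  have h8 := mul_le_mul_of_nonneg_left h3 (by positivity : 0 ≤ 2 * (1 + α) * K.bound ^ 2 * r)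
  have h9 : 0 ≤ 2 * (1 + α) * K.bound ^ 2 * r * m x t ^ (1 + α) := by positivity
  have e1 : c = 2 * (2 * (1 + α) * K.bound ^ 2 * r) := by rw [hc]; ring
  rw [e1]
  linarith

end IsSmoothSolution

/-- The energy `∫ m^{1+α}`, together with the moment of order `1 + 1/(1+α)` of the value
function, is bounded uniformly on `[0,T]`. -/
theorem exists_energy_bound (hd : 1 ≤ d) (hα : 0 ≤ α)
    (hα' : 3 ≤ d → α < 2 / ((d : ℝ) - 2)) (hγ : 1 < γ) (hγ2 : γ < 2) (hγ' : 1 < γ')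
    (K : Constants) {Tmax : ℝ} (hTmax : 0 < Tmax) :
    ∃ C : ℝ, 1 ≤ C ∧ ∀ T, 0 < T → T ≤ Tmax → ∀ D : Data d, Assumptions γ γ' K T D →
      ∀ u m : E d → ℝ → ℝ, IsSmoothSolution α T D u m → ∀ t ∈ Icc 0 T,
        ∫ x in cube d, m x t ^ (1 + α) ≤ C ∧
        ∫ x in cube d, (u x t + shift K Tmax) ^ (1 + 1 / (1 + α)) ≤ C := by
  have hB := K.one_le_bound
  have h1α : 0 < 1 + α := by linarith
  set B := K.bound with hBdef
  set a := shift K Tmax with ha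
  have ha0 : 0 ≤ a := by rw [ha, shift]; positivity
  set r := 1 + 1 / (1 + α) with hr
  have hr1 : 1 ≤ r := by rw [hr]; have : 0 < 1 / (1 + α) := by positivity
                         linarith
  set c := 4 * (1 + α) * B ^ 2 * r with hc
  have hc0 : 0 ≤ c := by positivity
  -- the weight that makes the coercivity of the Hamiltonian absorb the drift
  set l := B * (4 * α * (1 + α) * B ^ 2) with hl
  have hl0 : 0 ≤ l := by positivity
  -- the zero-order coefficient to be beaten by the damping `Λ`
  set c4 := l * B + 8 * α * (1 + α) * B ^ 2 with hc4
  have hc40 : 0 ≤ c4 := by positivity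
  -- with `μ = l B` the unknown initial value of `l ∫ u m` is dominated by `μ Z`
  set μ := l * B with hμ
  have hμ0 : 0 ≤ μ := by positivity
  set Λ := (μ + 1) * (Real.exp (c * Tmax) * c) with hΛ
  have hΛ0 : 0 < Λ := by positivity
  obtain ⟨C1, hC10, hC1⟩ := exists_integral_rpow_le (d := d) hd hα hα'
    (ε := (1 + α) / 2 / (Λ + c4)) (by positivity)
  set C := l * B + (Λ + c4) * C1 with hC
  have hC0 : 0 ≤ C := by positivity
  set w₀ := B ^ (1 + α) with hw₀
  set w₁ := l * B + (μ + 1) * Real.exp (c * Tmax) * (B + a) ^ r with hw₁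
  have hw₀0 : 1 ≤ w₀ := Real.one_le_rpow hB h1α.le
  have hw₁0 : 0 ≤ w₁ := by positivity
  set R := w₀ + w₁ + 2 * (C * Tmax) with hR
  have hR0 : 1 ≤ R := by
    have : 0 ≤ 2 * (C * Tmax) := by positivity
    linarith
  refine ⟨R + (w₀ + C * Tmax + μ * R + l * a), ?_, ?_⟩
  · have : 0 ≤ w₀ + C * Tmax + μ * R + l * a := by positivity
    linarith
  intro T hT hTm D A u m S t ht
  have hv : ∀ x, ∀ t ∈ Icc 0 T, 1 ≤ u x t + a :=
    fun x t ht => S.one_le_u_add_shift A hT hTm ht x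
  have hmem : ∀ x, ∀ t ∈ Icc 0 T, u x t ∈ Ioi (-a) := fun x t ht => by
    have := hv x t ht
    simp only [mem_Ioi]; linarith
  have cu := fun t (ht : t ∈ Icc 0 T) => (S.contDiff_u ht).continuous
  have cm := fun t (ht : t ∈ Icc 0 T) => (S.contDiff_m ht).continuous
  have cM := fun t (ht : t ∈ Icc 0 T) => S.continuous_rpow_m ht (1 + α)
  have cv := fun t (ht : t ∈ Icc 0 T) => S.continuous_rpow_u_add ht (fun x => hv x t ht) r
  set E1 : ℝ → ℝ := fun t => ∫ x in cube d, u x t * m x t with hE1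
  set M : ℝ → ℝ := fun t => ∫ x in cube d, m x t ^ (1 + α) with hM
  set Z : ℝ → ℝ := fun t => ∫ x in cube d, (u x t + a) ^ r with hZ
  have iM0 : ∀ t ∈ Icc 0 T, 0 ≤ M t := fun t ht =>
    integral_cube_nonneg fun x => (Real.rpow_pos_of_pos (S.m_pos x t ht) _).le
  have iZ0 : ∀ t ∈ Icc 0 T, 0 ≤ Z t := fun t ht =>
    integral_cube_nonneg fun x => Real.rpow_nonneg (by linarith [hv x t ht]) _
  have hcE := S.continuousOn_integral (P := fun y => y) contDiffOn_id
    (O := univ) (fun _ _ _ => mem_univ _) 1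
  have hcM := S.continuousOn_integral (P := fun _ => 1) contDiffOn_const
    (O := univ) (fun _ _ _ => mem_univ _) (1 + α)
  have hcZ := S.continuousOn_integral (contDiffOn_add_rpow a r) hmem 0
  have hdE := fun t (ht : t ∈ Ioo 0 T) => S.hasDerivAt_integral A hd isOpen_univ
    (P := fun y => y) contDiffOn_id (fun _ _ _ => mem_univ _) 1 ht
  have hdM := fun t (ht : t ∈ Ioo 0 T) => S.hasDerivAt_integral A hd isOpen_univ
    (P := fun _ => 1) contDiffOn_const (fun _ _ _ => mem_univ _) (1 + α) ht
  have hdZ := fun t (ht : t ∈ Ioo 0 T) => S.hasDerivAt_integral A hd isOpen_Ioi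
    (contDiffOn_add_rpow a r) hmem 0 ht
  simp only [Real.rpow_one, Real.rpow_zero, mul_one, one_mul] at hcE hcM hcZ hdE hdM hdZ
  -- the two values at the ends of the time interval
  have hb0 : l * E1 0 + M 0 - μ * Z 0 ≤ w₀ := by
    have h0 : (0 : ℝ) ∈ Icc 0 T := ⟨le_rfl, hT.le⟩
    have h : ∫ x in cube d, (l * (u x 0 * m x 0) + m x 0 ^ (1 + α) - μ * (u x 0 + a) ^ r)
        ≤ ∫ _ in cube d, w₀ := by
      refine integral_cube_mono (((continuous_const.mul ((cu 0 h0).mul (cm 0 h0))).add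
        (cM 0 h0)).sub (continuous_const.mul (cv 0 h0))) continuous_const fun x => ?_
      have hm := S.m_pos x 0 h0
      have hmB : m x 0 ≤ B := by
        rw [S.initial]
        exact (A.m₀_upper x).trans K.le_bound.2.2.2.2.1
      have hv0 := hv x 0 h0
      have k1 : m x 0 ^ (1 + α) ≤ w₀ := Real.rpow_le_rpow hm.le hmB h1α.le
      have k2 : u x 0 * m x 0 ≤ B * (u x 0 + a) ^ r := by
        have k3 : u x 0 + a ≤ (u x 0 + a) ^ r := by
          simpa using Real.rpow_le_rpow_of_exponent_le hv0 hr1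
        calc u x 0 * m x 0 ≤ (u x 0 + a) * m x 0 :=
              mul_le_mul_of_nonneg_right (by linarith) hm.le
          _ ≤ (u x 0 + a) * B := mul_le_mul_of_nonneg_left hmB (by linarith)
          _ = B * (u x 0 + a) := mul_comm _ _
          _ ≤ _ := mul_le_mul_of_nonneg_left k3 (by linarith)
      have k4 := mul_le_mul_of_nonneg_left k2 hl0
      rw [hμ]
      linarith
    rw [integral_cube_const, integral_cube_sub
      (f := fun x => l * (u x 0 * m x 0) + m x 0 ^ (1 + α)) (g := fun x => μ * (u x 0 + a) ^ r)
      ((continuous_const.mul ((cu 0 h0).mul (cm 0 h0))).add (cM 0 h0))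
      (continuous_const.mul (cv 0 h0)), integral_cube_add (f := fun x => l * (u x 0 * m x 0))
      (g := fun x => m x 0 ^ (1 + α)) (continuous_const.mul ((cu 0 h0).mul (cm 0 h0))) (cM 0 h0),
      integral_const_mul, integral_const_mul] at h
    exact h
  have hbT : -w₁ ≤ l * E1 T + M T - (μ + 1) * Real.exp (c * Tmax) * Z T := by
    have hTT : T ∈ Icc 0 T := ⟨hT.le, le_rfl⟩
    have hΨ := fun x => abs_le.1 ((A.Ψ_bound x).trans K.le_bound.2.2.2.2.2.1)
    have k1 : -B ≤ E1 T := by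
      have h : ∫ x in cube d, -B * m x T ≤ E1 T := by
        refine integral_cube_mono (continuous_const.mul (cm T hTT)) ((cu T hTT).mul (cm T hTT))
          fun x => mul_le_mul_of_nonneg_right ?_ (S.m_pos x T hTT).le
        rw [S.terminal]
        exact (hΨ x).1
      rw [integral_const_mul, S.integral_m A hd hTT, mul_one] at h
      exact h
    have k2 : Z T ≤ (B + a) ^ r := by
      have h : Z T ≤ ∫ _ in cube d, (B + a) ^ r := by
        refine integral_cube_mono (cv T hTT) continuous_const fun x => ?_
        refine Real.rpow_le_rpow (by linarith [hv x T hTT]) ?_ (by linarith)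
        have : u x T ≤ B := by
          rw [S.terminal]
          exact (hΨ x).2
        linarith
      rwa [integral_cube_const] at h
    have k3 := mul_le_mul_of_nonneg_left k1 hl0
    have k4 := mul_le_mul_of_nonneg_left k2
      (by positivity : 0 ≤ (μ + 1) * Real.exp (c * Tmax))
    have k5 := iM0 T hTT
    rw [hw₁]
    linarith
  have hFM : ∀ t ∈ Ioo 0 T, l * (∫ x in cube d, rate α D u m (fun y => y) 1 x t)
      + ∫ x in cube d, rate α D u m (fun _ => 1) (1 + α) x t ≤ -(Λ * M t) + C := by
    intro t ht
    have ht' := Ioo_subset_Icc_self ht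
    have k1 := mul_le_mul_of_nonneg_left (S.integral_rate_u_mul_m_le A hd hγ ht) hl0
    have k2 := S.integral_rate_rpow_m_le A hγ hγ2 hα ht
    have k3 := hC1 (fun x => m x t) (S.contDiff_m ht') (S.m_periodic t ht')
      (fun x => S.m_pos x t ht') (S.integral_m A hd ht')
    have k4 := mul_le_mul_of_nonneg_left k3 (by positivity : 0 ≤ Λ + c4)
    set X := ∫ x in cube d, m x t ^ (1 + α) * ‖momentum α u m x t‖ ^ γ
    set G := ∫ x in cube d, m x t ^ (α - 1) * ‖∇ (fun y => m y t) x‖ ^ 2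
    have e1 : l * (-(B⁻¹ * X)) = -(4 * α * (1 + α) * B ^ 2 * X) := by
      rw [hl]; field_simp
    have e2 : (Λ + c4) * ((1 + α) / 2 / (Λ + c4) * (α * G) + C1)
        = α * (1 + α) / 2 * G + (Λ + c4) * C1 := by
      field_simp
    rw [e2] at k4
    have k4' : (Λ + c4) * M t ≤ α * (1 + α) / 2 * G + (Λ + c4) * C1 := k4
    have e3 : c4 * M t = l * B * M t + 8 * α * (1 + α) * B ^ 2 * M t := by rw [hc4]; ring
    have k1' : l * ∫ x in cube d, rate α D u m (fun y => y) 1 x t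
        ≤ -(4 * α * (1 + α) * B ^ 2 * X) + l * B * M t + l * B := by
      rw [← e1]
      calc _ ≤ _ := k1
        _ = _ := by ring
    have k2' : ∫ x in cube d, rate α D u m (fun _ => 1) (1 + α) x t
        ≤ -(α * (1 + α) / 2 * G) + 4 * α * (1 + α) * B ^ 2 * X
          + 8 * α * (1 + α) * B ^ 2 * M t := k2
    linarith
  obtain ⟨q1, q2⟩ := bounds_of_coupled_inequalities (F := fun t => l * E1 t + M t) (Z := Z)
    (M := M) hTm hc0 hμ0 hC0 ((continuousOn_const.mul hcE).add hcM) hcZ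
    (fun t ht => ((hdE t ht).const_mul l).add (hdM t ht)) hdZ
    (fun t ht => iM0 t (Ioo_subset_Icc_self ht)) iZ0 hFM
    (fun t ht => S.le_integral_rate_rpow_u A hγ' hα hv ht) hb0 hbT ht
  have k1 : -a ≤ E1 t := by
    have h : ∫ x in cube d, -a * m x t ≤ E1 t := by
      refine integral_cube_mono (continuous_const.mul (cm t ht)) ((cu t ht).mul (cm t ht))
        fun x => mul_le_mul_of_nonneg_right ?_ (S.m_pos x t ht).le
      linarith [hv x t ht]
    rw [integral_const_mul, S.integral_m A hd ht, mul_one] at h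
    exact h
  have k2 := mul_le_mul_of_nonneg_left k1 hl0
  have q2' : l * E1 t + M t ≤ w₀ + C * Tmax + μ * R := q2
  have q1' : Z t ≤ R := q1
  have p1 : 0 ≤ w₀ + C * Tmax + μ * R + l * a := by positivity
  exact ⟨show M t ≤ _ by linarith, show Z t ≤ _ by linarith⟩

end CongestionMFG

/-! ### The upper bound for the value function -/

namespace CongestionMFG

variable {d : ℕ} {α γ γ' T : ℝ} {K : Constants} {D : Data d} {u m : E d → ℝ → ℝ}

/-- The weighted Sobolev inequality on the torus, in the form in which it absorbs a zero-order
term with a weight `a` and a large factor `L` into the dissipation: the weight is measured in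
`L^p`, and the loss is polynomial in `A` and `L`. -/
def WeightedSobolev (d : ℕ) (p k C : ℝ) : Prop :=
  ∀ f a : E d → ℝ, ContDiff ℝ 1 f → Periodic f → (∀ x, 0 < f x) → Continuous a →
    (∀ x, 0 ≤ a x) → ∀ A : ℝ, 1 ≤ A → ∫ x in cube d, a x ^ p ≤ A ^ p → ∀ L : ℝ, 1 ≤ L →
    L * (∫ x in cube d, a x * f x ^ 2) ≤ (∫ x in cube d, ‖(∇ f) x‖ ^ 2)
      + C * A ^ k * L ^ (k + 1) * (∫ x in cube d, f x) ^ 2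

theorem exists_weightedSobolev (hd : 1 ≤ d) {α : ℝ} (hα : 0 ≤ α)
    (hα' : 3 ≤ d → α < 2 / ((d : ℝ) - 2)) :
    ∃ p k C : ℝ, 1 ≤ p ∧ α * p ≤ 1 + α ∧ 1 ≤ k ∧ 1 ≤ C ∧ WeightedSobolev d p k C := by
  obtain ⟨p, k, C, hp, hαp, hk, hC, h⟩ := exists_weighted_sobolev hd hα hα'
  refine ⟨p, k, C, hp, hαp, hk, hC, fun f a hf hper hpos ha ha0 A hA hAp L hL => ?_⟩
  have hL0 : 0 < L := by linarith
  have h1 := h f a hf hper hpos ha ha0 A hA hAp L⁻¹ (inv_pos.2 hL0) (inv_le_one_of_one_le₀ hL)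
  have h2 := mul_le_mul_of_nonneg_left h1 hL0.le
  refine h2.trans (le_of_eq ?_)
  rw [div_inv_eq_mul, Real.mul_rpow (by linarith) hL0.le, Real.rpow_add hL0, Real.rpow_one]
  field_simp

theorem one_add_add_rpow_le {p x y : ℝ} (hp : 1 ≤ p) (hx : 0 ≤ x) (hy : 0 ≤ y) :
    (1 + x + y) ^ p ≤ 3 ^ p * (1 + x ^ p + y ^ p) := by
  set M := max 1 (max x y) with hM
  have h1 : 1 ≤ M := le_max_left _ _
  have h2 : x ≤ M := (le_max_left _ _).trans (le_max_right _ _)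
  have h3 : y ≤ M := (le_max_right _ _).trans (le_max_right _ _)
  have hxp := Real.rpow_nonneg hx p
  have hyp := Real.rpow_nonneg hy p
  have h4 : M ^ p ≤ 1 + x ^ p + y ^ p := by
    rcases max_choice 1 (max x y) with h | h
    · rw [hM, h, Real.one_rpow]; linarith
    · rcases max_choice x y with h' | h' <;> rw [hM, h, h'] <;> linarith
  calc (1 + x + y) ^ p ≤ (3 * M) ^ p :=
        Real.rpow_le_rpow (by linarith) (by linarith) (by linarith)
    _ = 3 ^ p * M ^ p := Real.mul_rpow (by norm_num) (by linarith)
    _ ≤ _ := mul_le_mul_of_nonneg_left h4 (by positivity)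

theorem rpow_le_one_add_rpow {s ρ σ : ℝ} (hs : 0 < s) (hρ : 0 ≤ ρ) (h : ρ ≤ σ) :
    s ^ ρ ≤ 1 + s ^ σ := by
  have h1 := Real.rpow_pos_of_pos hs σ
  rcases le_total s 1 with h2 | h2
  · have := Real.rpow_le_one hs.le h2 hρ
    linarith
  · have := Real.rpow_le_rpow_of_exponent_le h2 h
    linarith

/-- Polynomial growth along the exponents `r₀ 2^n` is geometric growth in `n`. -/
theorem exists_mul_rpow_le_pow (C : ℝ) {r₀ k : ℝ} (hr₀ : 0 ≤ r₀) (hk : 0 ≤ k) :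
    ∃ Q : ℝ, 1 ≤ Q ∧ ∀ n : ℕ, C * (r₀ * 2 ^ (n + 1)) ^ k ≤ Q ^ (n + 1) := by
  set a := max 1 (C * r₀ ^ k) with ha
  have ha1 : 1 ≤ a := le_max_left _ _
  have h2 : (1 : ℝ) ≤ 2 ^ k := Real.one_le_rpow (by norm_num) hk
  refine ⟨a * 2 ^ k, one_le_mul_of_one_le_of_one_le ha1 h2, fun n => ?_⟩
  have h3 : ((2 : ℝ) ^ (n + 1)) ^ k = (2 ^ k) ^ (n + 1) := by
    rw [← Real.rpow_natCast, ← Real.rpow_natCast, ← Real.rpow_mul (by norm_num),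
      ← Real.rpow_mul (by norm_num), mul_comm]
  rw [Real.mul_rpow hr₀ (by positivity), h3, ← mul_assoc, mul_pow]
  refine mul_le_mul_of_nonneg_right ?_ (by positivity)
  exact (le_max_right _ _).trans (le_self_pow₀ ha1 (Nat.succ_ne_zero n))

theorem rpow_half_sq {s : ℝ} (hs : 0 < s) (r : ℝ) : (s ^ (r / 2)) ^ 2 = s ^ r := by
  rw [← Real.rpow_natCast, ← Real.rpow_mul hs.le]
  congr 1
  push_cast
  ring

theorem rpow_mul_two_pow {s : ℝ} (hs : 0 ≤ s) (r : ℝ) (n : ℕ) :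
    s ^ (r * 2 ^ n) = (s ^ r) ^ 2 ^ n := by
  rw [Real.rpow_mul hs]
  exact_mod_cast Real.rpow_natCast (s ^ r) (2 ^ n)

namespace IsSmoothSolution

variable (A : Assumptions γ γ' K T D) (S : IsSmoothSolution α T D u m)
include A S

/-- The integrated form of `le_rate_rpow_u`, in terms of `f = v^{r/2}`. -/
theorem integral_sub_le_integral_rate_rpow_u (hγ' : 1 < γ') (hα : 0 ≤ α) {a r : ℝ}
    (hr : 1 + 1 / (1 + α) ≤ r) (hv : ∀ x, ∀ t ∈ Icc 0 T, 1 ≤ u x t + a) {t : ℝ}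
    (ht : t ∈ Ioo 0 T) :
    1 / (1 + α) * (∫ x in cube d, ‖∇ (fun y => (u y t + a) ^ (r / 2)) x‖ ^ 2)
      - 2 * (1 + α) * K.bound ^ 2 * r
        * (∫ x in cube d, (1 + m x t ^ α) * ((u x t + a) ^ (r / 2)) ^ 2)
      ≤ ∫ x in cube d, rate α D u m (fun y => (y + a) ^ r) 0 x t := by
  have ht' := Ioo_subset_Icc_self ht
  have h1α : 0 < 1 + α := by linarith
  have hi : 0 < 1 / (1 + α) := by positivity
  have hr0 : 0 < r := by linarith
  have hpos : ∀ x, 0 < u x t + a := fun x => by linarith [hv x t ht']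
  have hsm : ContDiff ℝ ∞ fun x => u x t + a := (S.contDiff_u ht').add contDiff_const
  have hsm2 : ContDiff ℝ ∞ fun x => (u x t + a) ^ (r / 2) :=
    hsm.rpow_const_of_ne fun x => (hpos x).ne'
  have cg : Continuous fun x => ‖∇ (fun y => (u y t + a) ^ (r / 2)) x‖ ^ 2 :=
    (continuous_gradient (hsm2.of_le (by simp))).norm.pow 2
  have cw : Continuous fun x => (1 + m x t ^ α) * ((u x t + a) ^ (r / 2)) ^ 2 :=
    (continuous_const.add (S.continuous_rpow_m ht' α)).mul (hsm2.continuous.pow 2)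
  rw [← integral_const_mul, ← integral_const_mul,
    ← integral_cube_sub (f := fun x => 1 / (1 + α) * ‖∇ (fun y => (u y t + a) ^ (r / 2)) x‖ ^ 2)
      (g := fun x => 2 * (1 + α) * K.bound ^ 2 * r
        * ((1 + m x t ^ α) * ((u x t + a) ^ (r / 2)) ^ 2))
      (continuous_const.mul cg) (continuous_const.mul cw)]
  refine integral_cube_mono ((continuous_const.mul cg).sub (continuous_const.mul cw))
    (S.continuous_rate A isOpen_Ioi (contDiffOn_add_rpow a r)
      (fun x t ht => by have := hv x t ht; simp only [mem_Ioi]; linarith) 0 ht) fun x => ?_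
  have h1 := S.le_rate_rpow_u A hγ' hα hr ht' x (hv x t ht')
  have hg : ∇ (fun y => u y t + a) x = ∇ (fun y => u y t) x := by
    simp [gradient, fderiv_add_const]
  rw [rpow_half_sq (hpos x),
    sq_norm_gradient_rpow r (hsm.differentiable (by simp) x) (hpos x), hg]
  have h2 : (u x t + a) ^ (r - 1) ≤ (u x t + a) ^ r :=
    Real.rpow_le_rpow_of_exponent_le (hv x t ht') (by linarith)
  have h3 := mul_le_mul_of_nonneg_left h2 (Real.rpow_pos_of_pos (S.m_pos x t ht') α).le
  have h4 := mul_le_mul_of_nonneg_left h3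
    (by positivity : 0 ≤ 2 * (1 + α) * K.bound ^ 2 * r)
  have h5 : 1 / (1 + α) * (r ^ 2 / 4) ≤ r * (r - 1) / 2 := by
    have h6 : 1 / (1 + α) ≤ 1 := by rw [div_le_one h1α]; linarith
    have h7 : 1 / (1 + α) * r ≤ 2 * (r - 1) := by nlinarith
    nlinarith
  have h8 := mul_le_mul_of_nonneg_right h5 (mul_nonneg (Real.rpow_nonneg (hpos x).le (r - 2))
    (sq_nonneg ‖∇ (fun y => u y t) x‖))
  linarith

end IsSmoothSolution

/-- The value function is bounded from above. -/
theorem exists_u_le (hd : 1 ≤ d) (hα : 0 ≤ α)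
    (hα' : 3 ≤ d → α < 2 / ((d : ℝ) - 2)) (hγ : 1 < γ) (hγ2 : γ < 2) (hγ' : 1 < γ')
    (K : Constants) {Tmax : ℝ} (hTmax : 0 < Tmax) :
    ∃ C : ℝ, 0 ≤ C ∧ ∀ T, 0 < T → T ≤ Tmax → ∀ D : Data d, Assumptions γ γ' K T D →
      ∀ u m : E d → ℝ → ℝ, IsSmoothSolution α T D u m → ∀ x, ∀ t ∈ Icc 0 T, u x t ≤ C := by
  have hB := K.one_le_bound
  have h1α : 0 < 1 + α := by linarith
  obtain ⟨p, k, C0, hp, hαp, hk, hC0, hsob⟩ := exists_weightedSobolev hd hα hα'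
  obtain ⟨CE, hCE, henergy⟩ := exists_energy_bound (d := d) hd hα hα' hγ hγ2 hγ' K hTmax
  set B := K.bound with hBdef
  set a := shift K Tmax with ha
  have ha0 : 0 ≤ a := by rw [ha, shift]; positivity
  set r₀ := 1 + 1 / (1 + α) with hr₀
  have hi : 0 < 1 / (1 + α) := by positivity
  have hr₀1 : 1 ≤ r₀ := by linarith
  set w := 3 * (2 + CE) with hw
  -- the coefficient of the zero-order term, divided by that of the dissipation
  set c := (1 + α) * (2 * (1 + α) * B ^ 2 + 1) with hc
  have hc0 : 0 ≤ c := by positivity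
  have hc1 : 1 ≤ c := by
    have : 0 ≤ 2 * (1 + α) * B ^ 2 := by positivity
    nlinarith
  have hk1 : 0 ≤ k + 1 := by linarith
  obtain ⟨Q, hQ, hQn⟩ := exists_mul_rpow_le_pow
    (1 / (1 + α) * (C0 * w ^ k * c ^ (k + 1))) (by linarith : 0 ≤ r₀) hk1
  set M := CE + (B + a) ^ r₀ with hM
  have hBa : 0 ≤ (B + a) ^ r₀ := by positivity
  have hM1 : 1 ≤ M := by linarith
  refine ⟨Q ^ 2 * M, by positivity, fun T hT hTm D A u m S => ?_⟩
  have hv : ∀ x, ∀ t ∈ Icc 0 T, 1 ≤ u x t + a :=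
    fun x t ht => S.one_le_u_add_shift A hT hTm ht x
  have hv0 : ∀ x, ∀ t ∈ Icc 0 T, 0 < u x t + a := fun x t ht => by linarith [hv x t ht]
  have hmem : ∀ x, ∀ t ∈ Icc 0 T, u x t ∈ Ioi (-a) := fun x t ht => by
    have := hv x t ht
    simp only [mem_Ioi]; linarith
  have hTT : T ∈ Icc 0 T := ⟨hT.le, le_rfl⟩
  have hmom : ∀ n : ℕ, ∀ t ∈ Icc 0 T,
      ∫ x in cube d, (u x t + a) ^ (r₀ * 2 ^ n) ≤ (Q ^ 2 * M) ^ 2 ^ n := by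
    refine moment_recursion hQ hM1 (fun t ht => ?_) (fun n c' hc' hn t ht => ?_)
    · have := (henergy T hT hTm D A u m S t ht).2
      simp only [pow_zero, mul_one]
      linarith
    set r := r₀ * 2 ^ (n + 1) with hr
    have hrr : r₀ ≤ r := le_mul_of_one_le_right (by linarith) (one_le_pow₀ (by norm_num))
    have hr2 : r / 2 = r₀ * 2 ^ n := by rw [hr, pow_succ]; ring
    have hcont := S.continuousOn_integral (contDiffOn_add_rpow a r) hmem 0
    have hder := fun t (ht : t ∈ Ioo 0 T) => S.hasDerivAt_integral A hd isOpen_Ioi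
      (contDiffOn_add_rpow a r) hmem 0 ht
    simp only [Real.rpow_zero, mul_one] at hcont hder
    have key := le_max_of_le_hasDerivAt (c := Q ^ (n + 1) * c' ^ 2) hcont hder
      (fun t ht => ?_) ht
    · refine key.trans (max_le_max ?_ le_rfl)
      have h : ∫ x in cube d, (u x T + a) ^ r ≤ ∫ _ in cube d, (B + a) ^ r := by
        refine integral_cube_mono (S.continuous_rpow_u_add hTT (fun x => hv x T hTT) r)
          continuous_const fun x => ?_
        refine Real.rpow_le_rpow (hv0 x T hTT).le ?_ (by linarith)
        have : u x T ≤ B := by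
          rw [S.terminal]
          exact (abs_le.1 ((A.Ψ_bound x).trans K.le_bound.2.2.2.2.2.1)).2
        linarith
      rw [integral_cube_const] at h
      refine h.trans ?_
      rw [hr, rpow_mul_two_pow (by positivity)]
      exact pow_le_pow_left₀ hBa (by linarith) _
    · have ht' := Ioo_subset_Icc_self ht
      have h1 := S.integral_sub_le_integral_rate_rpow_u A hγ' hα hrr hv ht
      have hsm2 : ContDiff ℝ ∞ fun x => (u x t + a) ^ (r / 2) :=
        ((S.contDiff_u ht').add contDiff_const).rpow_const_of_ne fun x => (hv0 x t ht').ne'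
      have cα := S.continuous_rpow_m ht' α
      -- the weight is controlled by the energy
      have hwp : ∫ x in cube d, (1 + m x t ^ α) ^ p ≤ w ^ p := by
        have h2 : ∫ x in cube d, (1 + m x t ^ α) ^ p
            ≤ ∫ x in cube d, 3 ^ p * (2 + m x t ^ (1 + α)) := by
          refine integral_cube_mono ((continuous_const.add cα).rpow_const fun x =>
            Or.inr (by linarith)) (continuous_const.mul
              (continuous_const.add (S.continuous_rpow_m ht' (1 + α)))) fun x => ?_
          have hm := S.m_pos x t ht'
          have h3 := one_add_add_rpow_le hp (Real.rpow_pos_of_pos hm α).le le_rfl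
          rw [Real.zero_rpow (by linarith), add_zero, add_zero, ← Real.rpow_mul hm.le] at h3
          have h4 := rpow_le_one_add_rpow hm (by positivity : 0 ≤ α * p) hαp
          exact h3.trans (mul_le_mul_of_nonneg_left (by linarith) (by positivity))
        have h5 := (henergy T hT hTm D A u m S t ht').1
        rw [integral_const_mul, integral_cube_add (f := fun _ => (2 : ℝ))
          (g := fun x => m x t ^ (1 + α)) continuous_const (S.continuous_rpow_m ht' (1 + α)),
          integral_cube_const] at h2
        refine h2.trans ?_
        rw [hw, Real.mul_rpow (by norm_num) (by linarith)]
        refine mul_le_mul_of_nonneg_left ?_ (by positivity)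
        have h6 := Real.rpow_le_rpow_of_exponent_le (by linarith : 1 ≤ 2 + CE) hp
        rw [Real.rpow_one] at h6
        linarith
      have hrpos : 1 ≤ r := by linarith
      have h2 := hsob (fun x => (u x t + a) ^ (r / 2)) (fun x => 1 + m x t ^ α)
        (hsm2.of_le (by simp))
        ((S.u_periodic t ht').comp fun s => (s + a) ^ (r / 2))
        (fun x => Real.rpow_pos_of_pos (hv0 x t ht') _) (continuous_const.add cα)
        (fun x => by linarith [Real.rpow_pos_of_pos (S.m_pos x t ht') α]) w (by linarith) hwp
        (c * r) (one_le_mul_of_one_le_of_one_le hc1 hrpos)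
      have h3 : ∫ x in cube d, (u x t + a) ^ r
          ≤ ∫ x in cube d, (1 + m x t ^ α) * ((u x t + a) ^ (r / 2)) ^ 2 := by
        refine integral_cube_mono (S.continuous_rpow_u_add ht' (fun x => hv x t ht') r)
          ((continuous_const.add cα).mul (hsm2.continuous.pow 2)) fun x => ?_
        rw [rpow_half_sq (hv0 x t ht')]
        exact le_mul_of_one_le_left (Real.rpow_nonneg (hv0 x t ht').le _)
          (by linarith [Real.rpow_pos_of_pos (S.m_pos x t ht') α])
      have h4 : ∫ x in cube d, (u x t + a) ^ (r / 2) ≤ c' := by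
        rw [hr2]
        exact hn t ht'
      have h40 : 0 ≤ ∫ x in cube d, (u x t + a) ^ (r / 2) :=
        integral_cube_nonneg fun x => Real.rpow_nonneg (hv0 x t ht').le _
      set J := ∫ x in cube d, (1 + m x t ^ α) * ((u x t + a) ^ (r / 2)) ^ 2
      set G := ∫ x in cube d, ‖∇ (fun x => (u x t + a) ^ (r / 2)) x‖ ^ 2
      set I := ∫ x in cube d, (u x t + a) ^ (r / 2)
      have hJ0 : 0 ≤ J := (integral_cube_nonneg fun x =>
        Real.rpow_nonneg (hv0 x t ht').le _).trans h3
      have h5 := mul_le_mul_of_nonneg_left h2 hi.le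
      have h6 : 1 / (1 + α) * (c * r * J) = 2 * (1 + α) * B ^ 2 * r * J + r * J := by
        rw [hc]; field_simp
      have h7 : J ≤ r * J := le_mul_of_one_le_left hJ0 hrpos
      have h8 : 1 / (1 + α) * (C0 * w ^ k * (c * r) ^ (k + 1) * I ^ 2)
          ≤ Q ^ (n + 1) * c' ^ 2 := by
        rw [Real.mul_rpow hc0 (by linarith)]
        calc _ = 1 / (1 + α) * (C0 * w ^ k * c ^ (k + 1)) * r ^ (k + 1) * I ^ 2 := by ring
          _ ≤ _ := mul_le_mul (hQn n) (pow_le_pow_left₀ h40 h4 2) (sq_nonneg _)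
            (by positivity)
      linarith
  intro x t ht
  have hW := le_of_moments_le (W := fun x => (u x t + a) ^ r₀) (Λ := Q ^ 2 * M)
    (S.continuous_rpow_u_add ht (fun x => hv x t ht) r₀)
    ((S.u_periodic t ht).comp fun s => (s + a) ^ r₀)
    (fun x => Real.rpow_nonneg (hv0 x t ht).le _) (by positivity) (fun n => by
      have := hmom n t ht
      simpa only [rpow_mul_two_pow (hv0 _ t ht).le] using this) x
  have h1 := Real.rpow_le_rpow_of_exponent_le (hv x t ht) hr₀1
  rw [Real.rpow_one] at h1
  linarith

end CongestionMFG

/-! ### Negative moments of the density -/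

namespace CongestionMFG

variable {d : ℕ} {α γ γ' T : ℝ} {K : Constants} {D : Data d} {u m : E d → ℝ → ℝ}

namespace IsSmoothSolution

variable (A : Assumptions γ γ' K T D) (S : IsSmoothSolution α T D u m)
include S

theorem continuous_weight {t : ℝ} (ht : t ∈ Icc 0 T) (β : ℝ) :
    Continuous fun x => 1 + m x t ^ α + m x t ^ (-β) :=
  (continuous_const.add (S.continuous_rpow_m ht α)).add (S.continuous_rpow_m ht (-β))

theorem one_le_weight {t : ℝ} (ht : t ∈ Icc 0 T) (β : ℝ) (x : E d) :
    1 ≤ 1 + m x t ^ α + m x t ^ (-β) := by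
  have h1 := Real.rpow_pos_of_pos (S.m_pos x t ht) α
  have h2 := Real.rpow_pos_of_pos (S.m_pos x t ht) (-β)
  linarith

/-- The weight `1 + m^α + m^{-β}` is controlled in `L^p` by the energy and by the negative moment
of order `1 + β p`. -/
theorem integral_weight_rpow_le (hα : 0 ≤ α) {p β R : ℝ} (hp : 1 ≤ p) (hαp : α * p ≤ 1 + α)
    (hβ : 0 ≤ β) {t : ℝ} (ht : t ∈ Icc 0 T) (hR : (∫ x in cube d, m x t ^ (1 + α))
      + ∫ x in cube d, m x t ^ (-(1 + β * p)) ≤ R) (hR0 : 0 ≤ R) :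
    ∫ x in cube d, (1 + m x t ^ α + m x t ^ (-β)) ^ p ≤ (3 * (3 + R)) ^ p := by
  have c1 := S.continuous_rpow_m ht (1 + α)
  have c2 := S.continuous_rpow_m ht (-(1 + β * p))
  have h : ∫ x in cube d, (1 + m x t ^ α + m x t ^ (-β)) ^ p
      ≤ ∫ x in cube d, 3 ^ p * (3 + m x t ^ (1 + α) + m x t ^ (-(1 + β * p))) := by
    refine integral_cube_mono ((S.continuous_weight ht β).rpow_const fun x =>
      Or.inr (by linarith)) (continuous_const.mul ((continuous_const.add c1).add c2)) fun x => ?_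
    have hm := S.m_pos x t ht
    have h1 := one_add_add_rpow_le hp (Real.rpow_pos_of_pos hm α).le
      (Real.rpow_pos_of_pos hm (-β)).le
    rw [← Real.rpow_mul hm.le, ← Real.rpow_mul hm.le] at h1
    have h2 := rpow_le_one_add_rpow hm (by positivity : 0 ≤ α * p) hαp
    have h3 := rpow_le_one_add_rpow (inv_pos.2 hm) (by positivity : 0 ≤ β * p)
      (by linarith : β * p ≤ 1 + β * p)
    rw [Real.inv_rpow hm.le, Real.inv_rpow hm.le, ← Real.rpow_neg hm.le,
      ← Real.rpow_neg hm.le, ← neg_mul] at h3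
    exact h1.trans (mul_le_mul_of_nonneg_left (by linarith) (by positivity))
  rw [integral_const_mul, integral_cube_add (f := fun x => 3 + m x t ^ (1 + α))
    (g := fun x => m x t ^ (-(1 + β * p))) (continuous_const.add c1) c2,
    integral_cube_add (f := fun _ => (3 : ℝ)) (g := fun x => m x t ^ (1 + α)) continuous_const c1,
    integral_cube_const] at h
  refine h.trans ?_
  rw [Real.mul_rpow (by norm_num) (by linarith)]
  refine mul_le_mul_of_nonneg_left ?_ (by positivity)
  have h6 := Real.rpow_le_rpow_of_exponent_le (by linarith : 1 ≤ 3 + R) hp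
  rw [Real.rpow_one] at h6
  linarith

theorem integral_sq_rpow_half {t : ℝ} (ht : t ∈ Icc 0 T) (r : ℝ) :
    ∫ x in cube d, (m x t ^ (-r / 2)) ^ 2 = ∫ x in cube d, m x t ^ (-r) := by
  simp only [rpow_half_sq (S.m_pos _ t ht)]

include A

/-- The integrated form of `rate_neg_rpow_m_le`, in terms of `f = m^{-r/2}`. -/
theorem integral_rate_neg_rpow_m_le (hγ : 1 < γ) (hγ2 : γ < 2) (hγ' : 1 < γ') {a κ : ℝ}
    (hu1 : ∀ x, ∀ t ∈ Icc 0 T, 1 ≤ a - u x t) (hu2 : ∀ x, ∀ t ∈ Icc 0 T, a - u x t ≤ κ)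
    {k β c : ℝ} (hk : k = 1 / (1 - 2 * (γ - 1) / γ))
    (hβ : β = α * (2 * (γ - 1) / γ) / (1 - 2 * (γ - 1) / γ))
    (hc : c = 4 * K.bound + (8 * K.bound ^ 2) ^ (1 / (1 - 1 / γ)) + 8 * κ * K.bound ^ 2
      + (32 * κ * K.bound ^ 3) ^ k) {r : ℝ} (hr : 1 ≤ r) {t : ℝ} (ht : t ∈ Ioo 0 T) :
    ∫ x in cube d, rate α D u m (fun y => a - y) (-r) x t
      ≤ -(2 * ∫ x in cube d, ‖∇ (fun y => m y t ^ (-r / 2)) x‖ ^ 2)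
        + c * r ^ (2 * k)
          * ∫ x in cube d, (1 + m x t ^ α + m x t ^ (-β)) * (m x t ^ (-r / 2)) ^ 2 := by
  have ht' := Ioo_subset_Icc_self ht
  have hsm := S.contDiff_rpow_m ht' (-r / 2)
  have cg : Continuous fun x => ‖∇ (fun y => m y t ^ (-r / 2)) x‖ ^ 2 :=
    (continuous_gradient (hsm.of_le (by simp))).norm.pow 2
  have cw : Continuous fun x =>
      (1 + m x t ^ α + m x t ^ (-β)) * (m x t ^ (-r / 2)) ^ 2 :=
    (S.continuous_weight ht' β).mul (hsm.continuous.pow 2)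
  rw [← integral_const_mul, ← integral_const_mul, ← integral_neg,
    ← integral_cube_add (f := fun x => -(2 * ‖∇ (fun y => m y t ^ (-r / 2)) x‖ ^ 2))
      (g := fun x => c * r ^ (2 * k)
        * ((1 + m x t ^ α + m x t ^ (-β)) * (m x t ^ (-r / 2)) ^ 2))
      (continuous_const.mul cg).neg (continuous_const.mul cw)]
  refine integral_cube_mono (S.continuous_rate A isOpen_univ (P := fun y => a - y)
    (contDiffOn_const.sub contDiffOn_id) (fun _ _ _ => mem_univ _) (-r) ht)
    ((continuous_const.mul cg).neg.add (continuous_const.mul cw)) fun x => ?_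
  have hm := S.m_pos x t ht'
  have h1 := S.rate_neg_rpow_m_le A hγ hγ2 hγ' hr hk ht' x (hu1 x t ht') (hu2 x t ht')
  rw [← hc, ← hβ] at h1
  rw [rpow_half_sq hm, sq_norm_gradient_rpow (-r) ((S.contDiff_m ht').differentiable (by simp) x)
    hm]
  refine h1.trans (le_of_eq ?_)
  ring

end IsSmoothSolution

end CongestionMFG

/-! ### The lower bound for the density -/

namespace CongestionMFG

variable {d : ℕ} {α γ γ' T : ℝ} {K : Constants} {D : Data d} {u m : E d → ℝ → ℝ}

namespace IsSmoothSolution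

variable (A : Assumptions γ γ' K T D) (S : IsSmoothSolution α T D u m)
include A S

/-- The evolution of the negative moments `∫ (a - u) m^{-r}`, with the zero-order terms absorbed
into the dissipation. -/
theorem integral_rate_neg_rpow_m_add_le (hγ : 1 < γ) (hγ2 : γ < 2) (hγ' : 1 < γ') {a κ : ℝ}
    (hu1 : ∀ x, ∀ t ∈ Icc 0 T, 1 ≤ a - u x t) (hu2 : ∀ x, ∀ t ∈ Icc 0 T, a - u x t ≤ κ)
    {j β c : ℝ} (hj : j = 1 / (1 - 2 * (γ - 1) / γ))
    (hβ : β = α * (2 * (γ - 1) / γ) / (1 - 2 * (γ - 1) / γ))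
    (hc : c = 4 * K.bound + (8 * K.bound ^ 2) ^ (1 / (1 - 1 / γ)) + 8 * κ * K.bound ^ 2
      + (32 * κ * K.bound ^ 3) ^ j) (hj0 : 0 ≤ j) (hc1 : 1 ≤ c)
    {p k C W e : ℝ} (hsob : WeightedSobolev d p k C) (hW : 1 ≤ W) (he : 0 ≤ e) {r : ℝ}
    (hr : 1 ≤ r) {t : ℝ} (ht : t ∈ Ioo 0 T)
    (hw : ∫ x in cube d, (1 + m x t ^ α + m x t ^ (-β)) ^ p ≤ W ^ p) :
    (∫ x in cube d, rate α D u m (fun y => a - y) (-r) x t) + e * ∫ x in cube d, m x t ^ (-r)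
      ≤ C * W ^ k * ((c + e) * r ^ (2 * j)) ^ (k + 1)
        * (∫ x in cube d, m x t ^ (-r / 2)) ^ 2 := by
  have ht' := Ioo_subset_Icc_self ht
  have h1 := S.integral_rate_neg_rpow_m_le A hγ hγ2 hγ' hu1 hu2 hj hβ hc hr ht
  have hR : 1 ≤ r ^ (2 * j) := Real.one_le_rpow hr (by linarith)
  have hsm := S.contDiff_rpow_m ht' (-r / 2)
  have cw := S.continuous_weight (α := α) ht' β
  have h2 := hsob (fun x => m x t ^ (-r / 2)) (fun x => 1 + m x t ^ α + m x t ^ (-β))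
    (hsm.of_le (by simp)) ((S.m_periodic t ht').comp fun s => s ^ (-r / 2))
    (fun x => Real.rpow_pos_of_pos (S.m_pos x t ht') _) cw
    (fun x => zero_le_one.trans (S.one_le_weight ht' β x)) W hW hw ((c + e) * r ^ (2 * j))
    (one_le_mul_of_one_le_of_one_le (by linarith) hR)
  have h3 : ∫ x in cube d, m x t ^ (-r)
      ≤ ∫ x in cube d, (1 + m x t ^ α + m x t ^ (-β)) * (m x t ^ (-r / 2)) ^ 2 := by
    rw [← S.integral_sq_rpow_half ht']
    exact integral_cube_mono (hsm.continuous.pow 2) (cw.mul (hsm.continuous.pow 2)) fun x =>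
      le_mul_of_one_le_left (sq_nonneg _) (S.one_le_weight ht' β x)
  have h4 : 0 ≤ ∫ x in cube d, ‖∇ (fun y => m y t ^ (-r / 2)) x‖ ^ 2 :=
    integral_cube_nonneg fun x => sq_nonneg _
  have h5 : 0 ≤ ∫ x in cube d, m x t ^ (-r) := integral_cube_nonneg fun x =>
    (Real.rpow_pos_of_pos (S.m_pos x t ht') _).le
  set J := ∫ x in cube d, (1 + m x t ^ α + m x t ^ (-β)) * (m x t ^ (-r / 2)) ^ 2
  have h6 := mul_le_mul_of_nonneg_left h3 he
  have h7 : e * J ≤ e * r ^ (2 * j) * J := by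
    rw [mul_right_comm]
    exact le_mul_of_one_le_right (mul_nonneg he (h5.trans h3)) hR
  have h8 : (c + e) * r ^ (2 * j) * J = c * r ^ (2 * j) * J + e * r ^ (2 * j) * J := by ring
  linarith

theorem rpow_neg_initial_le {r : ℝ} (hr : 0 ≤ r) (x : E d) : m x 0 ^ (-r) ≤ K.bound ^ r := by
  have hB := K.one_le_bound
  have h1 : K.bound⁻¹ ≤ m x 0 := by
    rw [S.initial]
    exact K.inv_bound_le_k₀.trans (A.m₀_lower x)
  have h2 := Real.rpow_le_rpow_of_nonpos (by positivity : 0 < K.bound⁻¹) h1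
    (by linarith : -r ≤ 0)
  rwa [Real.inv_rpow (by linarith), ← Real.rpow_neg (by linarith), neg_neg] at h2

theorem integral_mul_rpow_neg_initial_le (hT : 0 < T) {a κ r : ℝ} (hr : 0 ≤ r) (hκ : 0 ≤ κ)
    (hu2 : ∀ x, ∀ t ∈ Icc 0 T, a - u x t ≤ κ) :
    ∫ x in cube d, (a - u x 0) * m x 0 ^ (-r) ≤ κ * K.bound ^ r := by
  have h0 : (0 : ℝ) ∈ Icc 0 T := ⟨le_rfl, hT.le⟩
  rw [← integral_cube_const (d := d) (κ * K.bound ^ r)]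
  exact integral_cube_mono ((continuous_const.sub (S.contDiff_u h0).continuous).mul
    (S.continuous_rpow_m h0 _)) continuous_const fun x =>
      mul_le_mul (hu2 x 0 h0) (S.rpow_neg_initial_le A hr x)
        (Real.rpow_pos_of_pos (S.m_pos x 0 h0) _).le hκ

omit A in
theorem integral_rpow_neg_le {a : ℝ} (hu1 : ∀ x, ∀ t ∈ Icc 0 T, 1 ≤ a - u x t) (r : ℝ) {t : ℝ}
    (ht : t ∈ Icc 0 T) :
    ∫ x in cube d, m x t ^ (-r) ≤ ∫ x in cube d, (a - u x t) * m x t ^ (-r) :=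
  integral_cube_mono (S.continuous_rpow_m ht _) ((continuous_const.sub
    (S.contDiff_u ht).continuous).mul (S.continuous_rpow_m ht _)) fun x =>
      le_mul_of_one_le_left (Real.rpow_pos_of_pos (S.m_pos x t ht) _).le (hu1 x t ht)

/-- The negative moment of order `1 + β p` stays bounded on a short time interval, as it satisfies
a superlinear differential inequality. -/
theorem integral_rpow_neg_le_of_short_time (hd : 1 ≤ d) (hα : 0 ≤ α) (hγ : 1 < γ) (hγ2 : γ < 2)
    (hγ' : 1 < γ') (hT : 0 < T) {a κ : ℝ} (hκ : 0 ≤ κ)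
    (hu1 : ∀ x, ∀ t ∈ Icc 0 T, 1 ≤ a - u x t) (hu2 : ∀ x, ∀ t ∈ Icc 0 T, a - u x t ≤ κ)
    {j β c : ℝ} (hj : j = 1 / (1 - 2 * (γ - 1) / γ))
    (hβ : β = α * (2 * (γ - 1) / γ) / (1 - 2 * (γ - 1) / γ))
    (hc : c = 4 * K.bound + (8 * K.bound ^ 2) ^ (1 / (1 - 1 / γ)) + 8 * κ * K.bound ^ 2
      + (32 * κ * K.bound ^ 3) ^ j) (hj0 : 0 ≤ j) (hβ0 : 0 ≤ β) (hc1 : 1 ≤ c)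
    {p k C R y₀ : ℝ} (hp : 1 ≤ p) (hαp : α * p ≤ 1 + α) (hk : 1 ≤ k) (hC : 1 ≤ C)
    (hsob : WeightedSobolev d p k C) (hR0 : 0 ≤ R)
    (hR : ∀ t ∈ Icc 0 T, ∫ x in cube d, m x t ^ (1 + α) ≤ R)
    (hy₀ : y₀ = 3 * (3 + (R + κ * K.bound ^ (1 + β * p)))) {b : ℝ} (hbT : b ≤ T)
    (hb : k * (3 * (C * (c * (1 + β * p) ^ (2 * j)) ^ (k + 1))) * b ≤ y₀ ^ (-k) / 2) {t : ℝ}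
    (ht : t ∈ Icc 0 b) :
    3 * (3 + (R + ∫ x in cube d, m x t ^ (-(1 + β * p)))) ≤ 2 * y₀ := by
  set r := 1 + β * p with hr
  have hr1 : 1 ≤ r := by
    have : 0 ≤ β * p := by positivity
    linarith
  have hPsm : ContDiffOn ℝ ∞ (fun y : ℝ => a - y) univ := contDiffOn_const.sub contDiffOn_id
  have hcont := S.continuousOn_integral hPsm (fun _ _ _ => mem_univ _) (-r)
  have hder := fun t (ht : t ∈ Ioo 0 T) => S.hasDerivAt_integral A hd isOpen_univ hPsm
    (fun _ _ _ => mem_univ _) (-r) ht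
  set Φ : ℝ → ℝ := fun t => ∫ x in cube d, (a - u x t) * m x t ^ (-r) with hΦ
  have hle : ∀ t ∈ Icc 0 T, ∫ x in cube d, m x t ^ (-r) ≤ Φ t :=
    fun t ht => S.integral_rpow_neg_le hu1 r ht
  have hnn : ∀ t ∈ Icc 0 T, 0 ≤ ∫ x in cube d, m x t ^ (-r) := fun t ht =>
    integral_cube_nonneg fun x => (Real.rpow_pos_of_pos (S.m_pos x t ht) _).le
  have hsub : Icc 0 b ⊆ Icc 0 T := Icc_subset_Icc_right hbT
  have hsub' : Ioo 0 b ⊆ Ioo 0 T := Ioo_subset_Ioo_right hbT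
  have hr0 : 0 < c * r ^ (2 * j) := mul_pos (by linarith) (Real.rpow_pos_of_pos (by linarith) _)
  have key := le_two_mul_of_hasDerivAt_le_rpow (N := k + 1) (y₀ := y₀) (b := b)
    (C := 3 * (C * (c * r ^ (2 * j)) ^ (k + 1))) (f := fun t => 3 * (3 + (R + Φ t)))
    (by linarith)
    (mul_pos three_pos (mul_pos (by linarith) (Real.rpow_pos_of_pos hr0 _)))
    (continuousOn_const.mul (continuousOn_const.add (continuousOn_const.add (hcont.mono hsub))))
    (fun t ht => (((hder t (hsub' ht)).const_add R).const_add 3).const_mul 3)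
    (fun t ht => by
      have h1 := hle t (hsub ht)
      have h2 := hnn t (hsub ht)
      linarith)
    (fun t ht => ?_) ?_ (by rwa [add_sub_cancel_right]) ht
  · have h1 := hle t (hsub ht)
    linarith
  · have ht1 := hsub' ht
    have ht' := Ioo_subset_Icc_self ht1
    have h1 := hle t ht'
    have h2 := hnn t ht'
    have hw := S.integral_weight_rpow_le (R := R + Φ t) hα hp hαp hβ0 ht'
      (add_le_add (hR t ht') h1) (by linarith)
    have h3 := S.integral_rate_neg_rpow_m_add_le A hγ hγ2 hγ' hu1 hu2 hj hβ hc hj0 hc1 hsob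
      (by linarith) (le_refl 0) hr1 ht1 hw
    have h4 := sq_integral_cube_le (S.continuous_rpow_m ht' (-r / 2))
    rw [S.integral_sq_rpow_half ht'] at h4
    have hy0 : 0 < 3 * (3 + (R + Φ t)) := by linarith
    set y := 3 * (3 + (R + Φ t)) with hy
    have h5 : (∫ x in cube d, m x t ^ (-r / 2)) ^ 2 ≤ y := by linarith
    have hX : 0 ≤ C * (c * r ^ (2 * j)) ^ (k + 1) :=
      mul_nonneg (by linarith) (Real.rpow_pos_of_pos hr0 _).le
    have hyk : 0 ≤ y ^ k := (Real.rpow_pos_of_pos hy0 _).le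
    have h6 := mul_le_mul_of_nonneg_left h5 (mul_nonneg hX hyk)
    rw [zero_mul, add_zero, add_zero] at h3
    show 3 * (∫ x in cube d, rate α D u m (fun y => a - y) (-r) x t)
      ≤ 3 * (C * (c * r ^ (2 * j)) ^ (k + 1)) * y ^ (k + 1)
    rw [Real.rpow_add hy0, Real.rpow_one]
    linarith
  · have h1 := S.integral_mul_rpow_neg_initial_le A hT (by linarith : 0 ≤ r) hκ hu2
    show 3 * (3 + (R + Φ 0)) ≤ y₀
    rw [hy₀]
    have h2 : Φ 0 ≤ κ * K.bound ^ r := h1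
    linarith

/-- Moser iteration for the negative powers of the density: a bound for the moment of order
`1 + β p` improves to a pointwise bound. -/
theorem rpow_neg_le_of_integral_le (hd : 1 ≤ d) (hα : 0 ≤ α) (hγ : 1 < γ) (hγ2 : γ < 2)
    (hγ' : 1 < γ') (hT : 0 < T) {a κ : ℝ} (hκ : 1 ≤ κ)
    (hu1 : ∀ x, ∀ t ∈ Icc 0 T, 1 ≤ a - u x t) (hu2 : ∀ x, ∀ t ∈ Icc 0 T, a - u x t ≤ κ)
    {j β c : ℝ} (hj : j = 1 / (1 - 2 * (γ - 1) / γ))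
    (hβ : β = α * (2 * (γ - 1) / γ) / (1 - 2 * (γ - 1) / γ))
    (hc : c = 4 * K.bound + (8 * K.bound ^ 2) ^ (1 / (1 - 1 / γ)) + 8 * κ * K.bound ^ 2
      + (32 * κ * K.bound ^ 3) ^ j) (hj0 : 0 ≤ j) (hβ0 : 0 ≤ β) (hc1 : 1 ≤ c)
    {p k C R M Q : ℝ} (hp : 1 ≤ p) (hαp : α * p ≤ 1 + α)
    (hsob : WeightedSobolev d p k C) (hR0 : 0 ≤ R)
    (hR : ∀ t ∈ Icc 0 T, ∫ x in cube d, m x t ^ (1 + α) ≤ R) {b : ℝ} (hbT : b ≤ T)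
    (hQ : 1 ≤ Q) (hQn : ∀ n : ℕ, C * M ^ k * (c + κ) ^ (k + 1)
      * ((1 + β * p) * 2 ^ (n + 1)) ^ (2 * j * (k + 1)) ≤ Q ^ (n + 1))
    (hM0 : κ * K.bound ^ (1 + β * p) ≤ M)
    (hM : ∀ t ∈ Icc 0 b, 3 * (3 + (R + ∫ x in cube d, m x t ^ (-(1 + β * p)))) ≤ M)
    (x : E d) {t : ℝ} (ht : t ∈ Icc 0 b) : m x t ^ (-(1 + β * p)) ≤ Q ^ 2 * M := by
  set r₁ := 1 + β * p with hr₁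
  have hB := K.one_le_bound
  have hr₁1 : 1 ≤ r₁ := by
    have : 0 ≤ β * p := by positivity
    linarith
  have hsub : Icc 0 b ⊆ Icc 0 T := Icc_subset_Icc_right hbT
  have hsub' : Ioo 0 b ⊆ Ioo 0 T := Ioo_subset_Ioo_right hbT
  have hnn : ∀ r : ℝ, ∀ t ∈ Icc 0 T, 0 ≤ ∫ x in cube d, m x t ^ (-r) := fun r t ht =>
    integral_cube_nonneg fun x => (Real.rpow_pos_of_pos (S.m_pos x t ht) _).le
  have hM1 : 1 ≤ M := by
    have h1 := hM t ht
    have h2 := hnn r₁ t (hsub ht)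
    linarith
  have hmom : ∀ n : ℕ, ∀ t ∈ Icc 0 b,
      ∫ x in cube d, m x t ^ (-(r₁ * 2 ^ n)) ≤ (Q ^ 2 * M) ^ 2 ^ n := by
    refine moment_recursion hQ hM1 (fun t ht => ?_) (fun n c' hc' hn t ht => ?_)
    · have h1 := hM t ht
      have h2 := hnn r₁ t (hsub ht)
      simp only [pow_zero, mul_one]
      linarith
    set r := r₁ * 2 ^ (n + 1) with hr
    have hr1 : 1 ≤ r := one_le_mul_of_one_le_of_one_le hr₁1 (one_le_pow₀ (by norm_num))
    have hr2 : -r / 2 = -(r₁ * 2 ^ n) := by rw [hr, pow_succ]; ring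
    have hPsm : ContDiffOn ℝ ∞ (fun y : ℝ => a - y) univ := contDiffOn_const.sub contDiffOn_id
    have hcont := S.continuousOn_integral hPsm (fun _ _ _ => mem_univ _) (-r)
    have hder := fun t (ht : t ∈ Ioo 0 T) => S.hasDerivAt_integral A hd isOpen_univ hPsm
      (fun _ _ _ => mem_univ _) (-r) ht
    refine (S.integral_rpow_neg_le hu1 r (hsub ht)).trans ?_
    have key := le_max_of_hasDerivAt_le (c := Q ^ (n + 1) * c' ^ 2) (hcont.mono hsub)
      (fun t ht => hder t (hsub' ht)) (fun t ht => ?_) ht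
    · refine key.trans (max_le_max ?_ le_rfl)
      refine (S.integral_mul_rpow_neg_initial_le A hT (by linarith : 0 ≤ r) (by linarith)
        hu2).trans ?_
      rw [hr, rpow_mul_two_pow (by linarith)]
      calc κ * (K.bound ^ r₁) ^ 2 ^ (n + 1)
          ≤ κ ^ 2 ^ (n + 1) * (K.bound ^ r₁) ^ 2 ^ (n + 1) :=
            mul_le_mul_of_nonneg_right (le_self_pow₀ hκ (by positivity)) (by positivity)
        _ = (κ * K.bound ^ r₁) ^ 2 ^ (n + 1) := (mul_pow _ _ _).symm
        _ ≤ M ^ 2 ^ (n + 1) := pow_le_pow_left₀ (by positivity) hM0 _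
    · have ht1 := hsub' ht
      have ht' := Ioo_subset_Icc_self ht1
      have htb := Ioo_subset_Icc_self ht
      have hw := S.integral_weight_rpow_le hα hp hαp hβ0 ht'
        (add_le_add (hR t ht') le_rfl) (add_nonneg hR0 (hnn _ t ht'))
      have hw' := hw.trans (Real.rpow_le_rpow (by linarith [hnn r₁ t ht']) (hM t htb)
        (by linarith))
      have h3 := S.integral_rate_neg_rpow_m_add_le A hγ hγ2 hγ' hu1 hu2 hj hβ hc hj0 hc1 hsob
        hM1 (by linarith : 0 ≤ κ) hr1 ht1 hw'
      have h4 : ∫ x in cube d, m x t ^ (-r / 2) ≤ c' := by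
        rw [hr2]
        exact hn t htb
      have h5 : 0 ≤ ∫ x in cube d, m x t ^ (-r / 2) := by
        rw [neg_div]
        exact hnn (r / 2) t ht'
      have h6 : ∫ x in cube d, (a - u x t) * m x t ^ (-r) ≤ κ * ∫ x in cube d, m x t ^ (-r) := by
        rw [← integral_const_mul]
        exact integral_cube_mono ((continuous_const.sub (S.contDiff_u ht').continuous).mul
          (S.continuous_rpow_m ht' _)) (continuous_const.mul (S.continuous_rpow_m ht' _))
          fun x => mul_le_mul_of_nonneg_right (hu2 x t ht')
            (Real.rpow_pos_of_pos (S.m_pos x t ht') _).le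
      have h7 : C * M ^ k * ((c + κ) * r ^ (2 * j)) ^ (k + 1)
          * (∫ x in cube d, m x t ^ (-r / 2)) ^ 2 ≤ Q ^ (n + 1) * c' ^ 2 := by
        refine mul_le_mul ?_ (pow_le_pow_left₀ h5 h4 2) (sq_nonneg _) (by positivity)
        rw [Real.mul_rpow (by linarith) (Real.rpow_nonneg (by linarith) _),
          ← Real.rpow_mul (by linarith), ← mul_assoc]
        exact hQn n
      linarith
  refine le_of_moments_le (W := fun x => m x t ^ (-r₁)) (S.continuous_rpow_m (hsub ht) _)
    ((S.m_periodic t (hsub ht)).comp fun s => s ^ (-r₁))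
    (fun x => (Real.rpow_pos_of_pos (S.m_pos x t (hsub ht)) _).le) (by positivity) (fun n => ?_) x
  have := hmom n t ht
  simpa only [← neg_mul, rpow_mul_two_pow (S.m_pos _ t (hsub ht)).le] using this

end IsSmoothSolution

end CongestionMFG

theorem mainTheorem2 (d : ℕ) (hd : 1 ≤ d) (α γ γ' : ℝ)
    (hγ : 1 < γ) (hγ' : 1 < γ') (hconj : 1 / γ + 1 / γ' = 1) (hsub : γ < 2)
    (hα : 0 ≤ α) (hα' : 3 ≤ d → α < 2 / ((d : ℝ) - 2))
    (K : CongestionMFG.Constants) (Tmax : ℝ) (hTmax : 0 < Tmax) :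
    ∃ T₀ C : ℝ, 0 < T₀ ∧ T₀ ≤ Tmax ∧
      ∀ T : ℝ, 0 < T → T ≤ Tmax →
      ∀ D : CongestionMFG.Data d, CongestionMFG.Assumptions γ γ' K T D →
      ∀ u m : CongestionMFG.E d → ℝ → ℝ, CongestionMFG.IsSmoothSolution α T D u m →
      ∀ (x : CongestionMFG.E d), ∀ t ∈ Set.Icc (0 : ℝ) (min T₀ T), |1 / m x t| ≤ C := by
  have hB := K.one_le_bound
  obtain ⟨p, k, C, hp, hαp, hk, hC, hsob⟩ := CongestionMFG.exists_weightedSobolev hd hα hα'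
  obtain ⟨R, hR1, henergy⟩ :=
    CongestionMFG.exists_energy_bound hd hα hα' hγ hsub hγ' K hTmax
  obtain ⟨U, hU0, hU⟩ := CongestionMFG.exists_u_le hd hα hα' hγ hsub hγ' K hTmax
  set s := CongestionMFG.shift K Tmax with hs
  have hs0 : 0 ≤ s := by rw [hs, CongestionMFG.shift]; positivity
  set κ := U + 1 + s with hκ
  have hκ1 : 1 ≤ κ := by linarith
  have hθ : 0 < 1 - 2 * (γ - 1) / γ := by
    rw [sub_pos, div_lt_one (by linarith)]
    linarith
  obtain ⟨j, hj⟩ : ∃ j, j = 1 / (1 - 2 * (γ - 1) / γ) := ⟨_, rfl⟩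
  obtain ⟨β, hβ⟩ : ∃ β, β = α * (2 * (γ - 1) / γ) / (1 - 2 * (γ - 1) / γ) := ⟨_, rfl⟩
  obtain ⟨c, hc⟩ : ∃ c, c = 4 * K.bound + (8 * K.bound ^ 2) ^ (1 / (1 - 1 / γ))
    + 8 * κ * K.bound ^ 2 + (32 * κ * K.bound ^ 3) ^ j := ⟨_, rfl⟩
  have hj0 : 0 ≤ j := by rw [hj]; positivity
  have hβ0 : 0 ≤ β := by
    rw [hβ]
    exact div_nonneg (mul_nonneg hα (div_nonneg (by linarith) (by linarith))) hθ.le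
  have hc1 : 1 ≤ c := by
    have h1 : 0 ≤ (8 * K.bound ^ 2) ^ (1 / (1 - 1 / γ)) := by positivity
    have h2 : 0 ≤ 8 * κ * K.bound ^ 2 := by positivity
    have h3 : 0 ≤ (32 * κ * K.bound ^ 3) ^ j := by positivity
    linarith
  set y₀ := 3 * (3 + (R + κ * K.bound ^ (1 + β * p))) with hy₀
  have hy₀0 : 0 < y₀ := by positivity
  have hM0 : κ * K.bound ^ (1 + β * p) ≤ 2 * y₀ := by
    have : 0 ≤ κ * K.bound ^ (1 + β * p) := by positivity
    linarith
  set G := k * (3 * (C * (c * (1 + β * p) ^ (2 * j)) ^ (k + 1))) with hG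
  have hG0 : 0 < G := by positivity
  obtain ⟨Q, hQ, hQn⟩ := CongestionMFG.exists_mul_rpow_le_pow
    (C * (2 * y₀) ^ k * (c + κ) ^ (k + 1)) (by positivity : 0 ≤ 1 + β * p)
    (by positivity : 0 ≤ 2 * j * (k + 1))
  -- the negative moment at most doubles before the time `y₀^{-k} / (2 G)`
  refine ⟨min Tmax (y₀ ^ (-k) / 2 / G), Q ^ 2 * (2 * y₀), lt_min hTmax (by positivity),
    min_le_left _ _, fun T hT hTm D A u m S x t ht => ?_⟩
  set b := min (min Tmax (y₀ ^ (-k) / 2 / G)) T with hb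
  have hbT : b ≤ T := min_le_right _ _
  have hbG : G * b ≤ y₀ ^ (-k) / 2 := by
    have : b ≤ y₀ ^ (-k) / 2 / G := (min_le_left _ _).trans (min_le_right _ _)
    rwa [le_div_iff₀' hG0] at this
  have hu1 : ∀ x, ∀ t ∈ Set.Icc 0 T, 1 ≤ U + 1 - u x t := fun x t ht => by
    linarith [hU T hT hTm D A u m S x t ht]
  have hu2 : ∀ x, ∀ t ∈ Set.Icc 0 T, U + 1 - u x t ≤ κ := fun x t ht => by
    linarith [S.one_le_u_add_shift A hT hTm ht x]
  have hE : ∀ t ∈ Set.Icc 0 T, ∫ x in CongestionMFG.cube d, m x t ^ (1 + α) ≤ R :=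
    fun t ht => (henergy T hT hTm D A u m S t ht).1
  have hmom := fun t ht => S.integral_rpow_neg_le_of_short_time A hd hα hγ hsub hγ' hT
    (by linarith) hu1 hu2 hj hβ hc hj0 hβ0 hc1 hp hαp hk hC hsob (by linarith) hE hy₀ hbT hbG
    (t := t) ht
  have hpt := S.rpow_neg_le_of_integral_le A hd hα hγ hsub hγ' hT hκ1 hu1 hu2 hj hβ hc hj0 hβ0
    hc1 hp hαp hsob (by linarith) hE hbT hQ hQn hM0 hmom x ht
  have hm := S.m_pos x t ⟨ht.1, ht.2.trans hbT⟩
  rw [abs_of_pos (by positivity)]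
  have hQM : 1 ≤ Q ^ 2 * (2 * y₀) := by
    refine one_le_mul_of_one_le_of_one_le (one_le_pow₀ hQ) ?_
    have : 0 ≤ κ * K.bound ^ (1 + β * p) := by positivity
    linarith
  -- `1 + β p ≥ 1`, so the power bounds `1 / m` where `m ≤ 1`
  rcases le_total 1 (m x t) with h1 | h1
  · exact (div_le_one hm).2 h1 |>.trans hQM
  · refine le_trans ?_ hpt
    rw [one_div, ← Real.rpow_neg_one]
    refine Real.rpow_le_rpow_of_exponent_ge hm h1 ?_
    have : 0 ≤ β * p := by positivity
    linarith
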